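/- **Phase diagram of the Riemann problem.** Let $0<b\le \frac1{2+\sqrt2}$ and let $$G(v)=-\frac{v^2}{2}+\frac{4b^2+(1-2b)^2v^2}{2\bigl(4b^2+(1-2b)\sqrt{4b^2+(1-4b)v^2}\bigr)},\qquad v\in[-1,1].$$ For $u_-\ne u_+$ in $[-1,1]$ consider $\partial_tu+\partial_xG(u)=0$ on $\mathbb R\times(0,\infty)$ with initial datum $u_-$ for $x\le0$ and $u_+$ for $x>0$. Solutions are $[-1,1]$-valued entropy solutions in the sense of Kruzhkov: for every constant $k\in[-1,1]$, $\partial_t|u-k|+\partial_x\bigl(\operatorname{sgn}(u-k)(G(u)-G(k))\bigr)\le0$ in the sense of distributions on $\mathbb R\times(0,\infty)$, and $u(\cdot,t)\to u_0$ in $L^1_{loc}$ as $t\downarrow0$ outside a null set of times. Then there is an entropy solution; it is unique up to null sets and has the form $u(x,t)=U(x/t)$. It is given by the envelope formula: if $u_->u_+$, then for every $\xi$ the value $U(\xi)\in[u_+,u_-]$ is one at which $\xi$ is a supergradient, relative to $[u_+,u_-]$, of the upper concave envelope of $G$ on $[u_+,u_-]$; if $u_-<u_+$, the same holds with subgradients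 of the lower convex envelope of $G$ on $[u_-,u_+]$. Moreover $U$ has one of the following wave patterns, read from left to right (as $\xi=x/t$ increases from $-\infty$, where $U=u_-$, to $+\infty$, where $U=u_+$). S is a shock, i.e. a jump from a state $a$ to a state $c\neq a$ at the speed $\frac{G(c)-G(a)}{c-a}$. R is a rarefaction fan from $a$ to $c$, i.e. $U$ is continuous and strictly monotone with $G'(U(\xi))=\xi$ for $G'(a)<\xi<G'(c)$, with limits $a$ and $c$ at the ends. Consecutive waves are adjacent (no constant state in between). **(1)** If $b\ge\frac16$, the pattern is S for $u_-<u_+$ and R for $u_->u_+$. **(2)** Let $b<\frac16$ and $$v_{\rm infl}=\sqrt{\tfrac{(2b^2(1-2b))^{2/3}-4b^2}{1-4b}},\qquad v_{\max}=\tfrac12\sqrt{\tfrac{(1+2b)(1-6b)}{1-4b}}.$$ A tangency point from $v$ is an $e\in[-1,1]$, $e\ne v$, with $G(v)=G(e)+G'(e)(v-e)$. Let $v_e(v)$ be the tangency point closest to $v$ and $v_e^+(v)$ the one farthest from $v$ (if there is none, both are $+\infty$ for $v<0$ and $-\infty$ for $v\geq 0$), and let $v_e^{\rm r}(v)$, $v_e^{\rm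 l}(v)$ be the rightmost and the leftmost tangency point. Let $v_m^{+}(e)$ [$v_m^-(e)$] be the first point of $[-1,1]$ to the right [left] of $e$ at which the tangent line of $G$ at $e$ meets the graph of $G$ ($+\infty$ [$-\infty$] if there is none). Then every pair $(u_-,u_+)\in[-1,1]^2$, $u_-\ne u_+$, lies in exactly one of the following regions, and the solution has the pattern after which the region is named. * **S.** If $u_-<u_+$: $u_-<-v_{\rm infl}$ and [$v_e(u_-)\ge v_{\rm infl}$ or $u_+\ge v_m^+(v_e(u_-))$]; or $u_+>v_{\rm infl}$ and [$v_e(u_+)\le -v_{\rm infl}$ or $u_-\le v_m^-(v_e(u_+))$]; or $u_-<-v_{\rm infl}$ and $u_+\le v_e(u_-)$; or $u_+>v_{\rm infl}$ and $u_-\ge v_e(u_+)$. If $u_->u_+$: $u_-,u_+\in[-v_{\rm infl},v_{\rm infl}]$; or $v_{\rm infl}\le u_-\le v_{\max}$ and $v_e^+(u_-)\le u_+\le v_m^-(u_-)$; or $-v_{\max}\le u_+\le -v_{\rm infl}$ and $v_m^+(u_+)\le u_-\le v_e^+(u_+)$. * **R.** $u_-<u_+$ and $u_-,u_+\in[-v_{\rm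 infl},v_{\rm infl}]$; or $u_->u_+$ and either $u_-,u_+\in[-1,-v_{\rm infl}]$ or $u_-,u_+\in[v_{\rm infl},1]$. * **RS.** $u_-<u_+$, $v_{\rm infl}<u_+\le1$, $-v_{\rm infl}\le u_-<v_e(u_+)$; or $u_->u_+$, $-v_{\max}\le u_+<v_{\rm infl}$, $v_e^{\rm r}(u_+)<u_-\le1$. * **SR.** $u_-<u_+$, $-1\le u_-<-v_{\rm infl}$, $v_e(u_-)<u_+\le v_{\rm infl}$; or $u_->u_+$, $-v_{\rm infl}<u_-\le v_{\max}$, $-1\le u_+<v_e^{\rm l}(u_-)$. * **RSR.** $u_->v_{\max}$ and $u_+<-v_{\max}$. Here the middle shock goes from $v_{\max}$ to $-v_{\max}$ and has zero speed: $\lim_{x\to0^+}u(x,t)-\lim_{x\to0^-}u(x,t)=-2v_{\max}$ for all $t>0$. * **SRS.** $-1\le u_-<-v_{\rm infl}$, $v_e(u_-)<v_{\rm infl}$ and $v_{\rm infl}<u_+<v_m^+(v_e(u_-))$. Here the second shock is faster than the first one. -/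

import Mathlib

open Set Filter Topology MeasureTheory
open scoped ContDiff

noncomputable section

namespace RiemannPhase

/-- The hydrodynamic flux `G` of the model with `d = 0` (used on `[-1, 1]`). -/
def flux (b v : ℝ) : ℝ :=
  -v ^ 2 / 2 + (4 * b ^ 2 + (1 - 2 * b) ^ 2 * v ^ 2) /
    (2 * (4 * b ^ 2 + (1 - 2 * b) * Real.sqrt (4 * b ^ 2 + (1 - 4 * b) * v ^ 2)))

/-- The positive inflection point of the flux, for `0 < b < 1/6`. -/
def vInfl (b : ℝ) : ℝ :=
  Real.sqrt (((2 * b ^ 2 * (1 - 2 * b)) ^ ((2 : ℝ) / 3) - 4 * b ^ 2) / (1 - 4 * b))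

/-- The positive maximum point of the flux, for `0 < b < 1/6`. -/
def vMax (b : ℝ) : ℝ :=
  1 / 2 * Real.sqrt ((1 + 2 * b) * (1 - 6 * b) / (1 - 4 * b))

/-- The step initial datum. -/
def step (uL uR x : ℝ) : ℝ := if x ≤ 0 then uL else uR

/-- The open upper half plane of points `(x, t)` with `t > 0`. -/
def upperHalf : Set (ℝ × ℝ) := {p | 0 < p.2}

/-- Kruzhkov entropy solutions `u x t`, with values in `[-1, 1]`, of
`∂ₜ u + ∂ₓ G(u) = 0` for `t > 0`, `u = u₀` at `t = 0`: the entropy inequality for every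
constant `k` (the values `k = ±1` contain the weak formulation), and the initial datum attained
in `L¹_loc` as `t ↓ 0` outside a null set of times. -/
structure IsEntropySolution (G : ℝ → ℝ) (u₀ : ℝ → ℝ) (u : ℝ → ℝ → ℝ) : Prop where
  aemeasurable : AEMeasurable (fun p : ℝ × ℝ => u p.1 p.2) (volume.restrict upperHalf)
  mem_Icc : ∀ᵐ p : ℝ × ℝ ∂(volume.restrict upperHalf), u p.1 p.2 ∈ Icc (-1 : ℝ) 1
  entropy : ∀ k ∈ Icc (-1 : ℝ) 1, ∀ φ : ℝ × ℝ → ℝ, ContDiff ℝ ∞ φ → HasCompactSupport φ →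
    tsupport φ ⊆ upperHalf → (∀ p, 0 ≤ φ p) →
    0 ≤ ∫ p in upperHalf,
      (|u p.1 p.2 - k| * fderiv ℝ φ p (0, 1)
        + Real.sign (u p.1 p.2 - k) * (G (u p.1 p.2) - G k) * fderiv ℝ φ p (1, 0))
  initial : ∀ R : ℝ, 0 < R →
    Tendsto (fun t => ∫ x in Icc (-R) R, |u x t - u₀ x|) (𝓝[>] (0 : ℝ) ⊓ ae volume) (𝓝 0)

/-! ### Tangency and intersection points -/

/-- The points `e ≠ v` of `[-1, 1]` such that the tangent line of `G` at `e` passes through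
`(v, G v)`. -/
def tangencyPoints (b v : ℝ) : Set ℝ :=
  {e | e ∈ Icc (-1 : ℝ) 1 ∧ e ≠ v ∧ flux b v = flux b e + deriv (flux b) e * (v - e)}

open Classical in
/-- `v_e(v) = v_e⁻(v)`: the tangency point closest to `v`. If there is none, it is `+∞` for `v < 0`
and `-∞` otherwise. -/
def vE (b v : ℝ) : EReal :=
  if h : ∃ e ∈ tangencyPoints b v, ∀ e' ∈ tangencyPoints b v, |e - v| ≤ |e' - v| then
    ((h.choose : ℝ) : EReal)
  else if v < 0 then ⊤ else ⊥

open Classical in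
/-- `v_e⁺(v)`: the tangency point farthest from `v`, with the same convention. -/
def vEFar (b v : ℝ) : EReal :=
  if h : ∃ e ∈ tangencyPoints b v, ∀ e' ∈ tangencyPoints b v, |e' - v| ≤ |e - v| then
    ((h.choose : ℝ) : EReal)
  else if v < 0 then ⊤ else ⊥

/-- The rightmost tangency point. -/
def vERight (b v : ℝ) : EReal := sSup ((fun e : ℝ => (e : EReal)) '' tangencyPoints b v)

/-- The leftmost tangency point. -/
def vELeft (b v : ℝ) : EReal := sInf ((fun e : ℝ => (e : EReal)) '' tangencyPoints b v)

/-- The points of `[-1, 1]` at which the graph of `G` meets its tangent line at `e`. -/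
def tangentHits (b e : ℝ) : Set ℝ :=
  {v | v ∈ Icc (-1 : ℝ) 1 ∧ flux b v = flux b e + deriv (flux b) e * (v - e)}

/-- `v_m⁺(e)`: the first intersection to the right of `e`, `+∞` if there is none. -/
def vMRight (b e : ℝ) : EReal :=
  sInf ((fun v : ℝ => (v : EReal)) '' {v | v ∈ tangentHits b e ∧ e < v})

/-- `v_m⁻(e)`: the first intersection to the left of `e`, `-∞` if there is none. -/
def vMLeft (b e : ℝ) : EReal :=
  sSup ((fun v : ℝ => (v : EReal)) '' {v | v ∈ tangentHits b e ∧ v < e})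

/-! ### Envelopes -/

/-- The upper concave envelope of `G` on `[a, c]`: the smallest concave function above `G`. -/
def upperEnvelope (G : ℝ → ℝ) (a c v : ℝ) : ℝ :=
  sInf {y | ∃ g : ℝ → ℝ, ConcaveOn ℝ (Icc a c) g ∧ (∀ w ∈ Icc a c, G w ≤ g w) ∧ y = g v}

/-- The lower convex envelope of `G` on `[a, c]`: the largest convex function below `G`. -/
def lowerEnvelope (G : ℝ → ℝ) (a c v : ℝ) : ℝ :=
  sSup {y | ∃ g : ℝ → ℝ, ConvexOn ℝ (Icc a c) g ∧ (∀ w ∈ Icc a c, g w ≤ G w) ∧ y = g v}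

/-- The envelope formula: `U ξ` is a value in the interval between `uL` and `uR` at which `ξ` is a
slope (super- or subgradient relative to that interval) of the relevant envelope. This is the
inverse of the monotone derivative of the envelope, with its multivalued meaning at shock speeds,
and it gives the constant states beyond the extreme slopes. -/
def EnvelopeFormula (G U : ℝ → ℝ) (uL uR : ℝ) : Prop :=
  (uR < uL → ∀ ξ, U ξ ∈ Icc uR uL ∧ ∀ w ∈ Icc uR uL,
    upperEnvelope G uR uL w ≤ upperEnvelope G uR uL (U ξ) + ξ * (w - U ξ)) ∧
  (uL < uR → ∀ ξ, U ξ ∈ Icc uL uR ∧ ∀ w ∈ Icc uL uR,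
    lowerEnvelope G uL uR (U ξ) + ξ * (w - U ξ) ≤ lowerEnvelope G uL uR w)

/-! ### Self-similar wave patterns `u x t = U (x / t)` -/

/-- The Rankine--Hugoniot speed of a jump between `a` and `c`. -/
def shockSpeed (G : ℝ → ℝ) (a c : ℝ) : ℝ := (G c - G a) / (c - a)

/-- `U` jumps from `a` (on the left) to `c ≠ a` at the Rankine--Hugoniot speed. -/
def HasShock (G U : ℝ → ℝ) (a c : ℝ) : Prop :=
  a ≠ c ∧ Tendsto U (𝓝[<] shockSpeed G a c) (𝓝 a) ∧ Tendsto U (𝓝[>] shockSpeed G a c) (𝓝 c)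

/-- Between the speeds `G' a < G' c` the profile `U` is a rarefaction fan leading continuously and
strictly monotonically from `a` to `c`, with characteristic speed `G' (U ξ) = ξ`. -/
def HasFan (G U : ℝ → ℝ) (a c : ℝ) : Prop :=
  deriv G a < deriv G c ∧
  Tendsto U (𝓝[>] deriv G a) (𝓝 a) ∧ Tendsto U (𝓝[<] deriv G c) (𝓝 c) ∧
  ContinuousOn U (Ioo (deriv G a) (deriv G c)) ∧
  (StrictMonoOn U (Ioo (deriv G a) (deriv G c)) ∨
    StrictAntiOn U (Ioo (deriv G a) (deriv G c))) ∧
  ∀ ξ ∈ Ioo (deriv G a) (deriv G c), deriv G (U ξ) = ξ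

/-- Wave patterns, read from left to right: `S` shock, `R` rarefaction fan. -/
inductive Pattern
  | S | R | RS | SR | RSR | SRS

/-- A single shock from `uL` to `uR`. -/
def IsS (G U : ℝ → ℝ) (uL uR : ℝ) : Prop :=
  HasShock G U uL uR ∧
  (∀ ξ < shockSpeed G uL uR, U ξ = uL) ∧ (∀ ξ > shockSpeed G uL uR, U ξ = uR)

/-- A single rarefaction fan from `uL` to `uR`. -/
def IsR (G U : ℝ → ℝ) (uL uR : ℝ) : Prop :=
  HasFan G U uL uR ∧
  (∀ ξ ≤ deriv G uL, U ξ = uL) ∧ (∀ ξ ≥ deriv G uR, U ξ = uR)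

/-- A fan from `uL` to `m`, followed immediately by a shock from `m` to `uR`. -/
def IsRS (G U : ℝ → ℝ) (uL m uR : ℝ) : Prop :=
  HasFan G U uL m ∧ HasShock G U m uR ∧ deriv G m = shockSpeed G m uR ∧
  (∀ ξ ≤ deriv G uL, U ξ = uL) ∧ (∀ ξ > shockSpeed G m uR, U ξ = uR)

/-- A shock from `uL` to `m`, followed immediately by a fan from `m` to `uR`. -/
def IsSR (G U : ℝ → ℝ) (uL m uR : ℝ) : Prop :=
  HasShock G U uL m ∧ HasFan G U m uR ∧ shockSpeed G uL m = deriv G m ∧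
  (∀ ξ < shockSpeed G uL m, U ξ = uL) ∧ (∀ ξ ≥ deriv G uR, U ξ = uR)

/-- A fan from `uL` to `m`, a shock from `m` to `n`, a fan from `n` to `uR`. -/
def IsRSR (G U : ℝ → ℝ) (uL m n uR : ℝ) : Prop :=
  HasFan G U uL m ∧ HasShock G U m n ∧ HasFan G U n uR ∧
  deriv G m = shockSpeed G m n ∧ shockSpeed G m n = deriv G n ∧
  (∀ ξ ≤ deriv G uL, U ξ = uL) ∧ (∀ ξ ≥ deriv G uR, U ξ = uR)

/-- A shock from `uL` to `m`, a fan from `m` to `n`, a shock from `n` to `uR`; the second shock is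
faster than the first one. -/
def IsSRS (G U : ℝ → ℝ) (uL m n uR : ℝ) : Prop :=
  HasShock G U uL m ∧ HasFan G U m n ∧ HasShock G U n uR ∧
  shockSpeed G uL m = deriv G m ∧ deriv G n = shockSpeed G n uR ∧
  shockSpeed G uL m < shockSpeed G n uR ∧
  (∀ ξ < shockSpeed G uL m, U ξ = uL) ∧ (∀ ξ > shockSpeed G n uR, U ξ = uR)

/-- The profile `U` joins `uL` to `uR` by the given wave pattern. -/
def HasPattern (G U : ℝ → ℝ) (uL uR : ℝ) : Pattern → Prop
  | .S => IsS G U uL uR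
  | .R => IsR G U uL uR
  | .RS => ∃ m, IsRS G U uL m uR
  | .SR => ∃ m, IsSR G U uL m uR
  | .RSR => ∃ m n, IsRSR G U uL m n uR
  | .SRS => ∃ m n, IsSRS G U uL m n uR

/-! ### The regions of the phase diagram, for `0 < b < 1/6` -/

/-- The pair `(uL, uR) ∈ [-1, 1]²` lies in the region labelled by the given pattern. -/
def InRegion (b uL uR : ℝ) : Pattern → Prop
  | .S =>
      (uL < uR ∧
        ((uL < -vInfl b ∧
            ((vInfl b : EReal) ≤ vE b uL ∨ vMRight b (vE b uL).toReal ≤ (uR : EReal))) ∨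
          (vInfl b < uR ∧
            (vE b uR ≤ ((-vInfl b : ℝ) : EReal) ∨ (uL : EReal) ≤ vMLeft b (vE b uR).toReal)) ∨
          (uL < -vInfl b ∧ (uR : EReal) ≤ vE b uL) ∨
          (vInfl b < uR ∧ vE b uR ≤ (uL : EReal)))) ∨
      (uR < uL ∧
        ((uL ∈ Icc (-vInfl b) (vInfl b) ∧ uR ∈ Icc (-vInfl b) (vInfl b)) ∨
          (uL ∈ Icc (vInfl b) (vMax b) ∧
            vEFar b uL ≤ (uR : EReal) ∧ (uR : EReal) ≤ vMLeft b uL) ∨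
          (uR ∈ Icc (-vMax b) (-vInfl b) ∧
            vMRight b uR ≤ (uL : EReal) ∧ (uL : EReal) ≤ vEFar b uR)))
  | .R =>
      (uL < uR ∧ uL ∈ Icc (-vInfl b) (vInfl b) ∧ uR ∈ Icc (-vInfl b) (vInfl b)) ∨
      (uR < uL ∧
        ((uL ∈ Icc (-1) (-vInfl b) ∧ uR ∈ Icc (-1) (-vInfl b)) ∨
          (uL ∈ Icc (vInfl b) 1 ∧ uR ∈ Icc (vInfl b) 1)))
  | .RS =>
      (uL < uR ∧ uR ∈ Ioc (vInfl b) 1 ∧ -vInfl b ≤ uL ∧ (uL : EReal) < vE b uR) ∨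
      (uR < uL ∧ uR ∈ Ico (-vMax b) (vInfl b) ∧ vERight b uR < (uL : EReal) ∧ uL ≤ 1)
  | .SR =>
      (uL < uR ∧ uL ∈ Ico (-1) (-vInfl b) ∧ vE b uL < (uR : EReal) ∧ uR ≤ vInfl b) ∨
      (uR < uL ∧ uL ∈ Ioc (-vInfl b) (vMax b) ∧ -1 ≤ uR ∧ (uR : EReal) < vELeft b uL)
  | .RSR => vMax b < uL ∧ uR < -vMax b
  | .SRS =>
      uL ∈ Ico (-1) (-vInfl b) ∧ vInfl b < uR ∧
        vE b uL < (vInfl b : EReal) ∧ (uR : EReal) < vMRight b (vE b uL).toReal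

end RiemannPhase

end

/-! For decreasing data let `U ξ` be any maximizer of `G w - ξ w` over the interval between the two
states. The line of slope `ξ` through the graph point at `U ξ` is then a concave majorant touching
`G`, which gives the envelope formula. Increasing data reduce to this case through `u ↦ -u`, `G ↦
-G(-·)`, which preserves all wave speeds and hence the order of the waves.

Existence: comparing the maximizers at two speeds, and testing them against a constant `k` between
them, gives the entropy inequality in incremental form (`Profile`). Dividing by the increment and
passing to the limit yields an entropy inequality in `ξ` alone (`Profile.integral_le`). The
two-dimensional one follows by the substitution `x = ξ t` (`Profile.entropy`).

Uniqueness: a second entropy solution is tested with `k = U η` and a test function concentrated near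
the ray `x / t = η`. Integrating over `η` and using the one-variable inequality for `U` gives Kato's
inequality (`Profile.kato`). An energy estimate in backward cones of slope larger than the Lipschitz
constant then forces the difference to vanish (`Profile.unique`).

Wave patterns: a fan appears over states whose tangent lines stay strictly on the correct side of
the whole graph between the data (`FanCond`); a shock appears when a chord does. For `b ≥ 1/6` every
tangent line lies strictly above the graph elsewhere, so only single waves occur. For `b < 1/6` the
substitution `v = κ sinh x` turns the square root into `2b cosh x`. With `K = (1 - 2b)/(2b)`, the
excess of `G` at `x` over its tangent line at `y` has the sign of `K - hF x y`, where `hF x y = cosh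
y (1 + cosh (x + y))`; the excess over a chord has the sign of `hPhi - K`. The inflection and
maximum points become `2 cosh³ i = K` and `2 cosh m = K`. All tangency points and intersections are
roots of `hF = K`, and the phase diagram follows from three properties of `hF`: it increases with
`|y|` and `|x + y|`, is strictly convex in `y`, and is quasiconvex in `x` (`Small.ascending`,
`Small.descending`). -/

namespace RiemannPhase

/-! ### The Kruzhkov entropy flux -/

/-- The Kruzhkov entropy flux `sgn (u - k) (G u - G k)`. -/
noncomputable def kq (G : ℝ → ℝ) (u k : ℝ) : ℝ := Real.sign (u - k) * (G u - G k)

lemma kq_of_le {G : ℝ → ℝ} {u k : ℝ} (h : k ≤ u) : kq G u k = G u - G k := by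
  rcases h.eq_or_lt with rfl | h
  · simp [kq]
  · simp [kq, Real.sign_of_pos (sub_pos.2 h)]

lemma kq_of_ge {G : ℝ → ℝ} {u k : ℝ} (h : u ≤ k) : kq G u k = G k - G u := by
  rcases h.eq_or_lt with rfl | h
  · simp [kq]
  · simp [kq, Real.sign_of_neg (sub_neg.2 h)]

lemma kq_comm (G : ℝ → ℝ) (u k : ℝ) : kq G u k = kq G k u := by
  rcases le_total u k with h | h
  · rw [kq_of_ge h, kq_of_le h]
  · rw [kq_of_ge h, kq_of_le h]

/-- Lipschitz continuity on `[-1, 1]`. -/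
def LipOn (G : ℝ → ℝ) (L : ℝ) : Prop :=
  ∀ u ∈ Icc (-1 : ℝ) 1, ∀ w ∈ Icc (-1 : ℝ) 1, |G u - G w| ≤ L * |u - w|

lemma abs_kq_le {G : ℝ → ℝ} {L : ℝ} (hG : LipOn G L) {u k : ℝ} (hu : u ∈ Icc (-1 : ℝ) 1)
    (hk : k ∈ Icc (-1 : ℝ) 1) : |kq G u k| ≤ L * |u - k| := by
  rcases le_total u k with h | h
  · rw [kq_of_ge h, abs_sub_comm]; exact hG u hu k hk
  · rw [kq_of_le h]; exact hG u hu k hk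

lemma LipOn.nonneg {G : ℝ → ℝ} {L : ℝ} (hG : LipOn G L) : 0 ≤ L := by
  have h := hG 1 (by norm_num) 0 (by norm_num)
  have := abs_nonneg (G 1 - G 0)
  norm_num at h
  linarith

/-- If `u` is on one side of both constants, the difference is just `G k - G k'` up to sign. If `u`
separates them, `|u - k| + |u - k'| = |k - k'|` and the two bounds add up. This continuity in the
second argument is what lets the doubled variables be merged. -/
lemma abs_kq_sub_le {G : ℝ → ℝ} {L : ℝ} (hG : LipOn G L) {u k k' : ℝ} (hu : u ∈ Icc (-1 : ℝ) 1)
    (hk : k ∈ Icc (-1 : ℝ) 1) (hk' : k' ∈ Icc (-1 : ℝ) 1) :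
    |kq G u k - kq G u k'| ≤ L * |k - k'| := by
  have h0 := hG k hk k' hk'
  have h1 := hG u hu k hk
  have h2 := hG u hu k' hk'
  have key : ∀ {a b : ℝ}, |a| ≤ L * |u - k| → |b| ≤ L * |u - k'| →
      |u - k| + |u - k'| = |k - k'| → |a + b| ≤ L * |k - k'| := fun ha hb h => by
    rw [← h, mul_add]; exact (abs_add_le _ _).trans (add_le_add ha hb)
  rcases le_total u k with h | h <;> rcases le_total u k' with h' | h'
  · rw [kq_of_ge h, kq_of_ge h']; simpa using h0
  · rw [kq_of_ge h, kq_of_le h', sub_eq_add_neg]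
    refine key (by rwa [abs_sub_comm]) (by rwa [abs_neg]) ?_
    rw [abs_of_nonpos (by linarith), abs_of_nonneg (by linarith), abs_of_nonneg (by linarith)]
    ring
  · rw [kq_of_le h, kq_of_ge h', sub_eq_add_neg]
    refine key (by assumption) (by rwa [abs_neg, abs_sub_comm]) ?_
    rw [abs_of_nonneg (by linarith), abs_of_nonpos (by linarith), abs_of_nonpos (by linarith)]
    ring
  · rw [kq_of_le h, kq_of_le h']
    simpa [abs_sub_comm] using h0

/-! ### Profiles of self-similar entropy solutions -/

/-- A monotone profile between `uL` and `uR` satisfying the entropy inequality in incremental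
form. -/
structure Profile (G U : ℝ → ℝ) (uL uR : ℝ) : Prop where
  mem : ∀ ξ, U ξ ∈ Icc (-1 : ℝ) 1
  mono : Monotone U ∨ Antitone U
  bound : ∃ M, 0 < M ∧ (∀ ξ ≤ -M, U ξ = uL) ∧ ∀ ξ ≥ M, U ξ = uR
  -- This is the integrated form of `d q(U, k) ≤ ξ d|U - k|`. The error `(η₂ - η₁) |U η₂ - U η₁|`
  -- disappears after division by `η₂ - η₁` wherever `U` is continuous.
  incr : ∀ k ∈ Icc (-1 : ℝ) 1, ∀ η₁ η₂, η₁ ≤ η₂ → kq G (U η₂) k - kq G (U η₁) k ≤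
    η₁ * (|U η₂ - k| - |U η₁ - k|) + (η₂ - η₁) * |U η₂ - U η₁|

/-- `U ξ` maximizes `G w - ξ w` over `[a, c]`. -/
def MaxSel (G U : ℝ → ℝ) (a c : ℝ) : Prop :=
  ∀ ξ, U ξ ∈ Icc a c ∧ ∀ w ∈ Icc a c, G w - ξ * w ≤ G (U ξ) - ξ * U ξ

/-- `U ξ` minimizes `G w - ξ w` over `[a, c]`. -/
def MinSel (G U : ℝ → ℝ) (a c : ℝ) : Prop :=
  ∀ ξ, U ξ ∈ Icc a c ∧ ∀ w ∈ Icc a c, G (U ξ) - ξ * U ξ ≤ G w - ξ * w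

lemma LipOn.continuousOn {G : ℝ → ℝ} {L : ℝ} (hG : LipOn G L) : ContinuousOn G (Icc (-1) 1) := by
  have : LipschitzOnWith ⟨L, hG.nonneg⟩ G (Icc (-1) 1) :=
    LipschitzOnWith.of_dist_le_mul fun x hx y hy => hG x hx y hy
  exact this.continuousOn

lemma exists_maxSel {G : ℝ → ℝ} {L : ℝ} (hG : LipOn G L) {a c : ℝ} (ha : -1 ≤ a) (hac : a ≤ c)
    (hc : c ≤ 1) : ∃ U, MaxSel G U a c := by
  have hcont : ContinuousOn G (Icc a c) := hG.continuousOn.mono (Icc_subset_Icc ha hc)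
  have : ∀ ξ : ℝ, ∃ u ∈ Icc a c, ∀ w ∈ Icc a c, G w - ξ * w ≤ G u - ξ * u := fun ξ => by
    obtain ⟨u, hu, h⟩ := isCompact_Icc.exists_isMaxOn (nonempty_Icc.2 hac)
      (hcont.sub (by fun_prop : ContinuousOn (fun w => ξ * w) (Icc a c)))
    exact ⟨u, hu, fun w hw => h hw⟩
  choose U hU h using this
  exact ⟨U, fun ξ => ⟨hU ξ, h ξ⟩⟩

/-- Adding the optimality of `U η₁` tested with `U η₂` and the converse cancels `G` and leaves `(η₂
- η₁)(U η₂ - U η₁) ≤ 0`. -/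
lemma MaxSel.antitone {G U : ℝ → ℝ} {a c : ℝ} (h : MaxSel G U a c) : Antitone U := by
  intro η₁ η₂ h12
  rcases h12.eq_or_lt with rfl | h12
  · rfl
  have h1 := (h η₁).2 _ (h η₂).1
  have h2 := (h η₂).2 _ (h η₁).1
  by_contra! hlt
  nlinarith [mul_pos (sub_pos.2 h12) (sub_pos.2 hlt)]

lemma MaxSel.profile {G U : ℝ → ℝ} {L : ℝ} (hG : LipOn G L) {a c : ℝ} (ha : -1 ≤ a)
    (hac : a ≤ c) (hc : c ≤ 1) (h : MaxSel G U a c) : Profile G U c a where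
  mem ξ := ⟨ha.trans (h ξ).1.1, (h ξ).1.2.trans hc⟩
  mono := Or.inr h.antitone
  bound := by
    have hL := hG.nonneg
    have am : a ∈ Icc (-1 : ℝ) 1 := ⟨ha, hac.trans hc⟩
    have cm : c ∈ Icc (-1 : ℝ) 1 := ⟨ha.trans hac, hc⟩
    -- Difference quotients of `G` are bounded by `L`, so for `|ξ| ≥ L + 1` the function `G w - ξ w`
    -- is strictly monotone and only an endpoint can maximize it.
    refine ⟨L + 1, by linarith, fun ξ hξ => ?_, fun ξ hξ => ?_⟩
    · have h1 := (h ξ).2 c ⟨hac, le_rfl⟩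
      have h2 := (h ξ).1
      have um : U ξ ∈ Icc (-1 : ℝ) 1 := ⟨ha.trans h2.1, h2.2.trans hc⟩
      have h3 := hG _ um _ cm
      have h4 := le_abs_self (G (U ξ) - G c)
      rw [abs_of_nonpos (by linarith [h2.2] : U ξ - c ≤ 0)] at h3
      refine le_antisymm h2.2 ?_
      nlinarith [h2.2, mul_nonneg (sub_nonneg.2 h2.2) (by linarith : 0 ≤ -(L + 1) - ξ)]
    · have h1 := (h ξ).2 a ⟨le_rfl, hac⟩
      have h2 := (h ξ).1
      have um : U ξ ∈ Icc (-1 : ℝ) 1 := ⟨ha.trans h2.1, h2.2.trans hc⟩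
      have h3 := hG _ um _ am
      have h4 := le_abs_self (G (U ξ) - G a)
      rw [abs_of_nonneg (by linarith [h2.1] : 0 ≤ U ξ - a)] at h3
      refine le_antisymm ?_ h2.1
      nlinarith [h2.1, mul_nonneg (sub_nonneg.2 h2.1) (by linarith : 0 ≤ ξ - (L + 1))]
  incr := by
    intro k hk η₁ η₂ h12
    have hw : U η₂ ≤ U η₁ := h.antitone h12
    have h1 := (h η₁).2 _ (h η₂).1
    have h2 := (h η₂).2 _ (h η₁).1
    rw [abs_of_nonpos (by linarith : U η₂ - U η₁ ≤ 0)]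
    rcases le_total k (U η₂) with hk2 | hk2
    · rw [kq_of_le hk2, kq_of_le (hk2.trans hw), abs_of_nonneg (by linarith),
        abs_of_nonneg (by linarith)]
      nlinarith [mul_nonneg (sub_nonneg.2 h12) (sub_nonneg.2 hw)]
    · rcases le_total (U η₁) k with hk1 | hk1
      · rw [kq_of_ge hk2, kq_of_ge hk1, abs_of_nonpos (by linarith), abs_of_nonpos (by linarith)]
        nlinarith
      · rw [kq_of_ge hk2, kq_of_le hk1, abs_of_nonpos (by linarith), abs_of_nonneg (by linarith)]
        -- Only when `k` separates the two values does it serve as a competitor itself: both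
        -- maximizers are compared with `k`, and the slack is `(η₂ - η₁)(U η₁ - k)`.
        have hkm : k ∈ Icc a c := ⟨(h η₂).1.1.trans hk2, hk1.trans (h η₁).1.2⟩
        have h3 := (h η₁).2 _ hkm
        have h4 := (h η₂).2 _ hkm
        nlinarith [mul_nonneg (sub_nonneg.2 h12) (sub_nonneg.2 hk1)]

/-- Reflection of the states turns minimizers into maximizers. -/
lemma MaxSel.neg {G V : ℝ → ℝ} {a c : ℝ} (h : MaxSel (fun w => -G (-w)) V (-c) (-a)) :
    MinSel G (fun ξ => -V ξ) a c := by
  intro ξ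
  obtain ⟨h1, h2⟩ := h ξ
  refine ⟨⟨by linarith [h1.2], by linarith [h1.1]⟩, fun w hw => ?_⟩
  have := h2 (-w) ⟨by linarith [hw.2], by linarith [hw.1]⟩
  simp only [neg_neg] at this
  linarith

lemma Profile.neg {G V : ℝ → ℝ} {uL uR : ℝ} (h : Profile (fun w => -G (-w)) V (-uL) (-uR)) :
    Profile G (fun ξ => -V ξ) uL uR where
  mem ξ := ⟨by linarith [(h.mem ξ).2], by linarith [(h.mem ξ).1]⟩
  mono := h.mono.symm.imp (fun h => h.neg) (fun h => h.neg)
  bound := by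
    obtain ⟨M, hM, h1, h2⟩ := h.bound
    exact ⟨M, hM, fun ξ hξ => by rw [h1 ξ hξ, neg_neg], fun ξ hξ => by rw [h2 ξ hξ, neg_neg]⟩
  incr := by
    intro k hk η₁ η₂ h12
    have e1 : ∀ v, |-v - k| = |v - -k| := fun v => by rw [← abs_neg]; congr 1; ring
    have e2 : ∀ v, kq G (-v) k = kq (fun w => -G (-w)) v (-k) := fun v => by
      rcases le_total (-k) v with h | h
      · rw [kq_of_le h, kq_of_ge (by linarith)]; simp; ring
      · rw [kq_of_ge h, kq_of_le (by linarith)]; simp; ring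
    have e3 : |-V η₂ - -V η₁| = |V η₂ - V η₁| := by rw [← abs_neg]; congr 1; ring
    rw [e1, e1, e2, e2, e3]
    exact h.incr (-k) ⟨by linarith [hk.2], by linarith [hk.1]⟩ η₁ η₂ h12

lemma LipOn.neg {G : ℝ → ℝ} {L : ℝ} (hG : LipOn G L) : LipOn (fun w => -G (-w)) L := by
  intro u hu w hw
  have := hG (-u) ⟨by linarith [hu.2], by linarith [hu.1]⟩ (-w)
    ⟨by linarith [hw.2], by linarith [hw.1]⟩
  rw [← abs_neg (u - w), ← abs_neg (-G (-u) - -G (-w))]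
  convert this using 2 <;> ring_nf

/-! ### The envelope formula -/

/-- The affine function of slope `ξ` through `(U ξ, G (U ξ))` is a concave majorant of `G`. The
envelope therefore lies below it everywhere and agrees with `G` at `U ξ`. -/
lemma MaxSel.envelope {G U : ℝ → ℝ} {a c : ℝ} (h : MaxSel G U a c) (ξ w : ℝ)
    (hw : w ∈ Icc a c) :
    upperEnvelope G a c w ≤ upperEnvelope G a c (U ξ) + ξ * (w - U ξ) := by
  have hconc : ConcaveOn ℝ (Icc a c) fun w => G (U ξ) + ξ * (w - U ξ) := by
    refine ⟨convex_Icc a c, fun x _ y _ s t _ _ hst => le_of_eq ?_⟩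
    simp only [smul_eq_mul]
    linear_combination (G (U ξ) - ξ * U ξ) * hst
  have hmaj : ∀ w ∈ Icc a c, G w ≤ G (U ξ) + ξ * (w - U ξ) := fun w hw => by
    linarith [(h ξ).2 w hw]
  have h1 : upperEnvelope G a c w ≤ G (U ξ) + ξ * (w - U ξ) :=
    csInf_le ⟨G w, by rintro y ⟨g, -, hg, rfl⟩; exact hg w hw⟩ ⟨_, hconc, hmaj, rfl⟩
  have h2 : G (U ξ) ≤ upperEnvelope G a c (U ξ) :=
    le_csInf ⟨_, _, hconc, hmaj, rfl⟩ (by rintro y ⟨g, -, hg, rfl⟩; exact hg _ (h ξ).1)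
  linarith

lemma MinSel.envelope {G U : ℝ → ℝ} {a c : ℝ} (h : MinSel G U a c) (ξ w : ℝ)
    (hw : w ∈ Icc a c) :
    lowerEnvelope G a c (U ξ) + ξ * (w - U ξ) ≤ lowerEnvelope G a c w := by
  have hconv : ConvexOn ℝ (Icc a c) fun w => G (U ξ) + ξ * (w - U ξ) := by
    refine ⟨convex_Icc a c, fun x _ y _ s t _ _ hst => le_of_eq ?_⟩
    simp only [smul_eq_mul]
    linear_combination -(G (U ξ) - ξ * U ξ) * hst
  have hmin : ∀ w ∈ Icc a c, G (U ξ) + ξ * (w - U ξ) ≤ G w := fun w hw => by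
    linarith [(h ξ).2 w hw]
  have h1 : G (U ξ) + ξ * (w - U ξ) ≤ lowerEnvelope G a c w :=
    le_csSup ⟨G w, by rintro y ⟨g, -, hg, rfl⟩; exact hg w hw⟩ ⟨_, hconv, hmin, rfl⟩
  have h2 : lowerEnvelope G a c (U ξ) ≤ G (U ξ) :=
    csSup_le ⟨_, _, hconv, hmin, rfl⟩ (by rintro y ⟨g, -, hg, rfl⟩; exact hg _ (h ξ).1)
  linarith

end RiemannPhase

namespace RiemannPhase

/-! ### Wave patterns of maximizing profiles -/

/-- On `(n, m)` the graph of `G` restricted to `[a, c]` lies strictly below its tangent lines. -/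
def FanCond (G : ℝ → ℝ) (a c n m : ℝ) : Prop :=
  ∀ e ∈ Ioo n m, ∀ v ∈ Icc a c, v ≠ e → G v < G e + deriv G e * (v - e)

/-- On `(n, m)` the graph of `G` restricted to `[a, c]` lies strictly above its tangent lines. -/
def FanCondMin (G : ℝ → ℝ) (a c n m : ℝ) : Prop :=
  ∀ e ∈ Ioo n m, ∀ v ∈ Icc a c, v ≠ e → G e + deriv G e * (v - e) < G v

section MaxPatterns

variable {G U : ℝ → ℝ} {a c n m : ℝ}

/-- A strict tangent line at `e` makes `e` the unique maximizer for the slope `G' e`, so on fan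
states the arbitrary selection `U` is forced to be the inverse of `G'`. -/
lemma FanCond.value (hf : FanCond G a c n m) (hU : MaxSel G U a c) (han : a ≤ n) (hmc : m ≤ c)
    {e : ℝ} (he : e ∈ Ioo n m) : U (deriv G e) = e := by
  by_contra hne
  have h1 := hf e he _ (hU (deriv G e)).1 hne
  have h2 := (hU (deriv G e)).2 e ⟨han.trans he.1.le, he.2.le.trans hmc⟩
  linarith

lemma FanCond.anti (hf : FanCond G a c n m) (han : a ≤ n) (hmc : m ≤ c) :
    StrictAntiOn (deriv G) (Ioo n m) := by
  intro e₁ h₁ e₂ h₂ h12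
  have h3 := hf e₁ h₁ e₂ ⟨han.trans h₂.1.le, h₂.2.le.trans hmc⟩ h12.ne'
  have h4 := hf e₂ h₂ e₁ ⟨han.trans h₁.1.le, h₁.2.le.trans hmc⟩ h12.ne
  nlinarith

/-- Weak monotonicity reaches the endpoints by continuity of `G'`. Strictness is recovered by
inserting two interior points between the given ones. -/
lemma FanCond.anti_Icc (hf : FanCond G a c n m) (han : a ≤ n) (hmc : m ≤ c)
    (hd : ContinuousOn (deriv G) (Icc a c)) : StrictAntiOn (deriv G) (Icc n m) := by
  have hd' : ContinuousOn (deriv G) (Icc n m) := hd.mono (Icc_subset_Icc han hmc)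
  rcases lt_or_ge n m with hnm | hnm
  swap
  · intro x hx y hy hxy
    linarith [hx.1, hy.2]
  have hanti := hf.anti han hmc
  have hle : ∀ x ∈ Icc n m, ∀ y ∈ Ioo n m, x < y → deriv G y ≤ deriv G x := by
    intro x hx y hy hxy
    have ht : Tendsto (deriv G) (𝓝[Ioo x y] x) (𝓝 (deriv G x)) :=
      (hd' x hx).mono_left (nhdsWithin_mono _ fun z hz => ⟨hx.1.trans hz.1.le, hz.2.le.trans hy.2.le⟩)
    have : (𝓝[Ioo x y] x).NeBot := left_nhdsWithin_Ioo_neBot hxy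
    refine ge_of_tendsto ht (eventually_nhdsWithin_of_forall fun z hz => ?_)
    exact (hanti ⟨hx.1.trans_lt hz.1, hz.2.trans hy.2⟩ hy hz.2).le
  have hle' : ∀ x ∈ Ioo n m, ∀ y ∈ Icc n m, x < y → deriv G y ≤ deriv G x := by
    intro x hx y hy hxy
    have ht : Tendsto (deriv G) (𝓝[Ioo x y] y) (𝓝 (deriv G y)) :=
      (hd' y hy).mono_left (nhdsWithin_mono _ fun z hz => ⟨hx.1.le.trans hz.1.le, hz.2.le.trans hy.2⟩)
    have : (𝓝[Ioo x y] y).NeBot := right_nhdsWithin_Ioo_neBot hxy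
    refine le_of_tendsto ht (eventually_nhdsWithin_of_forall fun z hz => ?_)
    exact (hanti hx ⟨hx.1.trans hz.1, hz.2.trans_le hy.2⟩ hz.1).le
  intro x hx y hy hxy
  obtain ⟨z, hxz, hzy⟩ := exists_between hxy
  obtain ⟨w, hzw, hwy⟩ := exists_between hzy
  have hz : z ∈ Ioo n m := ⟨hx.1.trans_lt hxz, hzy.trans_le hy.2⟩
  have hw : w ∈ Ioo n m := ⟨hz.1.trans hzw, hwy.trans_le hy.2⟩
  exact (hle' w hw y hy hwy).trans_lt ((hanti hz hw hzw).trans_le (hle x hx z hz hxz))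

/-- Half of the continuity of `U` at `G' e`: a fan state `z` slightly below `e` has `G' z > G' e`,
so by monotonicity `U ξ ≥ z` for all `ξ` near `G' e`. Only states on one side are used, so the
argument also works at the end `e = m` of the fan. -/
lemma FanCond.eventually_gt (hf : FanCond G a c n m) (hU : MaxSel G U a c) (han : a ≤ n)
    (hmc : m ≤ c) (hd : ContinuousOn (deriv G) (Icc a c)) {e : ℝ} (he : e ∈ Ioc n m) {x : ℝ}
    (hx : x < e) : ∀ᶠ ξ in 𝓝 (deriv G e), x < U ξ := by
  obtain ⟨z, hz, hze⟩ := exists_between (max_lt hx he.1)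
  have hz' : z ∈ Ioo n m := ⟨(le_max_right _ _).trans_lt hz, hze.trans_le he.2⟩
  have h1 := hf.anti_Icc han hmc hd ⟨hz'.1.le, hz'.2.le⟩ ⟨he.1.le, he.2⟩ hze
  filter_upwards [gt_mem_nhds h1] with ξ hξ
  have := hU.antitone (le_of_lt hξ)
  rw [hf.value hU han hmc hz'] at this
  exact ((le_max_left _ _).trans_lt hz).trans_le this

lemma FanCond.eventually_lt (hf : FanCond G a c n m) (hU : MaxSel G U a c) (han : a ≤ n)
    (hmc : m ≤ c) (hd : ContinuousOn (deriv G) (Icc a c)) {e : ℝ} (he : e ∈ Ico n m) {x : ℝ}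
    (hx : e < x) : ∀ᶠ ξ in 𝓝 (deriv G e), U ξ < x := by
  obtain ⟨z, hez, hz⟩ := exists_between (lt_min hx he.2)
  have hz' : z ∈ Ioo n m := ⟨he.1.trans_lt hez, hz.trans_le (min_le_right _ _)⟩
  have h1 := hf.anti_Icc han hmc hd ⟨he.1, he.2.le⟩ ⟨hz'.1.le, hz'.2.le⟩ hez
  filter_upwards [lt_mem_nhds h1] with ξ hξ
  have := hU.antitone (le_of_lt hξ)
  rw [hf.value hU han hmc hz'] at this
  exact this.trans_lt (hz.trans_le (min_le_left _ _))

lemma FanCond.exists_eq (hd : ContinuousOn (deriv G) (Icc a c)) (han : a ≤ n)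
    (hnm : n ≤ m) (hmc : m ≤ c) {ξ : ℝ} (hξ : ξ ∈ Ioo (deriv G m) (deriv G n)) :
    ∃ e ∈ Ioo n m, deriv G e = ξ :=
  intermediate_value_Ioo' hnm (hd.mono (Icc_subset_Icc han hmc)) hξ

/-- By the intermediate value theorem every speed strictly between `G' m` and `G' n` is `G' e` for a
fan state `e`, and there `U` inverts `G'`. Since `G'` decreases on the fan, increasing speed leads
from `m` down to `n`. -/
lemma FanCond.hasFan (hf : FanCond G a c n m) (hU : MaxSel G U a c) (han : a ≤ n) (hnm : n < m)
    (hmc : m ≤ c) (hd : ContinuousOn (deriv G) (Icc a c)) : HasFan G U m n := by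
  have hlt : deriv G m < deriv G n :=
    hf.anti_Icc han hmc hd ⟨le_rfl, hnm.le⟩ ⟨hnm.le, le_rfl⟩ hnm
  have hval : ∀ ξ ∈ Ioo (deriv G m) (deriv G n), U ξ ∈ Ioo n m ∧ deriv G (U ξ) = ξ := by
    intro ξ hξ
    obtain ⟨e, he, rfl⟩ := FanCond.exists_eq hd han hnm.le hmc hξ
    rw [hf.value hU han hmc he]
    exact ⟨he, rfl⟩
  refine ⟨hlt, ?_, ?_, ?_, Or.inr ?_, fun ξ hξ => (hval ξ hξ).2⟩
  · refine tendsto_order.2 ⟨fun x hx =>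
      (hf.eventually_gt hU han hmc hd ⟨hnm, le_rfl⟩ hx).filter_mono nhdsWithin_le_nhds,
      fun x hx => ?_⟩
    filter_upwards [Ioo_mem_nhdsGT hlt] with ξ hξ
    exact (hval ξ hξ).1.2.trans hx
  · refine tendsto_order.2 ⟨fun x hx => ?_, fun x hx =>
      (hf.eventually_lt hU han hmc hd ⟨le_rfl, hnm⟩ hx).filter_mono nhdsWithin_le_nhds⟩
    filter_upwards [Ioo_mem_nhdsLT hlt] with ξ hξ
    exact hx.trans (hval ξ hξ).1.1
  · intro ξ hξ
    obtain ⟨h1, h2⟩ := hval ξ hξ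
    refine ContinuousAt.continuousWithinAt ?_
    refine tendsto_order.2 ⟨fun x hx => ?_, fun x hx => ?_⟩
    · have := hf.eventually_gt hU han hmc hd ⟨h1.1, h1.2.le⟩ hx
      rwa [h2] at this
    · have := hf.eventually_lt hU han hmc hd ⟨h1.1.le, h1.2⟩ hx
      rwa [h2] at this
  · intro ξ hξ ζ hζ hlt
    refine lt_of_le_of_ne (hU.antitone hlt.le) fun h => ?_
    rw [← (hval ξ hξ).2, ← (hval ζ hζ).2, h] at hlt
    exact lt_irrefl _ hlt

lemma FanCond.left_const (hf : FanCond G a c n c) (hU : MaxSel G U a c) (han : a ≤ n)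
    (hnc : n < c) (hd : ContinuousOn (deriv G) (Icc a c)) {ξ : ℝ} (hξ : ξ ≤ deriv G c) :
    U ξ = c := by
  refine le_antisymm (hU ξ).1.2 (le_trans ?_ (hU.antitone hξ))
  exact le_of_forall_lt fun x hx =>
    (hf.eventually_gt hU han le_rfl hd ⟨hnc, le_rfl⟩ hx).self_of_nhds

lemma FanCond.right_const (hf : FanCond G a c a m) (hU : MaxSel G U a c) (ham : a < m)
    (hmc : m ≤ c) (hd : ContinuousOn (deriv G) (Icc a c)) {ξ : ℝ} (hξ : deriv G a ≤ ξ) :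
    U ξ = a := by
  refine le_antisymm ((hU.antitone hξ).trans ?_) (hU ξ).1.1
  exact le_of_forall_gt fun x hx =>
    (hf.eventually_lt hU le_rfl hmc hd ⟨le_rfl, ham⟩ hx).self_of_nhds

/-- The tangent inequality survives, weakly, in the limit at the edge of the fan. When a shock is
attached there, this limiting tangent line is its chord, and the inequality identifies the constant
state behind it. -/
lemma FanCond.tangent_le_left (hf : FanCond G a c n m) (han : a ≤ n) (hnm : n < m) (hmc : m ≤ c)
    (hG : ContinuousOn G (Icc a c)) (hd : ContinuousOn (deriv G) (Icc a c)) {w : ℝ}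
    (hw : w ∈ Icc a c) : G w ≤ G n + deriv G n * (w - n) := by
  have hn : n ∈ Icc a c := ⟨han, hnm.le.trans hmc⟩
  have hsub : Ioo n m ⊆ Icc a c := fun z hz => ⟨han.trans hz.1.le, hz.2.le.trans hmc⟩
  have : (𝓝[Ioo n m] n).NeBot := left_nhdsWithin_Ioo_neBot hnm
  have ht : Tendsto (fun e => G e + deriv G e * (w - e)) (𝓝[Ioo n m] n)
      (𝓝 (G n + deriv G n * (w - n))) :=
    ((hG n hn).mono hsub).add (((hd n hn).mono hsub).mul
      ((by fun_prop : Continuous fun e : ℝ => w - e).continuousWithinAt))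
  refine ge_of_tendsto ht (eventually_nhdsWithin_of_forall fun e he => ?_)
  by_cases hwe : w = e
  · simp [hwe]
  · exact (hf e he w hw hwe).le

lemma FanCond.tangent_le_right (hf : FanCond G a c n m) (han : a ≤ n) (hnm : n < m) (hmc : m ≤ c)
    (hG : ContinuousOn G (Icc a c)) (hd : ContinuousOn (deriv G) (Icc a c)) {w : ℝ}
    (hw : w ∈ Icc a c) : G w ≤ G m + deriv G m * (w - m) := by
  have hm : m ∈ Icc a c := ⟨han.trans hnm.le, hmc⟩
  have hsub : Ioo n m ⊆ Icc a c := fun z hz => ⟨han.trans hz.1.le, hz.2.le.trans hmc⟩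
  have : (𝓝[Ioo n m] m).NeBot := right_nhdsWithin_Ioo_neBot hnm
  have ht : Tendsto (fun e => G e + deriv G e * (w - e)) (𝓝[Ioo n m] m)
      (𝓝 (G m + deriv G m * (w - m))) :=
    ((hG m hm).mono hsub).add (((hd m hm).mono hsub).mul
      ((by fun_prop : Continuous fun e : ℝ => w - e).continuousWithinAt))
  refine ge_of_tendsto ht (eventually_nhdsWithin_of_forall fun e he => ?_)
  by_cases hwe : w = e
  · simp [hwe]
  · exact (hf e he w hw hwe).le

/-- If the graph lies below a line of slope `s` through its left endpoint, then for every steeper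
slope that endpoint is the only maximizer. -/
lemma MaxSel.eq_right {s : ℝ} (hU : MaxSel G U a c) (hac : a ≤ c)
    (h : ∀ w ∈ Icc a c, G w ≤ G a + s * (w - a)) {ξ : ℝ} (hξ : s < ξ) : U ξ = a := by
  have h1 := h _ (hU ξ).1
  have h2 := (hU ξ).2 a ⟨le_rfl, hac⟩
  refine le_antisymm ?_ (hU ξ).1.1
  nlinarith [(hU ξ).1.1]

lemma MaxSel.eq_left {s : ℝ} (hU : MaxSel G U a c) (hac : a ≤ c)
    (h : ∀ w ∈ Icc a c, G w ≤ G c + s * (w - c)) {ξ : ℝ} (hξ : ξ < s) : U ξ = c := by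
  have h1 := h _ (hU ξ).1
  have h2 := (hU ξ).2 c ⟨hac, le_rfl⟩
  refine le_antisymm (hU ξ).1.2 ?_
  nlinarith [(hU ξ).1.2]

lemma shockSpeed_mul {x y : ℝ} (h : x ≠ y) : shockSpeed G x y * (y - x) = G y - G x := by
  rw [shockSpeed, div_mul_cancel₀ _ (sub_ne_zero.2 h.symm)]

lemma tendsto_of_eq_of_lt {s x : ℝ} (h : ∀ ξ < s, U ξ = x) : Tendsto U (𝓝[<] s) (𝓝 x) :=
  (tendsto_congr' (eventually_nhdsWithin_of_forall fun ξ hξ => h ξ hξ)).2 tendsto_const_nhds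

lemma tendsto_of_eq_of_gt {s x : ℝ} (h : ∀ ξ > s, U ξ = x) : Tendsto U (𝓝[>] s) (𝓝 x) :=
  (tendsto_congr' (eventually_nhdsWithin_of_forall fun ξ hξ => h ξ hξ)).2 tendsto_const_nhds

lemma MaxSel.isS (hU : MaxSel G U a c) (hac : a < c)
    (h : ∀ w ∈ Icc a c, (G w - G a) * (c - a) ≤ (G c - G a) * (w - a)) : IsS G U c a := by
  have hs := shockSpeed_mul (G := G) hac.ne'
  have h1 : ∀ ξ < shockSpeed G c a, U ξ = c := fun ξ hξ => by
    refine hU.eq_left hac.le (fun w hw => ?_) hξ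
    have := h w hw
    nlinarith [hw.1, hw.2]
  have h2 : ∀ ξ > shockSpeed G c a, U ξ = a := fun ξ hξ => by
    refine hU.eq_right hac.le (fun w hw => ?_) hξ
    have := h w hw
    nlinarith [hw.1, hw.2]
  exact ⟨⟨hac.ne', tendsto_of_eq_of_lt h1, tendsto_of_eq_of_gt h2⟩, h1, h2⟩

lemma MaxSel.isR (hU : MaxSel G U a c) (hac : a < c) (hd : ContinuousOn (deriv G) (Icc a c))
    (hf : FanCond G a c a c) : IsR G U c a :=
  ⟨hf.hasFan hU le_rfl hac le_rfl hd, fun _ hξ => hf.left_const hU le_rfl hac hd hξ,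
    fun _ hξ => hf.right_const hU hac le_rfl hd hξ⟩

lemma MaxSel.eq_right_of_fan (hU : MaxSel G U a c) (han : a < n) (hnm : n < m) (hmc : m ≤ c)
    (hG : ContinuousOn G (Icc a c)) (hd : ContinuousOn (deriv G) (Icc a c))
    (hf : FanCond G a c n m) (hs : deriv G n = shockSpeed G n a) {ξ : ℝ}
    (hξ : shockSpeed G n a < ξ) : U ξ = a := by
  refine hU.eq_right (by linarith) (fun w hw => ?_) hξ
  have h1 := hf.tangent_le_left han.le hnm hmc hG hd hw
  have h2 := shockSpeed_mul (G := G) han.ne'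
  rw [hs] at h1
  linarith

lemma MaxSel.eq_left_of_fan (hU : MaxSel G U a c) (han : a ≤ n) (hnm : n < m) (hmc : m < c)
    (hG : ContinuousOn G (Icc a c)) (hd : ContinuousOn (deriv G) (Icc a c))
    (hf : FanCond G a c n m) (hs : shockSpeed G c m = deriv G m) {ξ : ℝ}
    (hξ : ξ < shockSpeed G c m) : U ξ = c := by
  refine hU.eq_left (by linarith) (fun w hw => ?_) hξ
  have h1 := hf.tangent_le_right han hnm hmc.le hG hd hw
  have h2 := shockSpeed_mul (G := G) hmc.ne'
  rw [← hs] at h1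
  linarith

lemma MaxSel.isRS (hU : MaxSel G U a c) (han : a < n) (hnc : n < c)
    (hG : ContinuousOn G (Icc a c)) (hd : ContinuousOn (deriv G) (Icc a c))
    (hf : FanCond G a c n c) (hs : deriv G n = shockSpeed G n a) : IsRS G U c n a := by
  have hfan := hf.hasFan hU han.le hnc le_rfl hd
  have h2 := fun ξ hξ => hU.eq_right_of_fan han hnc le_rfl hG hd hf hs (ξ := ξ) hξ
  exact ⟨hfan, ⟨han.ne', hs ▸ hfan.2.2.1, tendsto_of_eq_of_gt h2⟩, hs,
    fun ξ hξ => hf.left_const hU han.le hnc hd hξ, h2⟩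

lemma MaxSel.isSR (hU : MaxSel G U a c) (ham : a < m) (hmc : m < c)
    (hG : ContinuousOn G (Icc a c)) (hd : ContinuousOn (deriv G) (Icc a c))
    (hf : FanCond G a c a m) (hs : shockSpeed G c m = deriv G m) : IsSR G U c m a := by
  have hfan := hf.hasFan hU le_rfl ham hmc.le hd
  have h2 := fun ξ hξ => hU.eq_left_of_fan le_rfl ham hmc hG hd hf hs (ξ := ξ) hξ
  exact ⟨⟨hmc.ne', tendsto_of_eq_of_lt h2, hs ▸ hfan.2.1⟩, hfan, hs, h2,
    fun ξ hξ => hf.right_const hU ham hmc.le hd hξ⟩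

lemma MaxSel.isRSR (hU : MaxSel G U a c) (han : a < n) (hnm : n < m) (hmc : m < c)
    (hd : ContinuousOn (deriv G) (Icc a c))
    (hf : FanCond G a c m c) (hf' : FanCond G a c a n) (hs : deriv G m = shockSpeed G m n)
    (hs' : shockSpeed G m n = deriv G n) : IsRSR G U c m n a := by
  have hfan := hf.hasFan hU (han.trans hnm).le hmc le_rfl hd
  have hfan' := hf'.hasFan hU le_rfl han (hnm.trans hmc).le hd
  exact ⟨hfan, ⟨hnm.ne', hs ▸ hfan.2.2.1, hs' ▸ hfan'.2.1⟩, hfan', hs, hs',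
    fun ξ hξ => hf.left_const hU (han.trans hnm).le hmc hd hξ,
    fun ξ hξ => hf'.right_const hU han (hnm.trans hmc).le hd hξ⟩

lemma MaxSel.isSRS (hU : MaxSel G U a c) (han : a < n) (hnm : n < m) (hmc : m < c)
    (hG : ContinuousOn G (Icc a c)) (hd : ContinuousOn (deriv G) (Icc a c))
    (hf : FanCond G a c n m) (hs : shockSpeed G c m = deriv G m)
    (hs' : deriv G n = shockSpeed G n a) : IsSRS G U c m n a := by
  have hfan := hf.hasFan hU han.le hnm hmc.le hd
  have h1 := fun ξ hξ => hU.eq_left_of_fan han.le hnm hmc hG hd hf hs (ξ := ξ) hξ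
  have h2 := fun ξ hξ => hU.eq_right_of_fan han hnm hmc.le hG hd hf hs' (ξ := ξ) hξ
  exact ⟨⟨hmc.ne', tendsto_of_eq_of_lt h1, hs ▸ hfan.2.1⟩, hfan,
    ⟨han.ne', hs' ▸ hfan.2.2.1, tendsto_of_eq_of_gt h2⟩, hs, hs', by
      rw [hs, ← hs']; exact hfan.1, h1, h2⟩

end MaxPatterns

/-! ### Reflection of the states -/

section Reflection

variable {G V : ℝ → ℝ} {a c n m : ℝ}

lemma deriv_reflect (G : ℝ → ℝ) (x : ℝ) : deriv (fun w => -G (-w)) x = deriv G (-x) := by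
  rw [deriv.fun_neg, deriv_comp_neg, neg_neg]

/-- Reflecting the states, and not space, changes neither shock speeds nor characteristic speeds.
Each pattern is thus transported with its waves in the same order. -/
lemma shockSpeed_reflect (G : ℝ → ℝ) (x y : ℝ) :
    shockSpeed (fun w => -G (-w)) (-x) (-y) = shockSpeed G x y := by
  simp only [shockSpeed, neg_neg]
  rw [← neg_div_neg_eq]
  congr 1 <;> ring

lemma HasShock.reflect (h : HasShock (fun w => -G (-w)) V (-a) (-c)) :
    HasShock G (fun ξ => -V ξ) a c := by
  obtain ⟨h1, h2, h3⟩ := h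
  rw [shockSpeed_reflect] at h2 h3
  exact ⟨fun h => h1 (by rw [h]), by simpa using h2.neg, by simpa using h3.neg⟩

lemma HasFan.reflect (h : HasFan (fun w => -G (-w)) V (-a) (-c)) :
    HasFan G (fun ξ => -V ξ) a c := by
  obtain ⟨h1, h2, h3, h4, h5, h6⟩ := h
  simp only [deriv_reflect, neg_neg] at h1 h2 h3 h4 h5 h6
  exact ⟨h1, by simpa using h2.neg, by simpa using h3.neg, h4.neg,
    h5.symm.imp (fun h => h.neg) (fun h => h.neg), h6⟩

lemma FanCondMin.reflect (hf : FanCondMin G a c n m) :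
    FanCond (fun w => -G (-w)) (-c) (-a) (-m) (-n) := by
  intro e he v hv hne
  have := hf (-e) ⟨by linarith [he.2], by linarith [he.1]⟩ (-v)
    ⟨by linarith [hv.2], by linarith [hv.1]⟩ (fun h => hne (neg_injective h))
  rw [deriv_reflect]
  linarith

lemma continuousOn_reflect (h : ContinuousOn G (Icc a c)) :
    ContinuousOn (fun w => G (-w)) (Icc (-c) (-a)) :=
  h.comp continuous_neg.continuousOn fun w hw => ⟨by linarith [hw.2], by linarith [hw.1]⟩

lemma continuousOn_deriv_reflect (h : ContinuousOn (deriv G) (Icc a c)) :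
    ContinuousOn (deriv fun w => -G (-w)) (Icc (-c) (-a)) := by
  simpa only [funext (deriv_reflect G)] using continuousOn_reflect h

lemma MaxSel.reflect_isS (hU : MaxSel (fun w => -G (-w)) V (-c) (-a))
    (hac : a < c)
    (h : ∀ w ∈ Icc a c, (G c - G a) * (w - a) ≤ (G w - G a) * (c - a)) :
    IsS G (fun ξ => -V ξ) a c := by
  obtain ⟨h1, h2, h3⟩ := hU.isS (by linarith) (fun w hw => by
    have := h (-w) ⟨by linarith [hw.2], by linarith [hw.1]⟩
    simp only [neg_neg]
    linarith)
  rw [shockSpeed_reflect] at h2 h3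
  exact ⟨h1.reflect, fun ξ hξ => neg_eq_iff_eq_neg.2 (h2 ξ hξ), fun ξ hξ => neg_eq_iff_eq_neg.2 (h3 ξ hξ)⟩

lemma MaxSel.reflect_isR (hU : MaxSel (fun w => -G (-w)) V (-c) (-a))
    (hac : a < c) (hd : ContinuousOn (deriv G) (Icc a c))
    (hf : FanCondMin G a c a c) : IsR G (fun ξ => -V ξ) a c := by
  obtain ⟨h1, h2, h3⟩ := hU.isR (by linarith) (continuousOn_deriv_reflect hd) hf.reflect
  simp only [deriv_reflect, neg_neg] at h2 h3
  exact ⟨h1.reflect, fun ξ hξ => neg_eq_iff_eq_neg.2 (h2 ξ hξ), fun ξ hξ => neg_eq_iff_eq_neg.2 (h3 ξ hξ)⟩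

lemma MaxSel.reflect_isRS (hU : MaxSel (fun w => -G (-w)) V (-c) (-a))
    (ham : a < m) (hmc : m < c)
    (hG : ContinuousOn G (Icc a c)) (hd : ContinuousOn (deriv G) (Icc a c))
    (hf : FanCondMin G a c a m) (hs : deriv G m = shockSpeed G m c) :
    IsRS G (fun ξ => -V ξ) a m c := by
  obtain ⟨h1, h2, h3, h4, h5⟩ := hU.isRS (n := -m) (by linarith) (by linarith)
    (continuousOn_reflect hG).neg (continuousOn_deriv_reflect hd) hf.reflect
    (by rw [deriv_reflect, shockSpeed_reflect, neg_neg, hs])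
  simp only [deriv_reflect, shockSpeed_reflect, neg_neg] at h3 h4 h5
  exact ⟨h1.reflect, h2.reflect, h3, fun ξ hξ => neg_eq_iff_eq_neg.2 (h4 ξ hξ),
    fun ξ hξ => neg_eq_iff_eq_neg.2 (h5 ξ hξ)⟩

lemma MaxSel.reflect_isSR (hU : MaxSel (fun w => -G (-w)) V (-c) (-a))
    (han : a < n) (hnc : n < c)
    (hG : ContinuousOn G (Icc a c)) (hd : ContinuousOn (deriv G) (Icc a c))
    (hf : FanCondMin G a c n c) (hs : shockSpeed G a n = deriv G n) :
    IsSR G (fun ξ => -V ξ) a n c := by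
  obtain ⟨h1, h2, h3, h4, h5⟩ := hU.isSR (m := -n) (by linarith) (by linarith)
    (continuousOn_reflect hG).neg (continuousOn_deriv_reflect hd) hf.reflect
    (by rw [deriv_reflect, shockSpeed_reflect, neg_neg, hs])
  simp only [deriv_reflect, shockSpeed_reflect, neg_neg] at h3 h4 h5
  exact ⟨h1.reflect, h2.reflect, h3, fun ξ hξ => neg_eq_iff_eq_neg.2 (h4 ξ hξ),
    fun ξ hξ => neg_eq_iff_eq_neg.2 (h5 ξ hξ)⟩

lemma MaxSel.reflect_isSRS (hU : MaxSel (fun w => -G (-w)) V (-c) (-a))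
    (han : a < n) (hnm : n < m) (hmc : m < c)
    (hG : ContinuousOn G (Icc a c)) (hd : ContinuousOn (deriv G) (Icc a c))
    (hf : FanCondMin G a c n m) (hs : shockSpeed G a n = deriv G n)
    (hs' : deriv G m = shockSpeed G m c) : IsSRS G (fun ξ => -V ξ) a n m c := by
  obtain ⟨h1, h2, h3, h4, h5, h6, h7, h8⟩ := hU.isSRS (m := -n) (n := -m) (by linarith)
    (by linarith) (by linarith)
    (continuousOn_reflect hG).neg (continuousOn_deriv_reflect hd) hf.reflect
    (by rw [deriv_reflect, shockSpeed_reflect, neg_neg, hs])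
    (by rw [deriv_reflect, shockSpeed_reflect, neg_neg, hs'])
  simp only [deriv_reflect, shockSpeed_reflect, neg_neg] at h4 h5 h6 h7 h8
  exact ⟨h1.reflect, h2.reflect, h3.reflect, h4, h5, h6, fun ξ hξ => neg_eq_iff_eq_neg.2 (h7 ξ hξ),
    fun ξ hξ => neg_eq_iff_eq_neg.2 (h8 ξ hξ)⟩

end Reflection

end RiemannPhase

namespace RiemannPhase

/-! ### The flux -/

/-- The square root in the flux. -/
noncomputable def rad (b v : ℝ) : ℝ := Real.sqrt (4 * b ^ 2 + (1 - 4 * b) * v ^ 2)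

/-- The admissible parameters. -/
structure Admissible (b : ℝ) : Prop where
  pos : 0 < b
  lt : b < 1 / 2
  -- The hypothesis `b ≤ 1 / (2 + √2)` in the form `√2 b ≤ 1 - 2b`, squared; the right side is the
  -- value of the radicand at `v = ±1`.
  sq_le : 2 * b ^ 2 ≤ (1 - 2 * b) ^ 2

lemma Admissible.of_le {b : ℝ} (hb : 0 < b) (hb' : b ≤ 1 / (2 + Real.sqrt 2)) : Admissible b := by
  have h2 : 0 < Real.sqrt 2 := Real.sqrt_pos.2 (by norm_num)
  rw [le_div_iff₀ (by positivity)] at hb'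
  have h3 : 0 < b * Real.sqrt 2 := by positivity
  have hs : Real.sqrt 2 ^ 2 = 2 := Real.sq_sqrt (by norm_num)
  refine ⟨hb, by linarith, ?_⟩
  have : b * Real.sqrt 2 ≤ 1 - 2 * b := by linarith
  nlinarith

section

variable {b : ℝ}

/-- The radicand is affine in `v²`, with values `4b²` at `0` and `(1 - 2b)² ≥ 2b²` at `1`. This
covers `b > 1/4` as well, where the coefficient of `v²` is negative. -/
lemma sq_le_radicand (hb : Admissible b) {v : ℝ} (hv : v ∈ Icc (-1 : ℝ) 1) :
    b ^ 2 ≤ 4 * b ^ 2 + (1 - 4 * b) * v ^ 2 := by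
  have h1 : v ^ 2 ≤ 1 := by nlinarith [hv.1, hv.2]
  nlinarith [hb.sq_le, sq_nonneg b, sq_nonneg v, mul_nonneg (sub_nonneg.2 hb.sq_le) (sq_nonneg v),
    mul_nonneg (sq_nonneg b) (sub_nonneg.2 h1)]

lemma sq_rad (hb : Admissible b) {v : ℝ} (hv : v ∈ Icc (-1 : ℝ) 1) :
    rad b v ^ 2 = 4 * b ^ 2 + (1 - 4 * b) * v ^ 2 :=
  Real.sq_sqrt ((sq_nonneg b).trans (sq_le_radicand hb hv))

lemma le_rad (hb : Admissible b) {v : ℝ} (hv : v ∈ Icc (-1 : ℝ) 1) : b ≤ rad b v :=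
  Real.le_sqrt_of_sq_le (sq_le_radicand hb hv)

lemma rad_pos (hb : Admissible b) {v : ℝ} (hv : v ∈ Icc (-1 : ℝ) 1) : 0 < rad b v :=
  hb.pos.trans_le (le_rad hb hv)

lemma flux_neg (b v : ℝ) : flux b (-v) = flux b v := by simp [flux]

lemma measurable_flux (b : ℝ) : Measurable (flux b) := by
  unfold flux
  fun_prop

/-- Rationalizing the quotient: `(1 - 2b)² rad² - 16b⁴` is `1 - 4b` times its numerator. The
excluded value `b = 1/4` is treated separately, since there the flux is a parabola. -/
lemma flux_eq (hb : Admissible b) (h4 : 1 - 4 * b ≠ 0) {v : ℝ}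
    (hv : 0 ≤ 4 * b ^ 2 + (1 - 4 * b) * v ^ 2) :
    flux b v = -v ^ 2 / 2 + ((1 - 2 * b) * rad b v - 4 * b ^ 2) / (2 * (1 - 4 * b)) := by
  have hs : rad b v ^ 2 = 4 * b ^ 2 + (1 - 4 * b) * v ^ 2 := Real.sq_sqrt hv
  have hs0 : 0 ≤ rad b v := Real.sqrt_nonneg _
  have hd : 4 * b ^ 2 + (1 - 2 * b) * rad b v ≠ 0 := by
    have := hb.pos
    have := mul_nonneg (by linarith [hb.lt] : 0 ≤ 1 - 2 * b) hs0
    positivity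
  unfold flux
  change _ + _ / (2 * (4 * b ^ 2 + (1 - 2 * b) * rad b v)) = _
  congr 1
  rw [div_eq_div_iff (by positivity) (by simpa using h4)]
  linear_combination (-2 * (1 - 2 * b) ^ 2) * hs

lemma rad_quarter (v : ℝ) : rad (1 / 4) v = 1 / 2 := by
  rw [rad, show (4 * (1 / 4 : ℝ) ^ 2 + (1 - 4 * (1 / 4)) * v ^ 2) = (1 / 2) ^ 2 by ring]
  exact Real.sqrt_sq (by norm_num)

lemma flux_quarter (v : ℝ) : flux (1 / 4) v = 1 / 4 - v ^ 2 / 4 := by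
  unfold flux
  change _ + _ / (2 * (4 * (1 / 4 : ℝ) ^ 2 + (1 - 2 * (1 / 4)) * rad (1 / 4) v)) = _
  rw [rad_quarter]
  ring

lemma hasDerivAt_flux (hb : Admissible b) {v : ℝ} (hv : v ∈ Icc (-1 : ℝ) 1) :
    HasDerivAt (flux b) (-v + (1 - 2 * b) * v / (2 * rad b v)) v := by
  by_cases h4 : 1 - 4 * b = 0
  · obtain rfl : b = 1 / 4 := by linarith
    have : flux (1 / 4) = fun v => 1 / 4 - v ^ 2 / 4 := funext flux_quarter
    rw [this, rad_quarter]
    refine (((hasDerivAt_id v).pow 2).div_const 4 |>.const_sub (1 / 4)).congr_deriv ?_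
    simp
    ring
  · have hpos : 0 < 4 * b ^ 2 + (1 - 4 * b) * v ^ 2 :=
      (pow_pos hb.pos 2).trans_le (sq_le_radicand hb hv)
    have hev : flux b =ᶠ[𝓝 v] fun v =>
        -v ^ 2 / 2 + ((1 - 2 * b) * rad b v - 4 * b ^ 2) / (2 * (1 - 4 * b)) := by
      have hc : Continuous fun v : ℝ => 4 * b ^ 2 + (1 - 4 * b) * v ^ 2 := by fun_prop
      filter_upwards [hc.continuousAt.eventually (lt_mem_nhds hpos)] with w hw
      exact flux_eq hb h4 (le_of_lt hw)
    refine HasDerivAt.congr_of_eventuallyEq ?_ hev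
    have h1 : HasDerivAt (fun v : ℝ => 4 * b ^ 2 + (1 - 4 * b) * v ^ 2) ((1 - 4 * b) * (2 * v)) v := by
      simpa using (((hasDerivAt_id v).pow 2).const_mul (1 - 4 * b)).const_add (4 * b ^ 2)
    have h2 : HasDerivAt (rad b) ((1 - 4 * b) * (2 * v) / (2 * rad b v)) v := h1.sqrt hpos.ne'
    have h3 := ((hasDerivAt_id v).pow 2).neg.div_const 2
    refine (h3.add (((h2.const_mul (1 - 2 * b)).sub_const (4 * b ^ 2)).div_const
      (2 * (1 - 4 * b)))).congr_deriv ?_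
    have := rad_pos hb hv
    have h5 : 1 - b * 4 ≠ 0 := by rwa [mul_comm]
    simp
    field_simp

lemma deriv_flux (hb : Admissible b) {v : ℝ} (hv : v ∈ Icc (-1 : ℝ) 1) :
    deriv (flux b) v = -v + (1 - 2 * b) * v / (2 * rad b v) :=
  (hasDerivAt_flux hb hv).deriv

lemma continuousOn_deriv_flux (hb : Admissible b) :
    ContinuousOn (deriv (flux b)) (Icc (-1) 1) := by
  have : ContinuousOn (fun v => -v + (1 - 2 * b) * v / (2 * rad b v)) (Icc (-1) 1) := by
    have hr : Continuous (rad b) := by unfold rad; fun_prop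
    refine ContinuousOn.add (by fun_prop) (ContinuousOn.div (by fun_prop) (by fun_prop) ?_)
    intro v hv
    have := rad_pos hb hv
    positivity
  exact this.congr fun v hv => deriv_flux hb hv

lemma lipOn_flux (hb : Admissible b) : LipOn (flux b) (1 + (1 - 2 * b) / (2 * b)) := by
  intro u hu w hw
  refine (convex_Icc (-1 : ℝ) 1).norm_image_sub_le_of_norm_hasDerivWithin_le
    (f' := fun v => -v + (1 - 2 * b) * v / (2 * rad b v))
    (fun v hv => (hasDerivAt_flux hb hv).hasDerivWithinAt) (fun v hv => ?_) hw hu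
  have hv1 : |v| ≤ 1 := abs_le.2 hv
  have hb0 := hb.pos
  have hp : 0 < 1 - 2 * b := by linarith [hb.lt]
  have hr := le_rad hb hv
  have hr0 := rad_pos hb hv
  refine (norm_add_le _ _).trans (add_le_add (by simpa using hv1) ?_)
  rw [Real.norm_eq_abs, abs_div, abs_mul, abs_of_pos hp, abs_of_pos (by positivity : 0 < 2 * rad b v)]
  exact div_le_div₀ hp.le (by nlinarith) (by positivity) (by linarith)

/-- The excess of the flux over its tangent line. -/
lemma flux_sub_tangent (hb : Admissible b) {v e : ℝ} (hv : v ∈ Icc (-1 : ℝ) 1)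
    (he : e ∈ Icc (-1 : ℝ) 1)
    (hT : rad b v * rad b e + 4 * b ^ 2 + (1 - 4 * b) * e * v ≠ 0) :
    flux b v - (flux b e + deriv (flux b) e * (v - e)) = (v - e) ^ 2 / 2 *
      (4 * b ^ 2 * (1 - 2 * b) /
        (rad b e * (rad b v * rad b e + 4 * b ^ 2 + (1 - 4 * b) * e * v)) - 1) := by
  rw [deriv_flux hb he]
  by_cases h4 : 1 - 4 * b = 0
  · obtain rfl : b = 1 / 4 := by linarith
    simp only [flux_quarter, rad_quarter]
    ring
  · have hS := sq_rad hb hv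
    have hR := sq_rad hb he
    have hR0 := (rad_pos hb he).ne'
    rw [flux_eq hb h4 ((sq_nonneg b).trans (sq_le_radicand hb hv)),
      flux_eq hb h4 ((sq_nonneg b).trans (sq_le_radicand hb he))]
    generalize rad b v = S at *
    generalize rad b e = R at *
    -- A Lagrange identity: `S²R² - (4b² + (1 - 4b) e v)² = 4b² (1 - 4b) (v - e)²`. It exposes the
    -- double zero of the excess at `v = e`.
    have key : S * R - (4 * b ^ 2 + (1 - 4 * b) * e * v) =
        4 * b ^ 2 * (1 - 4 * b) * (v - e) ^ 2 / (S * R + 4 * b ^ 2 + (1 - 4 * b) * e * v) := by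
      rw [eq_div_iff hT]
      linear_combination R ^ 2 * hS + (4 * b ^ 2 + (1 - 4 * b) * v ^ 2) * hR
    have key2 : (S - R) / (1 - 4 * b) - e * (v - e) / R =
        4 * b ^ 2 * (v - e) ^ 2 / (R * (S * R + 4 * b ^ 2 + (1 - 4 * b) * e * v)) := by
      have h5 : (S - R) / (1 - 4 * b) - e * (v - e) / R =
          (S * R - (4 * b ^ 2 + (1 - 4 * b) * e * v)) / ((1 - 4 * b) * R) := by
        field_simp
        linear_combination -hR
      rw [h5, key]
      field_simp
    have h6 : (v - e) ^ 2 / 2 *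
      (4 * b ^ 2 * (1 - 2 * b) / (R * (S * R + 4 * b ^ 2 + (1 - 4 * b) * e * v)) - 1) =
      (1 - 2 * b) / 2 * (4 * b ^ 2 * (v - e) ^ 2 /
        (R * (S * R + 4 * b ^ 2 + (1 - 4 * b) * e * v))) - (v - e) ^ 2 / 2 := by ring
    rw [h6, ← key2]
    field_simp
    ring

/-- For `b ≥ 1/6` the flux lies strictly below its tangent lines. -/
lemma flux_lt_tangent (hb : Admissible b) (h6 : 1 / 6 ≤ b) {v e : ℝ} (hv : v ∈ Icc (-1 : ℝ) 1)
    (he : e ∈ Icc (-1 : ℝ) 1) (hne : v ≠ e) :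
    flux b v < flux b e + deriv (flux b) e * (v - e) := by
  have hb0 := hb.pos
  have hp : 0 < 1 - 2 * b := by linarith [hb.lt]
  have hS := sq_rad hb hv
  have hR := sq_rad hb he
  have hS0 := rad_pos hb hv
  have hR0 := rad_pos hb he
  have hev : e * v < 1 := by
    have h0 : 0 < (v - e) ^ 2 := by have := sub_ne_zero.2 hne; positivity
    nlinarith [hv.1, hv.2, he.1, he.2]
  have hv2 : v ^ 2 ≤ 1 := by nlinarith [hv.1, hv.2]
  have he2 : e ^ 2 ≤ 1 := by nlinarith [he.1, he.2]
  have main : 0 < rad b v * rad b e + 4 * b ^ 2 + (1 - 4 * b) * e * v ∧ 4 * b ^ 2 * (1 - 2 * b) <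
      rad b e * (rad b v * rad b e + 4 * b ^ 2 + (1 - 4 * b) * e * v) := by
    -- For `b < 1/4` the bracket is at least `8b²` and `rad ≥ 2b`, so the product is at least `16b³
    -- ≥ 4b²(1 - 2b)`, because `b ≥ 1/6` means `4b ≥ 1 - 2b`. Strictness comes from `rad b e > 2b`,
    -- or from `rad b v > 2b` when `e = 0`.
    rcases lt_or_ge 0 (1 - 4 * b) with hq | hq
    · have hSR : 4 * b ^ 2 - (1 - 4 * b) * e * v ≤ rad b v * rad b e := by
        refine abs_le_of_sq_le_sq' ?_ (by positivity) |>.2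
        rw [mul_pow, hS, hR]
        nlinarith [mul_nonneg (mul_nonneg (sq_nonneg b) hq.le) (sq_nonneg (v + e))]
      have hR2 : 2 * b ≤ rad b e := Real.le_sqrt_of_sq_le (by nlinarith [mul_nonneg hq.le (sq_nonneg e)])
      have hX : 8 * b ^ 2 ≤ rad b v * rad b e + 4 * b ^ 2 + (1 - 4 * b) * e * v := by linarith
      refine ⟨by nlinarith, ?_⟩
      by_cases he0 : e = 0
      · have hv0 : v ≠ 0 := fun h => hne (h.trans he0.symm)
        have hv' : 2 * b < rad b v := by
          refine Real.lt_sqrt_of_sq_lt ?_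
          have : 0 < (1 - 4 * b) * v ^ 2 := by positivity
          linarith
        have : rad b e = 2 * b := by
          rw [he0, rad, show 4 * b ^ 2 + (1 - 4 * b) * 0 ^ 2 = (2 * b) ^ 2 by ring,
            Real.sqrt_sq (by positivity)]
        rw [this, he0]
        have : 0 < 2 * b * (2 * b) * (rad b v - 2 * b) :=
          mul_pos (by positivity) (sub_pos.2 hv')
        nlinarith [sq_nonneg b]
      · have hR3 : 2 * b < rad b e := by
          refine Real.lt_sqrt_of_sq_lt ?_
          have : 0 < (1 - 4 * b) * e ^ 2 := by positivity
          linarith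
        have h1 : rad b e * (8 * b ^ 2) ≤
            rad b e * (rad b v * rad b e + 4 * b ^ 2 + (1 - 4 * b) * e * v) :=
          mul_le_mul_of_nonneg_left hX hR0.le
        have h2 : 2 * b * (8 * b ^ 2) < rad b e * (8 * b ^ 2) :=
          mul_lt_mul_of_pos_right hR3 (by positivity)
        nlinarith [sq_nonneg b]
    · have hS2 : 1 - 2 * b ≤ rad b v := Real.le_sqrt_of_sq_le (by nlinarith)
      have hR2 : 1 - 2 * b ≤ rad b e := Real.le_sqrt_of_sq_le (by nlinarith)
      have hSR : (1 - 2 * b) ^ 2 ≤ rad b v * rad b e := by nlinarith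
      rcases hq.eq_or_lt with hq | hq
      · obtain rfl : b = 1 / 4 := by linarith
        simp only [rad_quarter]
        norm_num
      -- Now `1 - 4b < 0` and `e v < 1`, so the bracket exceeds `(1 - 2b)² + 4b² + 1 - 4b = 2(1 -
      -- 2b)²`; then `2b² ≤ (1 - 2b)²` finishes the estimate.
      · have hX : 2 * (1 - 2 * b) ^ 2 <
            rad b v * rad b e + 4 * b ^ 2 + (1 - 4 * b) * e * v := by nlinarith
        have hX0 : 0 < rad b v * rad b e + 4 * b ^ 2 + (1 - 4 * b) * e * v := by
          nlinarith [sq_nonneg (1 - 2 * b)]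
        refine ⟨hX0, ?_⟩
        calc 4 * b ^ 2 * (1 - 2 * b) ≤ (1 - 2 * b) * (2 * (1 - 2 * b) ^ 2) := by
              nlinarith [hb.sq_le]
          _ < (1 - 2 * b) * (rad b v * rad b e + 4 * b ^ 2 + (1 - 4 * b) * e * v) :=
              mul_lt_mul_of_pos_left hX hp
          _ ≤ _ := mul_le_mul_of_nonneg_right hR2 hX0.le
  have h := flux_sub_tangent hb hv he main.1.ne'
  have h1 : 4 * b ^ 2 * (1 - 2 * b) /
      (rad b e * (rad b v * rad b e + 4 * b ^ 2 + (1 - 4 * b) * e * v)) < 1 := by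
    rw [div_lt_one (by have := main.1; positivity)]
    exact main.2
  have h2 : 0 < (v - e) ^ 2 / 2 := by have := sub_ne_zero.2 hne; positivity
  nlinarith

end

end RiemannPhase

namespace RiemannPhase

/-! ### Hyperbolic inequalities -/

open Real (cosh sinh one_le_cosh cosh_pos cosh_le_cosh cosh_lt_cosh)

/-- The tangency function: in the coordinate `v = κ sinh x` the sign of `K - hF x y` is the sign of
the excess at `x` of the flux over its tangent line at `y`. -/
noncomputable def hF (x y : ℝ) : ℝ := cosh y * (1 + cosh (x + y))

/-- The chord function: the sign of `hPhi x w z - K` is the sign of the excess at `w` of the flux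
over its chord between `x` and `z`. -/
noncomputable def hPhi (x w z : ℝ) : ℝ :=
  cosh ((x + z) / 2) * (cosh (w + (x + z) / 2) + cosh ((z - x) / 2))

lemma hF_neg (x y : ℝ) : hF (-x) (-y) = hF x y := by
  rw [hF, hF, ← neg_add, Real.cosh_neg, Real.cosh_neg]

lemma hF_pos (x y : ℝ) : 0 < hF x y := by
  have := cosh_pos y
  have := cosh_pos (x + y)
  unfold hF
  positivity

lemma hPhi_pos (x w z : ℝ) : 0 < hPhi x w z := by
  have := cosh_pos ((x + z) / 2)
  have := cosh_pos (w + (x + z) / 2)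
  have := cosh_pos ((z - x) / 2)
  unfold hPhi
  positivity

/-- Both factors are functions of `cosh`, hence of absolute values only. This monotonicity carries
most of the comparisons in the phase diagram. -/
lemma hF_le_hF {x y x' y' : ℝ} (h1 : |y| ≤ |y'|) (h2 : |x + y| ≤ |x' + y'|) :
    hF x y ≤ hF x' y' := by
  have := cosh_pos y'
  have := cosh_pos (x + y)
  exact mul_le_mul (cosh_le_cosh.2 h1) (by linarith [cosh_le_cosh.2 h2]) (by positivity)
    (by positivity)

lemma hF_lt_hF_of_left {x y x' y' : ℝ} (h1 : |y| < |y'|) (h2 : |x + y| ≤ |x' + y'|) :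
    hF x y < hF x' y' := by
  have := cosh_pos y'
  have := cosh_pos (x + y)
  exact mul_lt_mul (cosh_lt_cosh.2 h1) (by linarith [cosh_le_cosh.2 h2]) (by positivity)
    (by positivity)

lemma hF_lt_hF_of_right {x y x' y' : ℝ} (h1 : |y| ≤ |y'|) (h2 : |x + y| < |x' + y'|) :
    hF x y < hF x' y' := by
  have := cosh_pos y'
  have := cosh_pos y
  have := cosh_pos (x + y)
  exact mul_lt_mul' (cosh_le_cosh.2 h1) (by linarith [cosh_lt_cosh.2 h2]) (by positivity)
    (by positivity)

lemma two_mul_cosh_le_hF (x y : ℝ) : 2 * cosh y ≤ hF x y := by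
  have := cosh_pos y
  have := one_le_cosh (x + y)
  unfold hF
  nlinarith

/-- The product-to-sum form shows that `hF` is strictly convex in its second argument; the tangency
equation from a fixed state therefore has at most two roots. -/
lemma hF_eq_sum (x y : ℝ) : hF x y = cosh y + cosh (x + 2 * y) / 2 + cosh x / 2 := by
  have h1 : cosh (x + 2 * y) = cosh (x + y + y) := by ring_nf
  have h2 : cosh x = cosh (x + y - y) := by ring_nf
  rw [hF, h1, h2, Real.cosh_add (x + y) y, Real.cosh_sub (x + y) y]
  ring

lemma cosh_tangent_lt {p q : ℝ} (h : p ≠ q) : cosh q + sinh q * (p - q) < cosh p := by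
  have h1 : p - q ≠ 0 := sub_ne_zero.2 h
  have h2 := Real.add_one_lt_exp h1
  have h3 := Real.add_one_lt_exp (neg_ne_zero.2 h1)
  have e1 : Real.exp p = Real.exp q * Real.exp (p - q) := by rw [← Real.exp_add]; ring_nf
  have e2 : Real.exp (-p) = Real.exp (-q) * Real.exp (-(p - q)) := by
    rw [← Real.exp_add]; ring_nf
  rw [Real.cosh_eq, Real.cosh_eq, Real.sinh_eq, e1, e2]
  nlinarith [mul_pos (Real.exp_pos q) (sub_pos.2 h2), mul_pos (Real.exp_pos (-q)) (sub_pos.2 h3)]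

lemma cosh_tangent_le (p q : ℝ) : cosh q + sinh q * (p - q) ≤ cosh p := by
  rcases eq_or_ne p q with rfl | h
  · simp
  · exact (cosh_tangent_lt h).le

lemma hF_tangent_lt {x y z : ℝ} (h : y ≠ z) :
    hF x z + (sinh z + sinh (x + 2 * z)) * (y - z) < hF x y := by
  rw [hF_eq_sum, hF_eq_sum]
  have h1 := cosh_tangent_lt h
  have h2 := cosh_tangent_le (x + 2 * y) (x + 2 * z)
  linarith

lemma hF_lt_of_between {x y₁ y y₂ K : ℝ} (h1 : y₁ < y) (h2 : y < y₂) (hy1 : hF x y₁ ≤ K)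
    (hy2 : hF x y₂ ≤ K) : hF x y < K := by
  have h3 := hF_tangent_lt (x := x) h1.ne
  have h4 := hF_tangent_lt (x := x) h2.ne'
  rcases le_total 0 (sinh y + sinh (x + 2 * y)) with h | h
  · nlinarith
  · nlinarith

lemma cosh_le_max {x w z t : ℝ} (h1 : x ≤ w) (h2 : w ≤ z) :
    cosh (w + t) ≤ max (cosh (x + t)) (cosh (z + t)) := by
  rcases le_total 0 (w + t) with h | h
  · refine le_max_of_le_right (cosh_le_cosh.2 ?_)
    rw [abs_of_nonneg h, abs_of_nonneg (by linarith)]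
    linarith
  · refine le_max_of_le_left (cosh_le_cosh.2 ?_)
    rw [abs_of_nonpos h, abs_of_nonpos (by linarith)]
    linarith

/-- Quasiconvexity in the first argument: a tangent line strictly below the graph at the two end
states is strictly below it at all states between, apart from the contact point. -/
lemma hF_lt_of_mem_Icc {a v c y K : ℝ} (hv : v ∈ Icc a c) (h1 : hF a y < K) (h2 : hF c y < K) :
    hF v y < K := by
  have hy := cosh_pos y
  unfold hF at *
  rcases le_max_iff.1 (cosh_le_max (t := y) hv.1 hv.2) with h | h
  · nlinarith
  · nlinarith

lemma half_add (a c : ℝ) : 1 + cosh (a + c) = 2 * cosh ((a + c) / 2) ^ 2 := by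
  have := Real.cosh_two_mul ((a + c) / 2)
  rw [mul_div_cancel₀ _ (two_ne_zero)] at this
  rw [this, Real.sinh_sq]
  ring

lemma prod_to_sum (p q : ℝ) : cosh (p + q) + cosh (p - q) = 2 * (cosh p * cosh q) := by
  rw [Real.cosh_add, Real.cosh_sub]
  ring

/-- As `w` reaches an end of the chord, the three-point function degenerates into the tangency
function at that end. -/
lemma hPhi_left (a c : ℝ) : hPhi a a c = hF c a := by
  have h := prod_to_sum (a + (c - a) / 2 + a / 2 + (- a / 2)) a
  have e1 : a + (c - a) / 2 + a / 2 + - a / 2 = (a + c) / 2 := by ring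
  rw [e1] at h
  have e2 : (a + c) / 2 - a = (c - a) / 2 := by ring
  rw [e2] at h
  rw [hPhi, add_comm a ((a + c) / 2), h, hF, add_comm c a, half_add]
  ring

lemma hPhi_right (a c : ℝ) : hPhi a c c = hF a c := by
  have h := prod_to_sum c ((a + c) / 2)
  have e2 : c - (a + c) / 2 = (c - a) / 2 := by ring
  rw [e2] at h
  rw [hPhi, h, hF, half_add]
  ring

/-- Quasiconvexity in `w`: the chord lies above the graph as soon as the tangency inequalities hold
at its two ends. -/
lemma hPhi_le {a w c K : ℝ} (hw : w ∈ Icc a c) (h1 : hF a c ≤ K) (h2 : hF c a ≤ K) :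
    hPhi a w c ≤ K := by
  rw [← hPhi_right] at h1
  rw [← hPhi_left] at h2
  have hy := cosh_pos ((a + c) / 2)
  unfold hPhi at *
  rcases le_max_iff.1 (cosh_le_max (t := (a + c) / 2) hw.1 hw.2) with h | h
  · nlinarith
  · nlinarith

/-- In `w` the chord function is smallest at `w = -(a + c) / 2`, where one `cosh` is `1`. Its value
there is `hF a w = hF c w`, so in the critical case the chord is tangent to the graph at this point.
-/
lemma hF_le_hPhi_mid (a w c : ℝ) : hF a (-(a + c) / 2) ≤ hPhi a w c := by
  have h1 : cosh (-(a + c) / 2) = cosh ((a + c) / 2) := by rw [neg_div, Real.cosh_neg]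
  have h2 : cosh (a + -(a + c) / 2) = cosh ((c - a) / 2) := by
    rw [← Real.cosh_neg]; congr 1; ring
  have := one_le_cosh (w + (a + c) / 2)
  have := cosh_pos ((a + c) / 2)
  rw [hF, hPhi, h1, h2]
  nlinarith

/-- Twice `cosh ((a + c) / 2) cosh ((a + w) / 2)` is `cosh (a + (w + c) / 2) + cosh ((c - w) / 2)`,
and the last term is at least `1`. A chord inequality thus follows from the tangency inequality from
`a` at `(w + c) / 2`. -/
lemma hF_le_hPhi_left (a w c : ℝ) : hF a ((w + c) / 2) ≤ hPhi a w c := by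
  have h := prod_to_sum ((a + w) / 2) ((w + c) / 2)
  have e1 : (a + w) / 2 + (w + c) / 2 = w + (a + c) / 2 := by ring
  have e2 : (a + w) / 2 - (w + c) / 2 = -((c - a) / 2) := by ring
  rw [e1, e2, Real.cosh_neg] at h
  have h3 := prod_to_sum ((a + c) / 2) ((a + w) / 2)
  have e3 : (a + c) / 2 + (a + w) / 2 = a + (w + c) / 2 := by ring
  rw [e3] at h3
  have := one_le_cosh ((a + c) / 2 - (a + w) / 2)
  have := cosh_pos ((w + c) / 2)
  rw [hF, hPhi, h]
  nlinarith

lemma hF_le_hPhi_right (a w c : ℝ) : hF c ((a + w) / 2) ≤ hPhi a w c := by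
  have h := prod_to_sum ((a + w) / 2) ((w + c) / 2)
  have e1 : (a + w) / 2 + (w + c) / 2 = w + (a + c) / 2 := by ring
  have e2 : (a + w) / 2 - (w + c) / 2 = -((c - a) / 2) := by ring
  rw [e1, e2, Real.cosh_neg] at h
  have h3 := prod_to_sum ((a + c) / 2) ((w + c) / 2)
  have e3 : (a + c) / 2 + (w + c) / 2 = c + (a + w) / 2 := by ring
  rw [e3] at h3
  have := one_le_cosh ((a + c) / 2 - (w + c) / 2)
  have := cosh_pos ((a + w) / 2)
  rw [hF, hPhi, h]
  nlinarith

/-! ### Roots of the tangency function -/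

/-- `i` and `m` are the coordinates of the inflection point and of the maximum point. -/
structure HypParams (K i m : ℝ) : Prop where
  i_pos : 0 < i
  i_eq : 2 * cosh i ^ 3 = K
  m_pos : 0 < m
  m_eq : 2 * cosh m = K

section

variable {K i m : ℝ}

lemma HypParams.hF_ii (h : HypParams K i m) : hF i i = K := by
  rw [hF, ← two_mul, Real.cosh_two_mul, Real.sinh_sq, ← h.i_eq]
  ring

lemma HypParams.hF_le (h : HypParams K i m) {x y : ℝ} (hx : x ∈ Icc (-i) i) (hy : y ∈ Icc (-i) i) :
    hF x y ≤ K := by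
  have h0 := h.i_pos
  rw [← h.hF_ii]
  refine hF_le_hF ?_ ?_
  · rw [abs_of_pos h0]; exact abs_le.2 hy
  · rw [abs_of_pos (by linarith : 0 < i + i)]
    exact abs_le.2 ⟨by linarith [hx.1, hy.1], by linarith [hx.2, hy.2]⟩

lemma HypParams.hF_lt (h : HypParams K i m) {x y : ℝ} (hx : x ∈ Icc (-i) i) (hy : y ∈ Ioo (-i) i) :
    hF x y < K := by
  have h0 := h.i_pos
  rw [← h.hF_ii]
  refine hF_lt_hF_of_left ?_ ?_
  · rw [abs_of_pos h0]; exact abs_lt.2 hy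
  · rw [abs_of_pos (by linarith : 0 < i + i)]
    exact abs_le.2 ⟨by linarith [hx.1, hy.1], by linarith [hx.2, hy.2]⟩

lemma HypParams.lt_hF (h : HypParams K i m) {x y : ℝ} (hx : i ≤ x) (hy : i < y) : K < hF x y := by
  have h0 := h.i_pos
  rw [← h.hF_ii]
  refine hF_lt_hF_of_left ?_ ?_
  · rw [abs_of_pos h0, abs_of_pos (h0.trans hy)]; exact hy
  · rw [abs_of_pos (by linarith : 0 < i + i), abs_of_pos (by linarith)]
    linarith

lemma HypParams.i_lt_m (h : HypParams K i m) : i < m := by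
  have h1 : 1 < cosh i := Real.one_lt_cosh.2 h.i_pos.ne'
  have h2 : cosh i < cosh m := by
    have := h.i_eq.trans h.m_eq.symm
    nlinarith [mul_pos (by linarith : 0 < cosh i) (by nlinarith : 0 < cosh i ^ 2 - 1)]
  rwa [cosh_lt_cosh, abs_of_pos h.i_pos, abs_of_pos h.m_pos] at h2

/-- Since `1 + cosh ≥ 2`, no tangent line at a point beyond `±m` can meet the graph again. In
particular all tangency points have modulus at most `m`. -/
lemma HypParams.abs_le_m (h : HypParams K i m) {x y : ℝ} (hF : hF x y ≤ K) : |y| ≤ m := by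
  have h1 := two_mul_cosh_le_hF x y
  have h2 : cosh y ≤ cosh m := by linarith [h.m_eq]
  rwa [cosh_le_cosh, abs_of_pos h.m_pos] at h2

lemma HypParams.lt_hF_of_m_lt (h : HypParams K i m) {x y : ℝ} (hy : m < |y|) : K < hF x y := by
  by_contra! hle
  exact (h.abs_le_m hle).not_gt hy

/-- Left states close to the inflection points have a tangency point in the convex region. -/
lemma HypParams.exists_near (h : HypParams K i m) {a : ℝ} (ha : a < -i) (ha' : -(3 * i) < a) :
    ∃ e ∈ Ioo (-i) i, hF a e = K ∧ (∀ y < e, K < hF a y) ∧ ∀ y ∈ Ioc e i, hF a y < K := by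
  have h0 := h.i_pos
  have hi : hF a i < K := by
    rw [← h.hF_ii]
    refine hF_lt_hF_of_right le_rfl ?_
    rw [abs_of_pos (by linarith : 0 < i + i)]
    exact abs_lt.2 ⟨by linarith, by linarith⟩
  have hni : K < hF a (-i) := by
    rw [← h.hF_ii]
    refine hF_lt_hF_of_right (by rw [abs_neg]) ?_
    rw [abs_of_pos (by linarith : 0 < i + i), abs_of_neg (by linarith)]
    linarith
  have hc : Continuous (hF a) := by unfold hF; fun_prop
  obtain ⟨e, he, heq⟩ := intermediate_value_Ioo' (by linarith : -i ≤ i) hc.continuousOn ⟨hi, hni⟩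
  refine ⟨e, he, heq, fun y hy => ?_, fun y hy => ?_⟩
  -- By strict convexity in `y`, a second value at most `K` to the left of `e`, together with the
  -- value below `K` at `i`, would make `hF a e` less than `K`.
  · by_contra! hle
    exact (hF_lt_of_between hy he.2 hle hi.le).ne heq
  · rcases hy.2.eq_or_lt with rfl | hlt
    · exact hi
    · exact hF_lt_of_between hy.1 hlt heq.le hi.le

/-- The critical state is `-3i`: there the derivative in `y` at `y = i` is `sinh i + sinh (-i) = 0`
and the value is `K`, so by convexity `i` is the strict minimum. Moving `a` further left increases
`|a + y|` as long as `y ≤ 3i`, and for `y ≥ 3i` the bound `2 cosh 3i > K` suffices. -/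
lemma HypParams.lt_hF_far (h : HypParams K i m) {a y : ℝ} (ha : a ≤ -(3 * i)) (hy : y ≠ i) :
    K < hF a y := by
  have h0 := h.i_pos
  rcases le_total y (3 * i) with hy3 | hy3
  · have h1 : hF (-(3 * i)) y ≤ hF a y := by
      refine hF_le_hF le_rfl ?_
      rw [abs_of_nonpos (by linarith), abs_of_nonpos (by linarith)]
      linarith
    have h2 := hF_tangent_lt (x := -(3 * i)) hy
    have e1 : -(3 * i) + 2 * i = -i := by ring
    rw [e1, Real.sinh_neg, add_neg_cancel, zero_mul, add_zero] at h2
    have e2 : hF (-(3 * i)) i = K := by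
      rw [← h.hF_ii, hF, hF, ← Real.cosh_neg (-(3 * i) + i)]
      ring_nf
    linarith
  · have h1 := two_mul_cosh_le_hF a y
    have h2 : cosh (3 * i) ≤ cosh y := by
      rw [cosh_le_cosh, abs_of_pos (by linarith), abs_of_nonneg (by linarith)]
      exact hy3
    rw [Real.cosh_three_mul] at h2
    have h3 : 1 < cosh i := Real.one_lt_cosh.2 h0.ne'
    have h4 := h.i_eq
    nlinarith [mul_pos (by linarith : 0 < cosh i) (by nlinarith : 0 < cosh i ^ 2 - 1)]

lemma HypParams.le_hF_far (h : HypParams K i m) {a : ℝ} (ha : a ≤ -(3 * i)) (y : ℝ) :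
    K ≤ hF a y := by
  rcases eq_or_ne y i with rfl | hy
  · have h0 := h.i_pos
    rw [← h.hF_ii]
    refine hF_le_hF le_rfl ?_
    rw [abs_of_pos (by linarith : 0 < y + y), abs_of_nonpos (by linarith)]
    linarith
  · exact (h.lt_hF_far ha hy).le

lemma HypParams.exists_near' (h : HypParams K i m) {c : ℝ} (hc : i < c) (hc' : c < 3 * i) :
    ∃ e ∈ Ioo (-i) i, hF c e = K ∧ (∀ y > e, K < hF c y) ∧ ∀ y ∈ Ico (-i) e, hF c y < K := by
  obtain ⟨e, he, h1, h2, h3⟩ := h.exists_near (a := -c) (by linarith) (by linarith)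
  refine ⟨-e, ⟨by linarith [he.2], by linarith [he.1]⟩, ?_, fun y hy => ?_, fun y hy => ?_⟩
  · rw [← h1, ← hF_neg, neg_neg]
  · rw [← hF_neg]; exact h2 _ (by linarith)
  · rw [← hF_neg]; exact h3 _ ⟨by linarith [hy.2], by linarith [hy.1]⟩

lemma HypParams.lt_hF_far' (h : HypParams K i m) {c y : ℝ} (hc : 3 * i ≤ c) (hy : y ≠ -i) :
    K < hF c y := by
  rw [← hF_neg]
  exact h.lt_hF_far (by linarith) fun h => hy (by linarith)

lemma HypParams.le_hF_far' (h : HypParams K i m) {c : ℝ} (hc : 3 * i ≤ c) (y : ℝ) :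
    K ≤ hF c y := by
  rw [← hF_neg]
  exact h.le_hF_far (by linarith) _

lemma hF_lt_hF_of_abs_le {a y z : ℝ} (hy : |a| ≤ y) (hz : y < z) : hF a y < hF a z := by
  have h1 := abs_le.1 hy
  have h0 := (abs_nonneg a).trans hy
  refine hF_lt_hF_of_left ?_ ?_
  · rw [abs_of_nonneg h0, abs_of_nonneg (by linarith)]; exact hz
  · rw [abs_of_nonneg (by linarith), abs_of_nonneg (by linarith)]; linarith

lemma HypParams.hF_abs_le (h : HypParams K i m) {a : ℝ} (ha : -m ≤ a) (ha' : a ≤ i) :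
    hF a |a| ≤ K := by
  rcases le_total 0 a with h0 | h0
  · rw [abs_of_nonneg h0]
    exact h.hF_le ⟨by linarith, ha'⟩ ⟨by linarith, ha'⟩
  · rw [abs_of_nonpos h0, hF, add_neg_cancel, Real.cosh_zero, Real.cosh_neg, ← h.m_eq]
    have : cosh a ≤ cosh m := by
      rw [cosh_le_cosh, abs_of_nonpos h0, abs_of_pos h.m_pos]; linarith
    linarith

/-- The rightmost tangency point. -/
lemma HypParams.exists_right (h : HypParams K i m) {a : ℝ} (ha : -m ≤ a) (ha' : a < i) :
    ∃ e, i < e ∧ |a| ≤ e ∧ e ≠ a ∧ hF a e = K ∧ (∀ y ∈ Icc |a| e, hF a y ≤ K) ∧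
      ∀ y > e, K < hF a y := by
  have h0 := h.i_pos
  have hc : Continuous (hF a) := by unfold hF; fun_prop
  have h1 := h.hF_abs_le ha ha'.le
  have h2 : K < hF a (|a| + m + 1) := h.lt_hF_of_m_lt (by
    have := abs_nonneg a
    rw [abs_of_pos (by linarith [h.m_pos])]
    linarith)
  obtain ⟨e, he, heq⟩ := intermediate_value_Icc (by linarith [h.m_pos] : |a| ≤ |a| + m + 1)
    hc.continuousOn ⟨h1, h2.le⟩
  have hgt : ∀ y > e, K < hF a y := fun y hy => heq ▸ hF_lt_hF_of_abs_le he.1 hy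
  have hie : i < e := by
    by_contra! hle
    have h3 : |a| ≤ i := he.1.trans hle
    -- If `e ≤ i`, then `|a| ≤ i`. The assumption `a < i` makes the value at `i` smaller than `hF i
    -- i = K`, whereas from `e` on the values are at least `K`.
    have h4 : hF a i < K := by
      rw [← h.hF_ii]
      refine hF_lt_hF_of_right le_rfl ?_
      rw [abs_of_pos (by linarith : 0 < i + i)]
      exact abs_lt.2 ⟨by linarith [(abs_le.1 h3).1], by linarith⟩
    rcases hle.eq_or_lt with rfl | hlt
    · exact h4.ne heq
    · exact (hgt i hlt).not_gt h4
  refine ⟨e, hie, he.1, by linarith, heq, fun y hy => ?_, hgt⟩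
  rcases hy.2.eq_or_lt with rfl | hlt
  · exact heq.le
  · exact heq ▸ (hF_lt_hF_of_abs_le hy.1 hlt).le

/-- The leftmost tangency point. -/
lemma HypParams.exists_left (h : HypParams K i m) {c : ℝ} (hc : -i < c) (hc' : c ≤ m) :
    ∃ e, e < -i ∧ e ≤ -|c| ∧ e ≠ c ∧ hF c e = K ∧ (∀ y ∈ Icc e (-|c|), hF c y ≤ K) ∧
      ∀ y < e, K < hF c y := by
  obtain ⟨e, h1, h2, h3, h4, h5, h6⟩ := h.exists_right (a := -c) (by linarith) (by linarith)
  rw [abs_neg] at h2 h5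
  refine ⟨-e, by linarith, by linarith, fun h => h3 (by linarith), ?_, fun y hy => ?_,
    fun y hy => ?_⟩
  · rw [← h4, ← hF_neg, neg_neg]
  · rw [← hF_neg]; exact h5 _ ⟨by linarith [hy.2], by linarith [hy.1]⟩
  · rw [← hF_neg]; exact h6 _ (by linarith)

/-- For fixed `y` the value determines `cosh (x + y)`. The tangent line at `y` meets the graph
elsewhere in at most two points, exchanged by `x ↦ -2y - x`. -/
lemma hF_eq_hF {x x' y : ℝ} (h : hF x y = hF x' y) : x = x' ∨ x + y = -(x' + y) := by
  have h1 : cosh (x + y) = cosh (x' + y) := by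
    have := cosh_pos y
    unfold hF at h
    nlinarith [mul_left_cancel₀ this.ne' h]
  have h2 : |x + y| = |x' + y| := le_antisymm (cosh_le_cosh.1 h1.le) (cosh_le_cosh.1 h1.ge)
  rcases abs_eq_abs.1 h2 with h | h
  · exact Or.inl (by linarith)
  · exact Or.inr h

lemma finite_hF_eq (K y : ℝ) : {x | hF x y = K}.Finite := by
  by_cases hne : ∃ x₀, hF x₀ y = K
  · obtain ⟨x₀, hx₀⟩ := hne
    refine ((finite_singleton (-(x₀ + y) - y)).insert x₀).subset fun x hx => ?_
    rcases hF_eq_hF (hx.trans hx₀.symm) with h | h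
    · exact Or.inl h
    · exact Or.inr (by simp only [mem_singleton_iff]; linarith)
  · convert finite_empty (α := ℝ)
    ext x
    simpa using fun h => hne ⟨x, h⟩

end

end RiemannPhase

namespace RiemannPhase

open Real (cosh sinh one_le_cosh cosh_pos cosh_le_cosh cosh_lt_cosh)

/-! ### The hyperbolic coordinate -/

/-- The scale of the hyperbolic coordinate. -/
noncomputable def kap (b : ℝ) : ℝ := 2 * b / Real.sqrt (1 - 4 * b)

/-- The threshold of the tangency function. -/
noncomputable def thr (b : ℝ) : ℝ := (1 - 2 * b) / (2 * b)

/-- The state with hyperbolic coordinate `x`. -/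
noncomputable def st (b x : ℝ) : ℝ := kap b * sinh x

/-- The hyperbolic coordinate of the state `v`. -/
noncomputable def co (b v : ℝ) : ℝ := Real.arsinh (v / kap b)

/-- `0 < b < 1/6`. -/
structure Small (b : ℝ) : Prop where
  pos : 0 < b
  lt : b < 1 / 6

section

variable {b : ℝ}

lemma Small.admissible (hb : Small b) : Admissible b :=
  ⟨hb.pos, by linarith [hb.lt], by nlinarith [hb.lt, hb.pos]⟩

lemma Small.kap_pos (hb : Small b) : 0 < kap b := by
  have := hb.pos
  have : 0 < Real.sqrt (1 - 4 * b) := Real.sqrt_pos.2 (by linarith [hb.lt])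
  unfold kap
  positivity

lemma Small.kap_sq (hb : Small b) : (1 - 4 * b) * kap b ^ 2 = 4 * b ^ 2 := by
  have h : 0 < 1 - 4 * b := by linarith [hb.lt]
  rw [kap, div_pow, Real.sq_sqrt h.le]
  field_simp
  ring

lemma Small.st_co (hb : Small b) (v : ℝ) : st b (co b v) = v := by
  rw [st, co, Real.sinh_arsinh, mul_div_cancel₀ _ hb.kap_pos.ne']

lemma Small.strictMono_st (hb : Small b) : StrictMono (st b) :=
  Real.sinh_strictMono.const_mul hb.kap_pos

lemma st_neg (b x : ℝ) : st b (-x) = -st b x := by rw [st, st, Real.sinh_neg, mul_neg]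

/-- The scale satisfies `(1 - 4b) κ² = 4b²`, so the radicand becomes `4b² (1 + sinh² x)`. -/
lemma Small.rad_st (hb : Small b) (x : ℝ) : rad b (st b x) = 2 * b * cosh x := by
  have h1 := hb.pos
  have h2 := cosh_pos x
  have h3 : 4 * b ^ 2 + (1 - 4 * b) * st b x ^ 2 = (2 * b * cosh x) ^ 2 := by
    rw [st]
    linear_combination sinh x ^ 2 * hb.kap_sq - 4 * b ^ 2 * Real.cosh_sq x
  rw [rad, h3, Real.sqrt_sq (by positivity)]

lemma Small.cosh_co (hb : Small b) (v : ℝ) : 2 * b * cosh (co b v) = rad b v := by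
  rw [← hb.rad_st, hb.st_co]

lemma Small.co_pos (hb : Small b) {v : ℝ} (hv : 0 < v) : 0 < co b v :=
  Real.arsinh_pos_iff.2 (div_pos hv hb.kap_pos)

lemma Small.vMax_sq (hb : Small b) :
    vMax b ^ 2 = (1 + 2 * b) * (1 - 6 * b) / (4 * (1 - 4 * b)) := by
  have h1 := hb.pos
  have h2 := hb.lt
  have h3 : 0 < 1 - 4 * b := by linarith
  have h4 : 0 < 1 - 6 * b := by linarith
  rw [vMax, mul_pow, Real.sq_sqrt (by positivity)]
  field_simp
  ring

lemma Small.vMax_pos (hb : Small b) : 0 < vMax b := by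
  have h1 := hb.pos
  have h3 : 0 < 1 - 4 * b := by linarith [hb.lt]
  have h4 : 0 < 1 - 6 * b := by linarith [hb.lt]
  have : 0 < Real.sqrt ((1 + 2 * b) * (1 - 6 * b) / (1 - 4 * b)) := Real.sqrt_pos.2 (by positivity)
  unfold vMax
  positivity

lemma Small.vMax_lt_one (hb : Small b) : vMax b < 1 := by
  have h1 := hb.pos
  have h3 : 0 < 1 - 4 * b := by linarith [hb.lt]
  refine lt_of_pow_lt_pow_left₀ 2 zero_le_one ?_
  rw [hb.vMax_sq, one_pow, div_lt_one (by positivity)]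
  nlinarith [hb.lt]

lemma Small.rad_vMax (hb : Small b) : rad b (vMax b) = (1 - 2 * b) / 2 := by
  have h3 : 0 < 1 - 4 * b := by linarith [hb.lt]
  have h4 : 4 * b ^ 2 + (1 - 4 * b) * vMax b ^ 2 = ((1 - 2 * b) / 2) ^ 2 := by
    rw [hb.vMax_sq]
    field_simp
    ring
  rw [rad, h4, Real.sqrt_sq (by linarith [hb.lt])]

/-- Here `b < 1/6` enters: it is equivalent to `8b³ < 2b²(1 - 2b)`, and the `2/3` power of `8b³` is
`4b²`. Hence `vInfl` is the root of a positive number. -/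
lemma Small.vInfl_aux (hb : Small b) : 4 * b ^ 2 < (2 * b ^ 2 * (1 - 2 * b)) ^ ((2 : ℝ) / 3) := by
  have h1 := hb.pos
  have h2 : 8 * b ^ 3 < 2 * b ^ 2 * (1 - 2 * b) := by
    nlinarith [mul_pos (pow_pos h1 2) (by linarith [hb.lt] : 0 < 1 - 6 * b)]
  have h3 : (8 * b ^ 3) ^ ((2 : ℝ) / 3) = 4 * b ^ 2 := by
    rw [show 8 * b ^ 3 = (2 * b) ^ (3 : ℝ) by norm_cast; ring, ← Real.rpow_mul (by positivity)]
    norm_num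
    ring
  rw [← h3]
  exact Real.rpow_lt_rpow (by positivity) h2 (by norm_num)

lemma Small.vInfl_pos (hb : Small b) : 0 < vInfl b :=
  Real.sqrt_pos.2 (div_pos (sub_pos.2 hb.vInfl_aux) (by linarith [hb.lt]))

lemma Small.rad_vInfl (hb : Small b) : rad b (vInfl b) ^ 3 = 2 * b ^ 2 * (1 - 2 * b) := by
  have h1 := hb.pos
  have h3 : 0 < 1 - 4 * b := by linarith [hb.lt]
  have hX : 0 ≤ 2 * b ^ 2 * (1 - 2 * b) := mul_nonneg (by positivity) (by linarith [hb.lt])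
  have h4 : 4 * b ^ 2 + (1 - 4 * b) * vInfl b ^ 2 = (2 * b ^ 2 * (1 - 2 * b)) ^ ((2 : ℝ) / 3) := by
    rw [vInfl, Real.sq_sqrt (div_pos (sub_pos.2 hb.vInfl_aux) h3).le]
    field_simp
    ring
  rw [rad, h4, Real.sqrt_eq_rpow, ← Real.rpow_mul hX, ← Real.rpow_natCast, ← Real.rpow_mul hX]
  norm_num

/-- The closed forms of `vInfl` and `vMax` are used only through `rad³ = 2b²(1 - 2b)` and `rad = (1
- 2b)/2`; with `rad = 2b cosh` these are the defining equations of `i` and `m`. -/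
lemma Small.hypParams (hb : Small b) : HypParams (thr b) (co b (vInfl b)) (co b (vMax b)) where
  i_pos := hb.co_pos hb.vInfl_pos
  i_eq := by
    have h1 := hb.pos
    have h2 := hb.rad_vInfl
    rw [← hb.cosh_co] at h2
    rw [thr, eq_div_iff (by positivity)]
    have h3 : b ^ 2 ≠ 0 := by positivity
    refine mul_left_cancel₀ h3 ?_
    linear_combination h2 / 2
  m_pos := hb.co_pos hb.vMax_pos
  m_eq := by
    have h1 := hb.pos
    have h2 := hb.rad_vMax
    rw [← hb.cosh_co] at h2
    rw [thr, eq_div_iff (by positivity)]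
    linear_combination 2 * h2

lemma Small.mem_iff (hb : Small b) {x : ℝ} :
    st b x ∈ Icc (-1 : ℝ) 1 ↔ x ∈ Icc (-co b 1) (co b 1) := by
  have h1 := hb.st_co 1
  have h2 : st b (-co b 1) = -1 := by rw [st_neg, h1]
  rw [mem_Icc, mem_Icc, ← hb.strictMono_st.le_iff_le (a := -co b 1),
    ← hb.strictMono_st.le_iff_le (b := co b 1), h1, h2]

lemma Small.co_vMax_lt (hb : Small b) : co b (vMax b) < co b 1 := by
  rw [← hb.strictMono_st.lt_iff_lt, hb.st_co, hb.st_co]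
  exact hb.vMax_lt_one

/-- The excess of the flux over its tangent line, in the hyperbolic coordinate. -/
lemma Small.sub_tangent (hb : Small b) {x y : ℝ} (hx : st b x ∈ Icc (-1 : ℝ) 1)
    (hy : st b y ∈ Icc (-1 : ℝ) 1) :
    flux b (st b x) - (flux b (st b y) + deriv (flux b) (st b y) * (st b x - st b y)) =
      (st b x - st b y) ^ 2 / 2 * (thr b / hF x y - 1) := by
  have h1 := hb.pos
  have hc := cosh_pos y
  have hc2 := cosh_pos (x + y)
  have hT : rad b (st b x) * rad b (st b y) + 4 * b ^ 2 + (1 - 4 * b) * st b y * st b x =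
      4 * b ^ 2 * (1 + cosh (x + y)) := by
    rw [hb.rad_st, hb.rad_st, st, st, Real.cosh_add]
    linear_combination (sinh x * sinh y) * hb.kap_sq
  rw [flux_sub_tangent hb.admissible hx hy (by rw [hT]; positivity), hT, hb.rad_st, thr, hF]
  congr 2
  field_simp

lemma Small.lt_tangent (hb : Small b) {x y : ℝ} (hx : st b x ∈ Icc (-1 : ℝ) 1)
    (hy : st b y ∈ Icc (-1 : ℝ) 1) (hne : x ≠ y) (h : thr b < hF x y) :
    flux b (st b x) < flux b (st b y) + deriv (flux b) (st b y) * (st b x - st b y) := by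
  have h1 := hb.sub_tangent hx hy
  have h2 : thr b / hF x y < 1 := (div_lt_one (hF_pos _ _)).2 h
  have h3 : 0 < (st b x - st b y) ^ 2 / 2 := by
    have := sub_ne_zero.2 (hb.strictMono_st.injective.ne hne)
    positivity
  nlinarith

lemma Small.tangent_lt (hb : Small b) {x y : ℝ} (hx : st b x ∈ Icc (-1 : ℝ) 1)
    (hy : st b y ∈ Icc (-1 : ℝ) 1) (hne : x ≠ y) (h : hF x y < thr b) :
    flux b (st b y) + deriv (flux b) (st b y) * (st b x - st b y) < flux b (st b x) := by
  have h1 := hb.sub_tangent hx hy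
  have h2 : 1 < thr b / hF x y := (one_lt_div (hF_pos _ _)).2 h
  have h3 : 0 < (st b x - st b y) ^ 2 / 2 := by
    have := sub_ne_zero.2 (hb.strictMono_st.injective.ne hne)
    positivity
  nlinarith

lemma Small.eq_tangent_iff (hb : Small b) {x y : ℝ} (hx : st b x ∈ Icc (-1 : ℝ) 1)
    (hy : st b y ∈ Icc (-1 : ℝ) 1) (hne : x ≠ y) :
    flux b (st b x) = flux b (st b y) + deriv (flux b) (st b y) * (st b x - st b y) ↔
      hF x y = thr b := by
  constructor
  · intro h
    rcases lt_trichotomy (hF x y) (thr b) with h1 | h1 | h1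
    · exact absurd h (hb.tangent_lt hx hy hne h1).ne'
    · exact h1
    · exact absurd h (hb.lt_tangent hx hy hne h1).ne
  · intro h
    have h1 := hb.sub_tangent hx hy
    rw [h, div_self (h ▸ (hF_pos x y).ne'), sub_self, mul_zero] at h1
    linarith

lemma Small.flux_st (hb : Small b) (x : ℝ) :
    flux b (st b x) = kap b ^ 2 / 2 * (thr b * cosh x - cosh x ^ 2) := by
  have h1 := hb.pos
  have h3 : 1 - 4 * b ≠ 0 := by linarith [hb.lt]
  have hk : kap b ^ 2 = 4 * b ^ 2 / (1 - 4 * b) := by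
    rw [eq_div_iff h3]; linear_combination hb.kap_sq
  have h4 : 0 ≤ 4 * b ^ 2 + (1 - 4 * b) * st b x ^ 2 := by
    have : 0 < 1 - 4 * b := by linarith [hb.lt]
    positivity
  rw [flux_eq hb.admissible h3 h4, hb.rad_st, st, mul_pow, Real.sinh_sq, hk, thr]
  field_simp
  ring

lemma sinh_sub_sinh (p q : ℝ) : sinh p - sinh q = 2 * (sinh ((p - q) / 2) * cosh ((p + q) / 2)) := by
  have e1 : p = (p + q) / 2 + (p - q) / 2 := by ring
  have e2 : q = (p + q) / 2 - (p - q) / 2 := by ring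
  conv_lhs => rw [e1, e2, Real.sinh_add, Real.sinh_sub]
  ring_nf

lemma hPhi_eq (a w c : ℝ) :
    hPhi a w c = 2 * (cosh ((a + w) / 2) * cosh ((w + c) / 2) * cosh ((a + c) / 2)) := by
  have h := prod_to_sum ((a + w) / 2) ((w + c) / 2)
  have e1 : (a + w) / 2 + (w + c) / 2 = w + (a + c) / 2 := by ring
  have e2 : (a + w) / 2 - (w + c) / 2 = -((c - a) / 2) := by ring
  rw [e1, e2, Real.cosh_neg] at h
  rw [hPhi, h]
  ring

lemma sinh_add_sinh_sub (A B : ℝ) :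
    sinh (2 * A) + sinh (2 * B) - sinh (2 * (A + B)) = -4 * (sinh A * sinh B * sinh (A + B)) := by
  simp only [Real.sinh_two_mul, Real.sinh_add, Real.cosh_add]
  linear_combination (-2 * sinh A * cosh A) * Real.cosh_sq B - 2 * sinh B * cosh B * Real.cosh_sq A

/-- The chord determinant of the hyperbola `(sinh x, cosh x)`. With `A, B` the two half differences
it is a product of three `sinh`; comparison with the same factorization of the `sinh` differences
leaves the three `cosh` whose product is half of `hPhi`. -/
lemma hyperbola_chord (a w c : ℝ) :
    (cosh w - cosh a) * (sinh c - sinh a) - (cosh c - cosh a) * (sinh w - sinh a) =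
      -((sinh w - sinh a) * (sinh c - sinh w) * (sinh c - sinh a) / hPhi a w c) := by
  have hL : (cosh w - cosh a) * (sinh c - sinh a) - (cosh c - cosh a) * (sinh w - sinh a) =
      sinh (2 * ((c - w) / 2)) + sinh (2 * ((w - a) / 2)) - sinh (2 * ((c - w) / 2 + (w - a) / 2)) := by
    have e1 : 2 * ((c - w) / 2) = c - w := by ring
    have e2 : 2 * ((w - a) / 2) = w - a := by ring
    have e3 : 2 * ((c - w) / 2 + (w - a) / 2) = c - a := by ring
    rw [e1, e2, e3, Real.sinh_sub, Real.sinh_sub, Real.sinh_sub]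
    ring
  rw [hL, sinh_add_sinh_sub, hPhi_eq, sinh_sub_sinh w a, sinh_sub_sinh c w, sinh_sub_sinh c a]
  have e3 : (c - w) / 2 + (w - a) / 2 = (c - a) / 2 := by ring
  rw [e3, add_comm w a, add_comm c w, add_comm c a]
  have := cosh_pos ((a + w) / 2)
  have := cosh_pos ((w + c) / 2)
  have := cosh_pos ((a + c) / 2)
  field_simp
  ring

/-- The excess of the flux over its chord, in the hyperbolic coordinate. -/
lemma Small.sub_chord (hb : Small b) (a w c : ℝ) :
    (flux b (st b w) - flux b (st b a)) * (st b c - st b a) -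
      (flux b (st b c) - flux b (st b a)) * (st b w - st b a) =
    (st b w - st b a) * (st b c - st b w) * (st b c - st b a) / 2 * (1 - thr b / hPhi a w c) := by
  have h := hyperbola_chord a w c
  have h0 := hPhi_pos a w c
  -- In this coordinate the flux is a quadratic in `sinh x` plus a multiple of `cosh x`. The
  -- quadratic contributes the summand `1` of the last factor, the hyperbola the summand `- thr b /
  -- hPhi a w c`.
  rw [hb.flux_st, hb.flux_st, hb.flux_st, st, st, st, Real.cosh_sq w, Real.cosh_sq a,
    Real.cosh_sq c]
  rw [div_eq_mul_inv] at h
  rw [div_eq_mul_inv (thr b)]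
  linear_combination (kap b ^ 3 / 2 * thr b) * h

lemma Small.le_chord (hb : Small b) {a w c : ℝ} (haw : a ≤ w) (hwc : w ≤ c)
    (h : hPhi a w c ≤ thr b) :
    (flux b (st b w) - flux b (st b a)) * (st b c - st b a) ≤
      (flux b (st b c) - flux b (st b a)) * (st b w - st b a) := by
  have h1 := hb.sub_chord a w c
  have h2 : 1 ≤ thr b / hPhi a w c := (one_le_div (hPhi_pos _ _ _)).2 h
  have h3 : 0 ≤ (st b w - st b a) * (st b c - st b w) * (st b c - st b a) / 2 := by
    have := sub_nonneg.2 (hb.strictMono_st.monotone haw)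
    have := sub_nonneg.2 (hb.strictMono_st.monotone hwc)
    have := sub_nonneg.2 (hb.strictMono_st.monotone (haw.trans hwc))
    positivity
  nlinarith

lemma Small.chord_le (hb : Small b) {a w c : ℝ} (haw : a ≤ w) (hwc : w ≤ c)
    (h : thr b ≤ hPhi a w c) :
    (flux b (st b c) - flux b (st b a)) * (st b w - st b a) ≤
    (flux b (st b w) - flux b (st b a)) * (st b c - st b a) := by
  have h1 := hb.sub_chord a w c
  have h2 : thr b / hPhi a w c ≤ 1 := (div_le_one (hPhi_pos _ _ _)).2 h
  have h3 : 0 ≤ (st b w - st b a) * (st b c - st b w) * (st b c - st b a) / 2 := by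
    have := sub_nonneg.2 (hb.strictMono_st.monotone haw)
    have := sub_nonneg.2 (hb.strictMono_st.monotone hwc)
    have := sub_nonneg.2 (hb.strictMono_st.monotone (haw.trans hwc))
    positivity
  nlinarith

/-! ### Tangency and intersection points in the hyperbolic coordinate -/

/-- Because `vMax < 1`, every root of the tangency equation is automatically an admissible state,
and the restriction to `[-1, 1]` costs no tangency point. -/
lemma Small.mem_of_hF_le (hb : Small b) {x y : ℝ} (h : hF x y ≤ thr b) :
    st b y ∈ Icc (-1 : ℝ) 1 := by
  rw [hb.mem_iff]
  exact abs_le.1 ((hb.hypParams.abs_le_m h).trans hb.co_vMax_lt.le)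

lemma Small.tangencyPoints_eq (hb : Small b) {x : ℝ} (hx : st b x ∈ Icc (-1 : ℝ) 1) :
    tangencyPoints b (st b x) = st b '' {y | y ≠ x ∧ hF x y = thr b} := by
  ext e
  constructor
  · rintro ⟨h1, h2, h3⟩
    rw [← hb.st_co e] at h1 h2 h3
    have hne : co b e ≠ x := fun h => h2 (by rw [h])
    exact ⟨co b e, ⟨hne, (hb.eq_tangent_iff hx h1 hne.symm).1 h3⟩, hb.st_co e⟩
  · rintro ⟨y, ⟨hne, h⟩, rfl⟩
    have hy := hb.mem_of_hF_le h.le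
    exact ⟨hy, hb.strictMono_st.injective.ne hne, (hb.eq_tangent_iff hx hy hne.symm).2 h⟩

lemma Small.rightHits_eq (hb : Small b) {y : ℝ} (hy : st b y ∈ Icc (-1 : ℝ) 1) :
    {v | v ∈ tangentHits b (st b y) ∧ st b y < v} =
      st b '' {x | st b x ∈ Icc (-1 : ℝ) 1 ∧ y < x ∧ hF x y = thr b} := by
  ext v
  constructor
  · rintro ⟨⟨h1, h2⟩, h3⟩
    rw [← hb.st_co v] at h1 h2 h3
    have hlt := hb.strictMono_st.lt_iff_lt.1 h3
    exact ⟨co b v, ⟨h1, hlt, (hb.eq_tangent_iff h1 hy hlt.ne').1 h2⟩, hb.st_co v⟩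
  · rintro ⟨x, ⟨hx, hlt, h⟩, rfl⟩
    exact ⟨⟨hx, (hb.eq_tangent_iff hx hy hlt.ne').2 h⟩, hb.strictMono_st hlt⟩

lemma Small.leftHits_eq (hb : Small b) {y : ℝ} (hy : st b y ∈ Icc (-1 : ℝ) 1) :
    {v | v ∈ tangentHits b (st b y) ∧ v < st b y} =
      st b '' {x | st b x ∈ Icc (-1 : ℝ) 1 ∧ x < y ∧ hF x y = thr b} := by
  ext v
  constructor
  · rintro ⟨⟨h1, h2⟩, h3⟩
    rw [← hb.st_co v] at h1 h2 h3
    have hlt := hb.strictMono_st.lt_iff_lt.1 h3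
    exact ⟨co b v, ⟨h1, hlt, (hb.eq_tangent_iff h1 hy hlt.ne).1 h2⟩, hb.st_co v⟩
  · rintro ⟨x, ⟨hx, hlt, h⟩, rfl⟩
    exact ⟨⟨hx, (hb.eq_tangent_iff hx hy hlt.ne).2 h⟩, hb.strictMono_st hlt⟩

/-- The intersections are finitely many, so the infimum is attained when it is not `⊤`. The
comparison with `v_m⁺` thus becomes the existence of a root. -/
lemma Small.vMRight_le (hb : Small b) {y c : ℝ} (hy : st b y ∈ Icc (-1 : ℝ) 1)
    (hc : st b c ∈ Icc (-1 : ℝ) 1) :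
    vMRight b (st b y) ≤ (st b c : EReal) ↔ ∃ x, y < x ∧ x ≤ c ∧ hF x y = thr b := by
  rw [vMRight, hb.rightHits_eq hy]
  set T := {x | st b x ∈ Icc (-1 : ℝ) 1 ∧ y < x ∧ hF x y = thr b} with hT
  constructor
  · intro h
    have hfin : ((fun v : ℝ => (v : EReal)) '' (st b '' T)).Finite :=
      (((finite_hF_eq (thr b) y).subset fun x hx => hx.2.2).image _).image _
    rcases T.eq_empty_or_nonempty with he | hne
    · rw [he, image_empty, image_empty, sInf_empty, top_le_iff] at h
      exact absurd h (EReal.coe_ne_top _)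
    · obtain ⟨_, ⟨x, hx, rfl⟩, hx'⟩ := ((hne.image (st b)).image _).csInf_mem hfin
      rw [← hx', EReal.coe_le_coe_iff, hb.strictMono_st.le_iff_le] at h
      exact ⟨x, hx.2.1, h, hx.2.2⟩
  · rintro ⟨x, h1, h2, h3⟩
    have hx : x ∈ T := ⟨⟨hy.1.trans (hb.strictMono_st h1).le,
      (hb.strictMono_st.monotone h2).trans hc.2⟩, h1, h3⟩
    exact (sInf_le (mem_image_of_mem _ (mem_image_of_mem _ hx))).trans
      (EReal.coe_le_coe_iff.2 (hb.strictMono_st.monotone h2))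

lemma Small.le_vMLeft (hb : Small b) {y a : ℝ} (hy : st b y ∈ Icc (-1 : ℝ) 1)
    (ha : st b a ∈ Icc (-1 : ℝ) 1) :
    (st b a : EReal) ≤ vMLeft b (st b y) ↔ ∃ x, a ≤ x ∧ x < y ∧ hF x y = thr b := by
  rw [vMLeft, hb.leftHits_eq hy]
  set T := {x | st b x ∈ Icc (-1 : ℝ) 1 ∧ x < y ∧ hF x y = thr b} with hT
  constructor
  · intro h
    have hfin : ((fun v : ℝ => (v : EReal)) '' (st b '' T)).Finite :=
      (((finite_hF_eq (thr b) y).subset fun x hx => hx.2.2).image _).image _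
    rcases T.eq_empty_or_nonempty with he | hne
    · rw [he, image_empty, image_empty, sSup_empty, le_bot_iff] at h
      exact absurd h (EReal.coe_ne_bot _)
    · obtain ⟨_, ⟨x, hx, rfl⟩, hx'⟩ := ((hne.image (st b)).image _).csSup_mem hfin
      rw [← hx', EReal.coe_le_coe_iff, hb.strictMono_st.le_iff_le] at h
      exact ⟨x, h, hx.2.1, hx.2.2⟩
  · rintro ⟨x, h1, h2, h3⟩
    have hx : x ∈ T := ⟨⟨ha.1.trans (hb.strictMono_st.monotone h1),
      (hb.strictMono_st h2).le.trans hy.2⟩, h2, h3⟩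
    exact (EReal.coe_le_coe_iff.2 (hb.strictMono_st.monotone h1)).trans
      (le_sSup (mem_image_of_mem _ (mem_image_of_mem _ hx)))

lemma Small.vERight_eq (hb : Small b) {x e : ℝ} (hx : st b x ∈ Icc (-1 : ℝ) 1) (hne : e ≠ x)
    (he : hF x e = thr b) (h : ∀ y > e, thr b < hF x y) : vERight b (st b x) = (st b e : EReal) := by
  rw [vERight, hb.tangencyPoints_eq hx]
  refine IsGreatest.csSup_eq ⟨mem_image_of_mem _ (mem_image_of_mem _ ⟨hne, he⟩), ?_⟩
  rintro _ ⟨_, ⟨y, hy, rfl⟩, rfl⟩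
  refine EReal.coe_le_coe_iff.2 (hb.strictMono_st.monotone ?_)
  by_contra! hlt
  exact (h y hlt).ne' hy.2

lemma Small.vELeft_eq (hb : Small b) {x e : ℝ} (hx : st b x ∈ Icc (-1 : ℝ) 1) (hne : e ≠ x)
    (he : hF x e = thr b) (h : ∀ y < e, thr b < hF x y) : vELeft b (st b x) = (st b e : EReal) := by
  rw [vELeft, hb.tangencyPoints_eq hx]
  refine IsLeast.csInf_eq ⟨mem_image_of_mem _ (mem_image_of_mem _ ⟨hne, he⟩), ?_⟩
  rintro _ ⟨_, ⟨y, hy, rfl⟩, rfl⟩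
  refine EReal.coe_le_coe_iff.2 (hb.strictMono_st.monotone ?_)
  by_contra! hlt
  exact (h y hlt).ne' hy.2

/-- A strictly closest tangency point is the only minimizer, so the choice in the definition of `vE`
must return it. -/
lemma vE_eq_of_forall {v e : ℝ} (he : e ∈ tangencyPoints b v)
    (h : ∀ e' ∈ tangencyPoints b v, e' ≠ e → |e - v| < |e' - v|) : vE b v = (e : EReal) := by
  have hex : ∃ e ∈ tangencyPoints b v, ∀ e' ∈ tangencyPoints b v, |e - v| ≤ |e' - v| :=
    ⟨e, he, fun e' he' => by
      rcases eq_or_ne e' e with rfl | hne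
      · rfl
      · exact (h e' he' hne).le⟩
  rw [vE, dif_pos hex]
  by_contra hne
  have := h _ hex.choose_spec.1 fun h => hne (by rw [h])
  exact this.not_ge (hex.choose_spec.2 e he)

lemma vEFar_eq_of_forall {v e : ℝ} (he : e ∈ tangencyPoints b v)
    (h : ∀ e' ∈ tangencyPoints b v, e' ≠ e → |e' - v| < |e - v|) : vEFar b v = (e : EReal) := by
  have hex : ∃ e ∈ tangencyPoints b v, ∀ e' ∈ tangencyPoints b v, |e' - v| ≤ |e - v| :=
    ⟨e, he, fun e' he' => by
      rcases eq_or_ne e' e with rfl | hne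
      · rfl
      · exact (h e' he' hne).le⟩
  rw [vEFar, dif_pos hex]
  by_contra hne
  have := h _ hex.choose_spec.1 fun h => hne (by rw [h])
  exact this.not_ge (hex.choose_spec.2 e he)

lemma Small.vE_eq_right (hb : Small b) {x e : ℝ} (hx : st b x ∈ Icc (-1 : ℝ) 1) (hxe : x < e)
    (he : hF x e = thr b) (h : ∀ y < e, thr b < hF x y) : vE b (st b x) = (st b e : EReal) := by
  rw [vE_eq_of_forall]
  · rw [hb.tangencyPoints_eq hx]; exact mem_image_of_mem _ ⟨hxe.ne', he⟩
  · rw [hb.tangencyPoints_eq hx]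
    rintro _ ⟨y, hy, rfl⟩ hne
    have h1 : e < y := lt_of_le_of_ne (not_lt.1 fun hlt => (h y hlt).ne' hy.2)
      fun h => hne (by rw [h])
    have h2 := hb.strictMono_st h1
    have h3 := hb.strictMono_st hxe
    rw [abs_of_pos (by linarith), abs_of_pos (by linarith)]
    linarith

lemma Small.vE_eq_left (hb : Small b) {x e : ℝ} (hx : st b x ∈ Icc (-1 : ℝ) 1) (hxe : e < x)
    (he : hF x e = thr b) (h : ∀ y > e, thr b < hF x y) : vE b (st b x) = (st b e : EReal) := by
  rw [vE_eq_of_forall]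
  · rw [hb.tangencyPoints_eq hx]; exact mem_image_of_mem _ ⟨hxe.ne, he⟩
  · rw [hb.tangencyPoints_eq hx]
    rintro _ ⟨y, hy, rfl⟩ hne
    have h1 : y < e := lt_of_le_of_ne (not_lt.1 fun hlt => (h y hlt).ne' hy.2)
      fun h => hne (by rw [h])
    have h2 := hb.strictMono_st h1
    have h3 := hb.strictMono_st hxe
    rw [abs_of_neg (by linarith), abs_of_neg (by linarith)]
    linarith

/-- Hypothesis `h'` excludes tangency points to the left of `x`. All of them lie on one side, where
distance is ordered like position and the farthest is the rightmost. -/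
lemma Small.vEFar_eq_right (hb : Small b) {x e : ℝ} (hx : st b x ∈ Icc (-1 : ℝ) 1) (hxe : x < e)
    (he : hF x e = thr b) (h : ∀ y > e, thr b < hF x y) (h' : ∀ y < x, thr b < hF x y) :
    vEFar b (st b x) = (st b e : EReal) := by
  rw [vEFar_eq_of_forall]
  · rw [hb.tangencyPoints_eq hx]; exact mem_image_of_mem _ ⟨hxe.ne', he⟩
  · rw [hb.tangencyPoints_eq hx]
    rintro _ ⟨y, hy, rfl⟩ hne
    have h1 : y < e := lt_of_le_of_ne (not_lt.1 fun hlt => (h y hlt).ne' hy.2)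
      fun h => hne (by rw [h])
    have h2 : x < y := lt_of_le_of_ne (not_lt.1 fun hlt => (h' y hlt).ne' hy.2) hy.1.symm
    have h3 := hb.strictMono_st h1
    have h4 := hb.strictMono_st h2
    have h5 := hb.strictMono_st hxe
    rw [abs_of_pos (by linarith), abs_of_pos (by linarith)]
    linarith

lemma Small.vEFar_eq_left (hb : Small b) {x e : ℝ} (hx : st b x ∈ Icc (-1 : ℝ) 1) (hxe : e < x)
    (he : hF x e = thr b) (h : ∀ y < e, thr b < hF x y) (h' : ∀ y > x, thr b < hF x y) :
    vEFar b (st b x) = (st b e : EReal) := by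
  rw [vEFar_eq_of_forall]
  · rw [hb.tangencyPoints_eq hx]; exact mem_image_of_mem _ ⟨hxe.ne, he⟩
  · rw [hb.tangencyPoints_eq hx]
    rintro _ ⟨y, hy, rfl⟩ hne
    have h1 : e < y := lt_of_le_of_ne (not_lt.1 fun hlt => (h y hlt).ne' hy.2)
      fun h => hne (by rw [h])
    have h2 : y < x := lt_of_le_of_ne (not_lt.1 fun hlt => (h' y hlt).ne' hy.2) hy.1
    have h3 := hb.strictMono_st h1
    have h4 := hb.strictMono_st h2
    have h5 := hb.strictMono_st hxe
    rw [abs_of_neg (by linarith), abs_of_neg (by linarith)]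
    linarith

/-- Two cases at once: a chosen tangency point cannot lie left of `i`, and if there is none, the
convention for negative states gives `⊤`. -/
lemma Small.le_vE (hb : Small b) {x i : ℝ} (hx : st b x ∈ Icc (-1 : ℝ) 1) (hx0 : x < 0)
    (h : ∀ y < i, thr b < hF x y) : (st b i : EReal) ≤ vE b (st b x) := by
  rw [vE]
  split_ifs with hex h0
  · have hmem : ∀ e ∈ tangencyPoints b (st b x), e ∈ st b '' {y | y ≠ x ∧ hF x y = thr b} :=
      fun e he => hb.tangencyPoints_eq hx ▸ he
    have := hmem _ hex.choose_spec.1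
    obtain ⟨y, hy, hy'⟩ := this
    rw [← hy', EReal.coe_le_coe_iff]
    exact hb.strictMono_st.monotone (not_lt.1 fun hlt => (h y hlt).ne' hy.2)
  · exact le_top
  · exact absurd (by simpa [st] using hb.strictMono_st hx0) h0

lemma Small.vE_le (hb : Small b) {x i : ℝ} (hx : st b x ∈ Icc (-1 : ℝ) 1) (hx0 : 0 < x)
    (h : ∀ y > i, thr b < hF x y) : vE b (st b x) ≤ (st b i : EReal) := by
  rw [vE]
  split_ifs with hex h0
  · have hmem : ∀ e ∈ tangencyPoints b (st b x), e ∈ st b '' {y | y ≠ x ∧ hF x y = thr b} :=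
      fun e he => hb.tangencyPoints_eq hx ▸ he
    have := hmem _ hex.choose_spec.1
    obtain ⟨y, hy, hy'⟩ := this
    rw [← hy', EReal.coe_le_coe_iff]
    exact hb.strictMono_st.monotone (not_lt.1 fun hlt => (h y hlt).ne' hy.2)
  · have : 0 < st b x := by simpa [st] using hb.strictMono_st hx0
    exact absurd h0 this.not_gt
  · exact bot_le

end

end RiemannPhase

namespace RiemannPhase

open Real (cosh sinh one_le_cosh cosh_pos cosh_le_cosh cosh_lt_cosh)

section

variable {b a c i m : ℝ}

/-! ### Wave patterns in the hyperbolic coordinate -/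

lemma Small.shockSpeed_left (hb : Small b) {x e : ℝ} (hx : st b x ∈ Icc (-1 : ℝ) 1) (hne : x ≠ e)
    (h : hF x e = thr b) : shockSpeed (flux b) (st b x) (st b e) = deriv (flux b) (st b e) := by
  have h1 := (hb.eq_tangent_iff hx (hb.mem_of_hF_le h.le) hne).2 h
  have h2 := sub_ne_zero.2 (hb.strictMono_st.injective.ne hne.symm)
  rw [shockSpeed, div_eq_iff h2]
  linarith

lemma Small.shockSpeed_right (hb : Small b) {x e : ℝ} (hx : st b x ∈ Icc (-1 : ℝ) 1) (hne : x ≠ e)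
    (h : hF x e = thr b) : deriv (flux b) (st b e) = shockSpeed (flux b) (st b e) (st b x) := by
  have h1 := (hb.eq_tangent_iff hx (hb.mem_of_hF_le h.le) hne).2 h
  have h2 := sub_ne_zero.2 (hb.strictMono_st.injective.ne hne)
  rw [shockSpeed, eq_div_iff h2]
  linarith

lemma Small.continuousOn (hb : Small b) (ha : st b a ∈ Icc (-1 : ℝ) 1)
    (hc : st b c ∈ Icc (-1 : ℝ) 1) : ContinuousOn (flux b) (Icc (st b a) (st b c)) :=
  (lipOn_flux hb.admissible).continuousOn.mono (Icc_subset_Icc ha.1 hc.2)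

lemma Small.continuousOn_deriv (hb : Small b) (ha : st b a ∈ Icc (-1 : ℝ) 1)
    (hc : st b c ∈ Icc (-1 : ℝ) 1) : ContinuousOn (deriv (flux b)) (Icc (st b a) (st b c)) :=
  (continuousOn_deriv_flux hb.admissible).mono (Icc_subset_Icc ha.1 hc.2)

lemma Small.exists_co (hb : Small b) {x y v : ℝ} (hv : v ∈ Icc (st b x) (st b y)) :
    ∃ w ∈ Icc x y, st b w = v := by
  refine ⟨co b v, ?_, hb.st_co v⟩
  rw [← hb.st_co v] at hv
  exact ⟨hb.strictMono_st.le_iff_le.1 hv.1, hb.strictMono_st.le_iff_le.1 hv.2⟩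

/-- Quasiconvexity in the first argument reduces the tangent condition on the whole interval to the
two end states. -/
lemma Small.fanCondMin (hb : Small b) (ha : st b a ∈ Icc (-1 : ℝ) 1)
    (hc : st b c ∈ Icc (-1 : ℝ) 1) {n p : ℝ}
    (h : ∀ y ∈ Ioo n p, hF a y < thr b ∧ hF c y < thr b) :
    FanCondMin (flux b) (st b a) (st b c) (st b n) (st b p) := by
  intro e he v hv hne
  obtain ⟨y, hy, rfl⟩ := hb.exists_co ⟨he.1.le, he.2.le⟩
  obtain ⟨x, hx, rfl⟩ := hb.exists_co hv
  have h1 := h y ⟨hb.strictMono_st.lt_iff_lt.1 he.1, hb.strictMono_st.lt_iff_lt.1 he.2⟩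
  exact hb.tangent_lt ⟨ha.1.trans hv.1, hv.2.trans hc.2⟩ (hb.mem_of_hF_le h1.1.le)
    (fun h => hne (by rw [h])) (hF_lt_of_mem_Icc hx h1.1 h1.2)

lemma Small.fanCond (hb : Small b) (ha : st b a ∈ Icc (-1 : ℝ) 1)
    (hc : st b c ∈ Icc (-1 : ℝ) 1) {n p : ℝ} (han : a ≤ n) (hpc : p ≤ c)
    (h : ∀ y ∈ Ioo n p, ∀ x ∈ Icc a c, thr b < hF x y) :
    FanCond (flux b) (st b a) (st b c) (st b n) (st b p) := by
  intro e he v hv hne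
  obtain ⟨y, hy, rfl⟩ := hb.exists_co ⟨he.1.le, he.2.le⟩
  obtain ⟨x, hx, rfl⟩ := hb.exists_co hv
  exact hb.lt_tangent ⟨ha.1.trans hv.1, hv.2.trans hc.2⟩
    ⟨ha.1.trans (hb.strictMono_st.monotone (han.trans hy.1)),
      (hb.strictMono_st.monotone (hy.2.trans hpc)).trans hc.2⟩ (fun h => hne (by rw [h]))
    (h y ⟨hb.strictMono_st.lt_iff_lt.1 he.1, hb.strictMono_st.lt_iff_lt.1 he.2⟩ x hx)

lemma Small.asc_isS (hb : Small b) {V : ℝ → ℝ} (hac : a < c)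
    (hU : MaxSel (fun w => -flux b (-w)) V (-st b c) (-st b a))
    (h : ∀ w ∈ Icc a c, thr b ≤ hPhi a w c) : IsS (flux b) (fun ξ => -V ξ) (st b a) (st b c) := by
  refine hU.reflect_isS (hb.strictMono_st hac) fun w hw => ?_
  obtain ⟨x, hx, rfl⟩ := hb.exists_co hw
  exact hb.chord_le hx.1 hx.2 (h x hx)

/-! ### The regions in the hyperbolic coordinate -/

lemma Small.asc_regions (hb : Small b) (hi : st b i = vInfl b) (hm : st b m = vMax b)
    (H : HypParams (thr b) i m) (hac : a < c) (ha : st b a ∈ Icc (-1 : ℝ) 1)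
    (hc : st b c ∈ Icc (-1 : ℝ) 1) :
    (InRegion b (st b a) (st b c) .S ↔
      (a < -i ∧ ((st b i : EReal) ≤ vE b (st b a) ∨
        vMRight b (vE b (st b a)).toReal ≤ (st b c : EReal))) ∨
      (i < c ∧ (vE b (st b c) ≤ (st b (-i) : EReal) ∨
        (st b a : EReal) ≤ vMLeft b (vE b (st b c)).toReal)) ∨
      (a < -i ∧ (st b c : EReal) ≤ vE b (st b a)) ∨
      (i < c ∧ vE b (st b c) ≤ (st b a : EReal))) ∧
    (InRegion b (st b a) (st b c) .R ↔ -i ≤ a ∧ c ≤ i) ∧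
    (InRegion b (st b a) (st b c) .RS ↔ i < c ∧ -i ≤ a ∧ (st b a : EReal) < vE b (st b c)) ∧
    (InRegion b (st b a) (st b c) .SR ↔ a < -i ∧ vE b (st b a) < (st b c : EReal) ∧ c ≤ i) ∧
    (InRegion b (st b a) (st b c) .RSR ↔ False) ∧
    (InRegion b (st b a) (st b c) .SRS ↔ a < -i ∧ i < c ∧ vE b (st b a) < (st b i : EReal) ∧
      (st b c : EReal) < vMRight b (vE b (st b a)).toReal) := by
  have hlt : ∀ x y, st b x < st b y ↔ x < y := fun x y => hb.strictMono_st.lt_iff_lt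
  have hle : ∀ x y, st b x ≤ st b y ↔ x ≤ y := fun x y => hb.strictMono_st.le_iff_le
  have hm0 := H.m_pos
  simp only [InRegion, ← hi, ← hm, ← st_neg, hlt, hle, mem_Icc, mem_Ioc, mem_Ico, ha.1, hc.2,
    hac, hac.not_gt, true_and, false_and, or_false, and_true]
  refine ⟨?_, ?_⟩
  · constructor
    · rintro ⟨⟨h1, h2⟩, h3, h4⟩; exact ⟨h1, h4⟩
    · rintro ⟨h1, h2⟩; exact ⟨⟨h1, by linarith⟩, by linarith, h2⟩
  · constructor
    · rintro ⟨h1, h2⟩; linarith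
    · exact False.elim

lemma Small.desc_regions (hb : Small b) (hi : st b i = vInfl b) (hm : st b m = vMax b)
    (hac : a < c) (ha : st b a ∈ Icc (-1 : ℝ) 1)
    (hc : st b c ∈ Icc (-1 : ℝ) 1) :
    (InRegion b (st b c) (st b a) .S ↔
      (-i ≤ a ∧ c ≤ i) ∨
      ((i ≤ c ∧ c ≤ m) ∧ vEFar b (st b c) ≤ (st b a : EReal) ∧
        (st b a : EReal) ≤ vMLeft b (st b c)) ∨
      ((-m ≤ a ∧ a ≤ -i) ∧ vMRight b (st b a) ≤ (st b c : EReal) ∧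
        (st b c : EReal) ≤ vEFar b (st b a))) ∧
    (InRegion b (st b c) (st b a) .R ↔ c ≤ -i ∨ i ≤ a) ∧
    (InRegion b (st b c) (st b a) .RS ↔ (-m ≤ a ∧ a < i) ∧ vERight b (st b a) < (st b c : EReal)) ∧
    (InRegion b (st b c) (st b a) .SR ↔ (-i < c ∧ c ≤ m) ∧ (st b a : EReal) < vELeft b (st b c)) ∧
    (InRegion b (st b c) (st b a) .RSR ↔ m < c ∧ a < -m) ∧
    (InRegion b (st b c) (st b a) .SRS ↔ False) := by
  have hlt : ∀ x y, st b x < st b y ↔ x < y := fun x y => hb.strictMono_st.lt_iff_lt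
  have hle : ∀ x y, st b x ≤ st b y ↔ x ≤ y := fun x y => hb.strictMono_st.le_iff_le
  have hi0 : 0 < i := by
    have h0 : st b 0 = 0 := by simp [st]
    rw [← hlt, h0, hi]
    exact hb.vInfl_pos
  simp only [InRegion, ← hi, ← hm, ← st_neg, hlt, hle, mem_Icc, mem_Ioc, mem_Ico, ha.1, hc.2,
    hac, hac.not_gt, true_and, false_and, false_or, and_true]
  refine ⟨or_congr_left ?_, ?_, ?_⟩
  · constructor
    · rintro ⟨⟨h1, h2⟩, h3, h4⟩; exact ⟨h3, h2⟩
    · rintro ⟨h1, h2⟩; exact ⟨⟨by linarith, h2⟩, h1, by linarith⟩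
  · have h1 := ha.1
    have h2 := hc.2
    have h3 := hb.strictMono_st hac
    refine or_congr ⟨fun h => h.1.2, fun h => ⟨⟨?_, h⟩, ?_⟩⟩
      ⟨fun h => h.2.1, fun h => ⟨?_, h, ?_⟩⟩
    all_goals linarith
  · constructor
    · rintro ⟨h1, h2, -⟩; linarith
    · exact False.elim

end

end RiemannPhase

/-! ### The phase diagram for increasing data -/

namespace RiemannPhase

open Real (cosh sinh one_le_cosh cosh_pos cosh_le_cosh cosh_lt_cosh)

section

variable {b a c i m : ℝ}

/-- Lying in exactly one region means membership in one and exclusion from the five others. -/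
lemma forall_pattern {P : Pattern → Prop} (w₀ : Pattern) (h : P w₀)
    (h' : ∀ w, w ≠ w₀ → ¬P w) : ∀ w, P w ↔ w = w₀ := fun w =>
  ⟨fun hw => by_contra fun hne => h' w hne hw, fun hw => hw ▸ h⟩

/-- The dichotomy for the tangency points from a left state beyond the inflection point. -/
lemma Small.near_left (hb : Small b) (H : HypParams (thr b) i m) (ha : st b a ∈ Icc (-1 : ℝ) 1)
    (hai : a < -i) :
    ((st b i : EReal) ≤ vE b (st b a) ∧ ∀ y, thr b ≤ hF a y) ∨
    ∃ e ∈ Ioo (-i) i, vE b (st b a) = (st b e : EReal) ∧ hF a e = thr b ∧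
      (∀ y < e, thr b < hF a y) ∧ ∀ y ∈ Ioc e i, hF a y < thr b := by
  have h0 := H.i_pos
  rcases le_or_gt a (-(3 * i)) with h | h
  · exact Or.inl ⟨hb.le_vE ha (by linarith) fun y hy => H.lt_hF_far h hy.ne, H.le_hF_far h⟩
  · obtain ⟨e, he, h1, h2, h3⟩ := H.exists_near hai h
    exact Or.inr ⟨e, he, hb.vE_eq_right ha (hai.trans he.1) h1 h2, h1, h2, h3⟩

lemma Small.near_right (hb : Small b) (H : HypParams (thr b) i m) (hc : st b c ∈ Icc (-1 : ℝ) 1)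
    (hci : i < c) :
    (vE b (st b c) ≤ (st b (-i) : EReal) ∧ ∀ y, thr b ≤ hF c y) ∨
    ∃ e ∈ Ioo (-i) i, vE b (st b c) = (st b e : EReal) ∧ hF c e = thr b ∧
      (∀ y > e, thr b < hF c y) ∧ ∀ y ∈ Ico (-i) e, hF c y < thr b := by
  have h0 := H.i_pos
  rcases le_or_gt (3 * i) c with h | h
  · exact Or.inl ⟨hb.vE_le hc (by linarith) fun y hy => H.lt_hF_far' h (ne_of_gt hy),
      H.le_hF_far' h⟩
  · obtain ⟨e, he, h1, h2, h3⟩ := H.exists_near' hci h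
    exact Or.inr ⟨e, he, hb.vE_eq_left hc (he.2.trans hci) h1 h2, h1, h2, h3⟩

lemma hF_mid_right (a c : ℝ) : hF c (-(a + c) / 2) = hF a (-(a + c) / 2) := by
  rw [hF, hF, ← Real.cosh_neg (c + _)]
  congr 3
  ring

/-- The tangent line at `e` through the state `a` meets the graph again at `-2e - a`; this locates
`v_m⁺(v_e)` explicitly. -/
lemma hF_reflect (a e : ℝ) : hF (-2 * e - a) e = hF a e := by
  rw [hF, hF, ← Real.cosh_neg (a + e)]
  congr 3
  ring

/-- The phase diagram for `uL < uR`. -/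
lemma Small.ascending (hb : Small b) (hi : st b i = vInfl b) (hm : st b m = vMax b)
    (H : HypParams (thr b) i m) (hac : a < c) (ha : st b a ∈ Icc (-1 : ℝ) 1)
    (hc : st b c ∈ Icc (-1 : ℝ) 1) {V : ℝ → ℝ}
    (hU : MaxSel (fun w => -flux b (-w)) V (-st b c) (-st b a)) :
    ∃ w₀, (∀ w, InRegion b (st b a) (st b c) w ↔ w = w₀) ∧
      HasPattern (flux b) (fun ξ => -V ξ) (st b a) (st b c) w₀ := by
  obtain ⟨hS, hR, hRS, hSR, hRSR, hSRS⟩ := hb.asc_regions hi hm H hac ha hc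
  have h0 := H.i_pos
  have hlt : ∀ x y, st b x < st b y ↔ x < y := fun x y => hb.strictMono_st.lt_iff_lt
  have hle : ∀ x y, st b x ≤ st b y ↔ x ≤ y := fun x y => hb.strictMono_st.le_iff_le
  have hGc := hb.continuousOn ha hc
  have hdc := hb.continuousOn_deriv ha hc
  rcases lt_or_ge a (-i) with hai | hai <;> rcases lt_or_ge i c with hci | hci
  · -- both states lie beyond the inflection points
    -- The point `-(a + c) / 2` minimizes the chord function. If its value is at least `K`, the
    -- chord lies below the graph and a single shock results; otherwise the chord crosses the graph
    -- and a fan opens around this point.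
    rcases le_or_gt (thr b) (hF a (-(a + c) / 2)) with hG | hG
    · have key : ∀ e ∈ Ioo (-i) i, hF a e = thr b → (∀ y ∈ Ioc e i, hF a y < thr b) →
          ∃ x, e < x ∧ x ≤ c ∧ hF x e = thr b := by
        intro e he h2 h4
        have hy : -(a + c) / 2 ≤ e := by
          by_contra! hlt'
          -- Together with `c > i` this puts `-(a + c) / 2` to the left of `i`, inside the range
          -- where `hF a` is known to be below `K`.
          have ha3 : -(3 * i) < a := by
            by_contra! h5
            exact (h4 i ⟨he.2, le_rfl⟩).not_ge (H.le_hF_far h5 i)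
          exact (h4 _ ⟨hlt', by linarith⟩).not_ge hG
        have hx : hF (-2 * e - a) e = thr b := by rw [hF_reflect, h2]
        -- The second intersection of the tangent line at `e`. It is at most `c` exactly because
        -- `-(a + c) / 2 ≤ e`, and it cannot be at most `e`: it would lie in the convex region,
        -- where `hF · e < K`.
        refine ⟨-2 * e - a, ?_, by linarith, hx⟩
        by_contra! hle'
        have h5 := H.hF_lt (x := -2 * e - a) ⟨by linarith [he.1, he.2], by linarith [he.2]⟩ he
        exact h5.ne hx
      refine ⟨.S, forall_pattern _ ?_ ?_, hb.asc_isS hac hU fun w _ =>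
        hG.trans (hF_le_hPhi_mid a w c)⟩
      · refine hS.2 (Or.inl ⟨hai, ?_⟩)
        rcases hb.near_left H ha hai with ⟨h1, -⟩ | ⟨e, he, h1, h2, h3, h4⟩
        · exact Or.inl h1
        · right
          have hea := hb.mem_of_hF_le h2.le
          rw [h1, EReal.toReal_coe, hb.vMRight_le hea hc]
          exact key e he h2 h4
      · rintro (_ | _ | _ | _ | _ | _) hne hw
        · exact hne rfl
        · linarith [(hR.1 hw).1]
        · linarith [(hRS.1 hw).2.1]
        · linarith [(hSR.1 hw).2.2]
        · exact hRSR.1 hw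
        · obtain ⟨-, -, h5, h6⟩ := hSRS.1 hw
          rcases hb.near_left H ha hai with ⟨h1, -⟩ | ⟨e, he, h1, h2, h3, h4⟩
          · exact h5.not_ge h1
          · have hea := hb.mem_of_hF_le h2.le
            rw [h1, EReal.toReal_coe, ← not_le, hb.vMRight_le hea hc] at h6
            exact h6 (key e he h2 h4)
    · obtain ⟨e, he, h1, h2, h3, h4⟩ := (hb.near_left H ha hai).resolve_left
        fun h => hG.not_ge (h.2 _)
      have hG' := hG
      rw [← hF_mid_right] at hG'
      obtain ⟨f, hf, k1, k2, k3, k4⟩ := (hb.near_right H hc hci).resolve_left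
        fun h => hG'.not_ge (h.2 _)
      -- The tangency points from the two states lie on either side of the minimizing point, which
      -- gives the order `a < e < f < c` of the two shocks and the fan.
      have hey : e < -(a + c) / 2 := by
        by_contra! hle'
        rcases hle'.eq_or_lt with h5 | h5
        · rw [h5] at hG; exact hG.ne h2
        · exact (h3 _ h5).not_gt hG
      have hyf : -(a + c) / 2 < f := by
        by_contra! hle'
        rcases hle'.eq_or_lt with h5 | h5
        · rw [← h5] at hG'; exact hG'.ne k2
        · exact (k3 _ h5).not_gt hG'
      have hea := hb.mem_of_hF_le h2.le
      have hfa := hb.mem_of_hF_le k2.le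
      have hright : ¬vMRight b (st b e) ≤ (st b c : EReal) := by
        rw [hb.vMRight_le hea hc]
        rintro ⟨x, hx1, hx2, hx3⟩
        -- An intersection would be `a`, which is left of `e`, or `-2e - a`, which exceeds `c`.
        rcases hF_eq_hF (hx3.trans h2.symm) with h5 | h5
        · linarith [he.1]
        · linarith
      have hleft : ¬(st b a : EReal) ≤ vMLeft b (st b f) := by
        rw [hb.le_vMLeft hfa ha]
        rintro ⟨x, hx1, hx2, hx3⟩
        rcases hF_eq_hF (hx3.trans k2.symm) with h5 | h5
        · linarith [hf.2]
        · linarith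
      refine ⟨.SRS, forall_pattern _ (hSRS.2 ⟨hai, hci, ?_, ?_⟩) ?_, st b e, st b f,
        hU.reflect_isSRS ((hlt _ _).2 (hai.trans he.1)) ((hlt _ _).2 (hey.trans hyf))
          ((hlt _ _).2 (hf.2.trans hci)) hGc hdc
          (hb.fanCondMin ha hc fun y hy => ⟨h4 y ⟨hy.1, (hy.2.trans hf.2).le⟩,
            k4 y ⟨(he.1.trans hy.1).le, hy.2⟩⟩)
          (hb.shockSpeed_left ha (hai.trans he.1).ne h2)
          (hb.shockSpeed_right hc (hf.2.trans hci).ne' k2)⟩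
      · rw [h1, EReal.coe_lt_coe_iff, hlt]; exact he.2
      · rw [h1, EReal.toReal_coe]; exact not_le.1 hright
      · rintro (_ | _ | _ | _ | _ | _) hne hw
        · rw [hS, h1, k1] at hw
          simp only [EReal.toReal_coe, EReal.coe_le_coe_iff, hle, hright, hleft, or_false] at hw
          rcases hw with ⟨-, h⟩ | ⟨-, h⟩ | ⟨-, h⟩ | ⟨-, h⟩
          · exact h.not_gt he.2
          · exact h.not_gt hf.1
          · linarith [he.2]
          · linarith [hf.1]
        · linarith [(hR.1 hw).1]
        · linarith [(hRS.1 hw).2.1]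
        · linarith [(hSR.1 hw).2.2]
        · exact hRSR.1 hw
        · exact hne rfl
  · -- the right state lies in the convex region
    rcases hb.near_left H ha hai with ⟨h1, h2⟩ | ⟨e, he, h1, h2, h3, h4⟩
    · refine ⟨.S, forall_pattern _ (hS.2 (Or.inl ⟨hai, Or.inl h1⟩)) ?_, hb.asc_isS hac hU fun w _ =>
        (h2 _).trans (hF_le_hPhi_left a w c)⟩
      rintro (_ | _ | _ | _ | _ | _) hne hw
      · exact hne rfl
      · linarith [(hR.1 hw).1]
      · linarith [(hRS.1 hw).1]
      · have h5 := h1.trans_lt (hSR.1 hw).2.1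
        rw [EReal.coe_lt_coe_iff, hlt] at h5
        linarith
      · exact hRSR.1 hw
      · linarith [(hSRS.1 hw).2.1]
    · rcases le_or_gt c e with hce | hce
      · refine ⟨.S, forall_pattern _ (hS.2 (Or.inr (Or.inr (Or.inl ⟨hai, ?_⟩)))) ?_,
          hb.asc_isS hac hU fun w hw => le_trans ?_ (hF_le_hPhi_left a w c)⟩
        · rw [h1, EReal.coe_le_coe_iff, hle]; exact hce
        · rintro (_ | _ | _ | _ | _ | _) hne hw
          · exact hne rfl
          · linarith [(hR.1 hw).1]
          · linarith [(hRS.1 hw).1]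
          · have h5 := (hSR.1 hw).2.1
            rw [h1, EReal.coe_lt_coe_iff, hlt] at h5
            linarith
          · exact hRSR.1 hw
          · linarith [(hSRS.1 hw).2.1]
        -- For `w ≤ c ≤ e` the auxiliary tangency argument `(w + c) / 2` stays at or below the root,
        -- where `hF a` is at least `K`.
        · have h5 : (w + c) / 2 ≤ e := by linarith [hw.2]
          rcases h5.eq_or_lt with h5 | h5
          · rw [h5, h2]
          · exact (h3 _ h5).le
      · refine ⟨.SR, forall_pattern _ (hSR.2 ⟨hai, ?_, hci⟩) ?_, st b e,
          hU.reflect_isSR ((hlt _ _).2 (hai.trans he.1)) ((hlt _ _).2 hce) hGc hdc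
          (hb.fanCondMin ha hc fun y hy => ⟨h4 y ⟨hy.1, hy.2.le.trans hci⟩,
            H.hF_lt ⟨(he.1.trans hce).le, hci⟩ ⟨he.1.trans hy.1, hy.2.trans_le hci⟩⟩)
          (hb.shockSpeed_left ha (hai.trans he.1).ne h2)⟩
        · rw [h1, EReal.coe_lt_coe_iff, hlt]; exact hce
        · rintro (_ | _ | _ | _ | _ | _) hne hw
          · rw [hS, h1] at hw
            simp only [EReal.toReal_coe, EReal.coe_le_coe_iff, hle, hci.not_gt, hce.not_ge,
              he.2.not_ge, false_and, and_false, false_or, or_false] at hw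
            rw [hb.vMRight_le (hb.mem_of_hF_le h2.le) hc] at hw
            obtain ⟨-, x, hx1, hx2, hx3⟩ := hw
            exact (H.hF_lt ⟨(he.1.trans hx1).le, hx2.trans hci⟩ he).ne hx3
          · linarith [(hR.1 hw).1]
          · linarith [(hRS.1 hw).1]
          · exact hne rfl
          · exact hRSR.1 hw
          · linarith [(hSRS.1 hw).2.1]
  · -- the left state lies in the convex region
    rcases hb.near_right H hc hci with ⟨h1, h2⟩ | ⟨e, he, h1, h2, h3, h4⟩
    · refine ⟨.S, forall_pattern _ (hS.2 (Or.inr (Or.inl ⟨hci, Or.inl h1⟩))) ?_,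
        hb.asc_isS hac hU fun w _ => (h2 _).trans (hF_le_hPhi_right a w c)⟩
      rintro (_ | _ | _ | _ | _ | _) hne hw
      · exact hne rfl
      · linarith [(hR.1 hw).2]
      · have h5 := (hRS.1 hw).2.2.trans_le h1
        rw [EReal.coe_lt_coe_iff, hlt] at h5
        linarith
      · linarith [(hSR.1 hw).1]
      · exact hRSR.1 hw
      · linarith [(hSRS.1 hw).1]
    · rcases le_or_gt e a with hce | hce
      · refine ⟨.S, forall_pattern _ (hS.2 (Or.inr (Or.inr (Or.inr ⟨hci, ?_⟩)))) ?_,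
          hb.asc_isS hac hU fun w hw => le_trans ?_ (hF_le_hPhi_right a w c)⟩
        · rw [h1, EReal.coe_le_coe_iff, hle]; exact hce
        · rintro (_ | _ | _ | _ | _ | _) hne hw
          · exact hne rfl
          · linarith [(hR.1 hw).2]
          · have h5 := (hRS.1 hw).2.2
            rw [h1, EReal.coe_lt_coe_iff, hlt] at h5
            linarith
          · linarith [(hSR.1 hw).1]
          · exact hRSR.1 hw
          · linarith [(hSRS.1 hw).1]
        · have h5 : e ≤ (a + w) / 2 := by linarith [hw.1]
          rcases h5.eq_or_lt with h5 | h5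
          · rw [← h5, h2]
          · exact (h3 _ h5).le
      · refine ⟨.RS, forall_pattern _ (hRS.2 ⟨hci, hai, ?_⟩) ?_, st b e,
          hU.reflect_isRS ((hlt _ _).2 hce) ((hlt _ _).2 (he.2.trans hci)) hGc hdc
          (hb.fanCondMin ha hc fun y hy => ⟨H.hF_lt ⟨hai, (hce.trans he.2).le⟩
            ⟨hai.trans_lt hy.1, hy.2.trans he.2⟩, h4 y ⟨hai.trans hy.1.le, hy.2⟩⟩)
          (hb.shockSpeed_right hc (he.2.trans hci).ne' h2)⟩
        · rw [h1, EReal.coe_lt_coe_iff, hlt]; exact hce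
        · rintro (_ | _ | _ | _ | _ | _) hne hw
          · rw [hS, h1] at hw
            simp only [EReal.toReal_coe, EReal.coe_le_coe_iff, hle, hai.not_gt, hce.not_ge,
              he.1.not_ge, false_and, and_false, false_or, or_false] at hw
            rw [hb.le_vMLeft (hb.mem_of_hF_le h2.le) ha] at hw
            obtain ⟨-, x, hx1, hx2, hx3⟩ := hw
            exact (H.hF_lt ⟨hai.trans hx1, (hx2.trans he.2).le⟩ he).ne hx3
          · linarith [(hR.1 hw).2]
          · exact hne rfl
          · linarith [(hSR.1 hw).1]
          · exact hRSR.1 hw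
          · linarith [(hSRS.1 hw).1]
  · -- both states lie in the convex region
    refine ⟨.R, forall_pattern _ (hR.2 ⟨hai, hci⟩) ?_, hU.reflect_isR ((hlt _ _).2 hac) hdc
      (hb.fanCondMin ha hc fun y hy => ⟨H.hF_lt ⟨hai, hac.le.trans hci⟩
        ⟨hai.trans_lt hy.1, hy.2.trans_le hci⟩, H.hF_lt ⟨hai.trans hac.le, hci⟩
        ⟨hai.trans_lt hy.1, hy.2.trans_le hci⟩⟩)⟩
    rintro (_ | _ | _ | _ | _ | _) hne hw
    · rcases hS.1 hw with h | h | h | h <;> linarith [h.1]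
    · exact hne rfl
    · linarith [(hRS.1 hw).1]
    · linarith [(hSR.1 hw).1]
    · exact hRSR.1 hw
    · linarith [(hSRS.1 hw).1]

end

end RiemannPhase

/-! ### The phase diagram for decreasing data -/

namespace RiemannPhase

open Real (cosh sinh one_le_cosh cosh_pos cosh_le_cosh cosh_lt_cosh)

section

variable {b a c i m : ℝ}

/-- The factor in `|x + y|` is symmetric, so tangency at the state of larger modulus is the more
restrictive condition. The descending case splits according to which of the two states that is. -/
lemma hF_swap_le {x y : ℝ} (h : |y| ≤ |x|) : hF x y ≤ hF y x :=
  hF_le_hF h (by rw [add_comm])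

lemma HypParams.lt_hF_neg (h : HypParams K i m) {x y : ℝ} (hx : x ≤ -i) (hy : y < -i) :
    K < hF x y := by
  rw [← hF_neg]
  exact h.lt_hF (by linarith) (by linarith)

/-- The three alternatives defining the region say the same thing: the graph satisfies the tangency
inequalities at both ends. This is precisely what `hPhi_le` needs to put the chord above the graph.
-/
lemma Small.desc_S_iff (hb : Small b) (hi : st b i = vInfl b) (hm : st b m = vMax b)
    (H : HypParams (thr b) i m) (hac : a < c) (ha : st b a ∈ Icc (-1 : ℝ) 1)
    (hc : st b c ∈ Icc (-1 : ℝ) 1) :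
    InRegion b (st b c) (st b a) .S ↔ hF a c ≤ thr b ∧ hF c a ≤ thr b := by
  have h0 := H.i_pos
  have hle : ∀ x y, st b x ≤ st b y ↔ x ≤ y := fun x y => hb.strictMono_st.le_iff_le
  -- Beyond `c ≥ i` there are no tangency points from `c`, so the farthest one is the leftmost root.
  have far_left : ∀ e, i ≤ c → e < c → hF c e = thr b → (∀ y < e, thr b < hF c y) →
      vEFar b (st b c) = (st b e : EReal) := fun e h1 h2 h3 h4 =>
    hb.vEFar_eq_left hc h2 h3 h4 fun y hy => H.lt_hF h1 (h1.trans_lt hy)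
  have far_right : ∀ e, a ≤ -i → a < e → hF a e = thr b → (∀ y > e, thr b < hF a y) →
      vEFar b (st b a) = (st b e : EReal) := fun e h1 h2 h3 h4 =>
    hb.vEFar_eq_right ha h2 h3 h4 fun y hy => H.lt_hF_neg h1 (hy.trans_le h1)
  have hcont : ∀ y, Continuous fun x => hF x y := fun y => by unfold hF; fun_prop
  rw [(hb.desc_regions hi hm hac ha hc).1]
  constructor
  · rintro (⟨h1, h2⟩ | ⟨⟨h1, h2⟩, h3, h4⟩ | ⟨⟨h1, h2⟩, h3, h4⟩)
    · have haI : a ∈ Icc (-i) i := ⟨h1, hac.le.trans h2⟩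
      have hcI : c ∈ Icc (-i) i := ⟨h1.trans hac.le, h2⟩
      exact ⟨H.hF_le haI hcI, H.hF_le hcI haI⟩
    · obtain ⟨e, -, he2, -, he4, he5, he6⟩ := H.exists_left (by linarith : -i < c) h2
      rw [abs_of_pos (by linarith : 0 < c)] at he2 he5
      rw [far_left e h1 (by linarith) he4 he6, EReal.coe_le_coe_iff, hle] at h3
      obtain ⟨x, hx1, hx2, hx3⟩ := (hb.le_vMLeft hc ha).1 h4
      -- If `|a|` dominates, the bound `v_e⁺ ≤ a` gives the decisive inequality; if `c` dominates,
      -- the intersection `x ≥ a` gives it through `|a + c| ≤ |x + c|`.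
      rcases le_total a (-c) with hca | hca
      · have h5 := he5 a ⟨h3, hca⟩
        refine ⟨(hF_swap_le ?_).trans h5, h5⟩
        rw [abs_of_pos (by linarith), abs_of_neg (by linarith)]
        linarith
      · have h5 : hF a c ≤ thr b := by
          rw [← hx3]
          refine hF_le_hF le_rfl ?_
          rw [abs_of_nonneg (by linarith), abs_of_nonneg (by linarith)]
          linarith
        refine ⟨h5, (hF_swap_le ?_).trans h5⟩
        rw [abs_of_pos (by linarith : 0 < c)]
        exact abs_le.2 ⟨hca, hac.le⟩
    · obtain ⟨e, he1, he2, -, he4, he5, he6⟩ := H.exists_right h1 (by linarith : a < i)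
      rw [abs_of_neg (by linarith : a < 0)] at he2 he5
      rw [far_right e h2 (by linarith) he4 he6, EReal.coe_le_coe_iff, hle] at h4
      obtain ⟨x, hx1, hx2, hx3⟩ := (hb.vMRight_le ha hc).1 h3
      rcases le_total (-a) c with hca | hca
      · have h5 := he5 c ⟨hca, h4⟩
        refine ⟨h5, (hF_swap_le ?_).trans h5⟩
        rw [abs_of_neg (by linarith : a < 0), abs_of_pos (by linarith)]
        exact hca
      · have h5 : hF c a ≤ thr b := by
          rw [← hx3]
          refine hF_le_hF le_rfl ?_
          rw [abs_of_nonpos (by linarith), abs_of_nonpos (by linarith)]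
          linarith
        refine ⟨(hF_swap_le ?_).trans h5, h5⟩
        rw [abs_of_neg (by linarith : a < 0)]
        exact abs_le.2 ⟨by linarith, hca⟩
  · rintro ⟨h1, h2⟩
    have hcm := abs_le.1 (H.abs_le_m h1)
    have ham := abs_le.1 (H.abs_le_m h2)
    rcases le_or_gt (-c) a with hca | hca
    · rcases le_or_gt c i with hci | hci
      · exact Or.inl ⟨by linarith, hci⟩
      · obtain ⟨e, -, he2, -, he4, -, he6⟩ := H.exists_left (by linarith : -i < c) hcm.2
        rw [abs_of_pos (by linarith : 0 < c)] at he2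
        refine Or.inr (Or.inl ⟨⟨hci.le, hcm.2⟩, ?_, (hb.le_vMLeft hc ha).2 ?_⟩)
        · rw [far_left e hci.le (by linarith) he4 he6, EReal.coe_le_coe_iff, hle]
          linarith
        -- The function `x ↦ hF x c` is at most `K` at `a` and larger than `K` at `c`, so the
        -- tangent line at `c` meets the graph in between.
        · have h3 := H.lt_hF hci.le hci
          obtain ⟨x, hx, hx'⟩ := intermediate_value_Icc hac.le (hcont c).continuousOn ⟨h1, h3.le⟩
          exact ⟨x, hx.1, lt_of_le_of_ne hx.2 (by rintro rfl; exact h3.ne' hx'), hx'⟩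
    · rcases le_or_gt (-i) a with hai | hai
      · exact Or.inl ⟨hai, by linarith⟩
      · obtain ⟨e, he1, he2, -, he4, -, he6⟩ := H.exists_right ham.1 (by linarith : a < i)
        rw [abs_of_neg (by linarith : a < 0)] at he2
        refine Or.inr (Or.inr ⟨⟨ham.1, hai.le⟩, (hb.vMRight_le ha hc).2 ?_, ?_⟩)
        · have h3 := H.lt_hF_neg hai.le hai
          obtain ⟨x, hx, hx'⟩ := intermediate_value_Icc' hac.le (hcont a).continuousOn ⟨h2, h3.le⟩
          exact ⟨x, lt_of_le_of_ne hx.1 (by rintro rfl; exact h3.ne' hx'), hx.2, hx'⟩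
        · rw [far_right e hai.le (by linarith) he4 he6, EReal.coe_le_coe_iff, hle]
          linarith

/-- To the right of `|a|` the tangency function from `a` increases, so being past the rightmost
tangency point is a sign condition at `c`. -/
lemma Small.desc_RS_iff (hb : Small b) (hi : st b i = vInfl b) (hm : st b m = vMax b)
    (H : HypParams (thr b) i m) (hac : a < c) (ha : st b a ∈ Icc (-1 : ℝ) 1)
    (hc : st b c ∈ Icc (-1 : ℝ) 1) :
    InRegion b (st b c) (st b a) .RS ↔ (-m ≤ a ∧ a < i) ∧ |a| < c ∧ thr b < hF a c := by
  rw [(hb.desc_regions hi hm hac ha hc).2.2.1]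
  refine and_congr_right fun ⟨h1, h2⟩ => ?_
  obtain ⟨e, -, he2, he3, he4, he5, he6⟩ := H.exists_right h1 h2
  rw [hb.vERight_eq ha he3 he4 he6, EReal.coe_lt_coe_iff, hb.strictMono_st.lt_iff_lt]
  refine ⟨fun h => ⟨he2.trans_lt h, he6 c h⟩, fun ⟨h3, h4⟩ => ?_⟩
  by_contra! hle
  exact (he5 c ⟨h3.le, hle⟩).not_gt h4

lemma Small.desc_SR_iff (hb : Small b) (hi : st b i = vInfl b) (hm : st b m = vMax b)
    (H : HypParams (thr b) i m) (hac : a < c) (ha : st b a ∈ Icc (-1 : ℝ) 1)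
    (hc : st b c ∈ Icc (-1 : ℝ) 1) :
    InRegion b (st b c) (st b a) .SR ↔ (-i < c ∧ c ≤ m) ∧ a < -|c| ∧ thr b < hF c a := by
  rw [(hb.desc_regions hi hm hac ha hc).2.2.2.1]
  refine and_congr_right fun ⟨h1, h2⟩ => ?_
  obtain ⟨e, -, he2, he3, he4, he5, he6⟩ := H.exists_left h1 h2
  rw [hb.vELeft_eq hc he3 he4 he6, EReal.coe_lt_coe_iff, hb.strictMono_st.lt_iff_lt]
  refine ⟨fun h => ⟨h.trans_le he2, he6 a h⟩, fun ⟨h3, h4⟩ => ?_⟩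
  by_contra! hle
  exact (he5 a ⟨hle, h3.le⟩).not_gt h4

lemma HypParams.hF_neg_m (H : HypParams K i m) : hF (-m) m = K := by
  rw [hF, neg_add_cancel, Real.cosh_zero, ← H.m_eq]
  ring

/-- For `|y| > m` the tangency function exceeds `K` whatever the first argument, so both outer
ranges carry fans. The tangent line at `m` passes through the graph point at `-m` and conversely,
which attaches the middle shock to both fans. -/
lemma Small.desc_isRSR (hb : Small b) (H : HypParams (thr b) i m) (ham : a < -m) (hmc : m < c)
    (ha : st b a ∈ Icc (-1 : ℝ) 1) (hc : st b c ∈ Icc (-1 : ℝ) 1) {U : ℝ → ℝ}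
    (hU : MaxSel (flux b) U (st b a) (st b c)) :
    IsRSR (flux b) U (st b c) (st b m) (st b (-m)) (st b a) := by
  have h0 := H.m_pos
  have h1 := H.hF_neg_m
  have h2 : hF m (-m) = thr b := by rw [← h1, ← hF_neg, neg_neg]
  have hm1 := hb.mem_of_hF_le h1.le
  have hm2 := hb.mem_of_hF_le h2.le
  have hlt : ∀ x y, st b x < st b y ↔ x < y := fun x y => hb.strictMono_st.lt_iff_lt
  refine hU.isRSR ((hlt _ _).2 ham) ((hlt _ _).2 (by linarith)) ((hlt _ _).2 hmc)
    (hb.continuousOn_deriv ha hc)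
    (hb.fanCond ha hc (by linarith) le_rfl fun y hy x _ => H.lt_hF_of_m_lt ?_)
    (hb.fanCond ha hc le_rfl (by linarith) fun y hy x _ => H.lt_hF_of_m_lt ?_)
    (hb.shockSpeed_right hm2 (by linarith) h1) (hb.shockSpeed_left hm1 (by linarith) h2)
  · rw [abs_of_pos (h0.trans hy.1)]; exact hy.1
  · rw [abs_of_neg (by linarith [hy.2])]; linarith [hy.2]

/-- The phase diagram for `uR < uL`. -/
lemma Small.descending (hb : Small b) (hi : st b i = vInfl b) (hm : st b m = vMax b)
    (H : HypParams (thr b) i m) (hac : a < c) (ha : st b a ∈ Icc (-1 : ℝ) 1)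
    (hc : st b c ∈ Icc (-1 : ℝ) 1) {U : ℝ → ℝ} (hU : MaxSel (flux b) U (st b a) (st b c)) :
    ∃ w₀, (∀ w, InRegion b (st b c) (st b a) w ↔ w = w₀) ∧
      HasPattern (flux b) U (st b c) (st b a) w₀ := by
  have hS := hb.desc_S_iff hi hm H hac ha hc
  have hRS := hb.desc_RS_iff hi hm H hac ha hc
  have hSR := hb.desc_SR_iff hi hm H hac ha hc
  obtain ⟨-, hR, -, -, hRSR, hSRS⟩ := hb.desc_regions hi hm hac ha hc
  have h0 := H.i_pos
  have him := H.i_lt_m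
  have hlt : ∀ x y, st b x < st b y ↔ x < y := fun x y => hb.strictMono_st.lt_iff_lt
  have hGc := hb.continuousOn ha hc
  have hdc := hb.continuousOn_deriv ha hc
  by_cases hSc : hF a c ≤ thr b ∧ hF c a ≤ thr b
  · have ham := abs_le.1 (H.abs_le_m hSc.2)
    refine ⟨.S, forall_pattern _ (hS.2 hSc) ?_, hU.isS ((hlt _ _).2 hac) fun w hw => ?_⟩
    · rintro (_ | _ | _ | _ | _ | _) hne hw
      · exact hne rfl
      · rcases hR.1 hw with h | h
        · exact (H.lt_hF_neg h (hac.trans_le h)).not_ge hSc.2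
        · exact (H.lt_hF h (h.trans_lt hac)).not_ge hSc.1
      · exact (hRS.1 hw).2.2.not_ge hSc.1
      · exact (hSR.1 hw).2.2.not_ge hSc.2
      · linarith [(hRSR.1 hw).2]
      · exact hSRS.1 hw
    · obtain ⟨x, hx, rfl⟩ := hb.exists_co hw
      exact hb.le_chord hx.1 hx.2 (hPhi_le hx hSc.1 hSc.2)
  by_cases hRc : c ≤ -i ∨ i ≤ a
  · refine ⟨.R, forall_pattern _ (hR.2 hRc) ?_, hU.isR ((hlt _ _).2 hac) hdc
      (hb.fanCond ha hc le_rfl le_rfl fun y hy x hx => ?_)⟩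
    · rintro (_ | _ | _ | _ | _ | _) hne hw
      · exact hSc (hS.1 hw)
      · exact hne rfl
      · obtain ⟨⟨h1, h2⟩, h3, -⟩ := hRS.1 hw
        rcases hRc with h | h
        · linarith [abs_nonneg a]
        · linarith
      · obtain ⟨⟨h1, h2⟩, h3, -⟩ := hSR.1 hw
        rcases hRc with h | h
        · linarith
        · linarith [abs_nonneg c]
      · obtain ⟨h1, h2⟩ := hRSR.1 hw
        rcases hRc with h | h <;> linarith
      · exact hSRS.1 hw
    · rcases hRc with h | h
      · exact H.lt_hF_neg (hx.2.trans h) (hy.2.trans_le h)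
      · exact H.lt_hF (h.trans hx.1) (h.trans_lt hy.1)
  obtain ⟨hci, hai⟩ := not_or.1 hRc
  rw [not_le] at hci hai
  by_cases hRSRc : m < c ∧ a < -m
  · refine ⟨.RSR, forall_pattern _ (hRSR.2 hRSRc) ?_, _, _,
      hb.desc_isRSR H hRSRc.2 hRSRc.1 ha hc hU⟩
    rintro (_ | _ | _ | _ | _ | _) hne hw
    · exact hSc (hS.1 hw)
    · exact hRc (hR.1 hw)
    · linarith [(hRS.1 hw).1.1]
    · linarith [(hSR.1 hw).1.2]
    · exact hne rfl
    · exact hSRS.1 hw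
  -- No shock, single fan or double fan is left. The state of larger modulus starts or ends a fan,
  -- and the shock ends at the other one.
  rcases le_or_gt (-c) a with hca | hca
  · have hac' : |a| ≤ c := abs_le.2 ⟨hca, hac.le⟩
    have hc0 := (abs_nonneg a).trans hac'
    have ham : -m ≤ a := by
      by_contra! h
      exact hRSRc ⟨by linarith, h⟩
    have hK : thr b < hF a c := by
      by_contra! h
      exact hSc ⟨h, (hF_swap_le (by rwa [abs_of_nonneg hc0])).trans h⟩
    -- Equality of the moduli is excluded, since `hF a |a| ≤ K` for `-m ≤ a ≤ i`.
    have hlt' : |a| < c := lt_of_le_of_ne hac' fun h => by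
      have := H.hF_abs_le ham hai.le
      rw [h] at this
      exact this.not_gt hK
    obtain ⟨e, -, he2, he3, he4, he5, he6⟩ := H.exists_right ham hai
    have hec : e < c := by
      by_contra! h
      exact (he5 c ⟨hac', h⟩).not_gt hK
    have hae : a < e := lt_of_le_of_ne ((le_abs_self a).trans he2) he3.symm
    refine ⟨.RS, forall_pattern _ (hRS.2 ⟨⟨ham, hai⟩, hlt', hK⟩) ?_, st b e,
      hU.isRS ((hlt _ _).2 hae) ((hlt _ _).2 hec) hGc hdc
        (hb.fanCond ha hc hae.le le_rfl fun y hy x hx => ?_)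
        (hb.shockSpeed_right ha hae.ne he4)⟩
    · rintro (_ | _ | _ | _ | _ | _) hne hw
      · exact hSc (hS.1 hw)
      · exact hRc (hR.1 hw)
      · exact hne rfl
      · have := (hSR.1 hw).2.1
        linarith [le_abs_self c]
      · linarith [(hRSR.1 hw).2]
      · exact hSRS.1 hw
    · refine (he6 y hy.1).trans_le (hF_le_hF le_rfl ?_)
      have := (abs_le.1 he2).1
      rw [abs_of_nonneg (by linarith [hy.1]), abs_of_nonneg (by linarith [hy.1, hx.1])]
      linarith [hx.1]
  · have ha0 : a < 0 := by linarith
    have hac' : |c| ≤ -a := abs_le.2 ⟨by linarith, by linarith⟩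
    have hcm : c ≤ m := by
      by_contra! h
      exact hRSRc ⟨h, by linarith⟩
    have hK : thr b < hF c a := by
      by_contra! h
      exact hSc ⟨(hF_swap_le (by rwa [abs_of_neg ha0])).trans h, h⟩
    have hlt' : a < -|c| := by
      have := abs_lt.2 (⟨by linarith, by linarith⟩ : -(-a) < c ∧ c < -a)
      linarith
    obtain ⟨e, -, he2, he3, he4, he5, he6⟩ := H.exists_left hci hcm
    have hae : a < e := by
      by_contra! h
      exact (he5 a ⟨h, hlt'.le⟩).not_gt hK
    have hec : e < c := lt_of_le_of_ne (by linarith [neg_abs_le c]) he3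
    refine ⟨.SR, forall_pattern _ (hSR.2 ⟨⟨hci, hcm⟩, hlt', hK⟩) ?_, st b e,
      hU.isSR ((hlt _ _).2 hae) ((hlt _ _).2 hec) hGc hdc
        (hb.fanCond ha hc le_rfl hec.le fun y hy x hx => ?_)
        (hb.shockSpeed_left hc hec.ne' he4)⟩
    · rintro (_ | _ | _ | _ | _ | _) hne hw
      · exact hSc (hS.1 hw)
      · exact hRc (hR.1 hw)
      · have := (hRS.1 hw).2.1
        linarith [neg_abs_le a]
      · exact hne rfl
      · linarith [(hRSR.1 hw).1]
      · exact hSRS.1 hw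
    · refine (he6 y hy.2).trans_le (hF_le_hF le_rfl ?_)
      have := le_abs_self c
      rw [abs_of_nonpos (by linarith [hy.2]), abs_of_nonpos (by linarith [hy.2, hx.2])]
      linarith [hx.2]

end

end RiemannPhase

namespace RiemannPhase

/-! ### Measurability and bounds -/

lemma measurable_real_sign : Measurable Real.sign := by
  unfold Real.sign
  exact Measurable.ite measurableSet_Iio measurable_const
    (Measurable.ite measurableSet_Ioi measurable_const measurable_const)

lemma measurable_kq {G : ℝ → ℝ} (hG : Measurable G) :
    Measurable fun p : ℝ × ℝ => kq G p.1 p.2 := by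
  unfold kq
  exact (measurable_real_sign.comp (measurable_fst.sub measurable_snd)).mul
    ((hG.comp measurable_fst).sub (hG.comp measurable_snd))

lemma abs_sub_le_two {u k : ℝ} (hu : u ∈ Icc (-1 : ℝ) 1) (hk : k ∈ Icc (-1 : ℝ) 1) :
    |u - k| ≤ 2 :=
  abs_le.2 ⟨by linarith [hu.1, hk.2], by linarith [hu.2, hk.1]⟩

lemma abs_kq_le_two {G : ℝ → ℝ} {L : ℝ} (hG : LipOn G L) {u k : ℝ} (hu : u ∈ Icc (-1 : ℝ) 1)
    (hk : k ∈ Icc (-1 : ℝ) 1) : |kq G u k| ≤ 2 * L := by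
  have := abs_kq_le hG hu hk
  nlinarith [abs_sub_le_two hu hk, hG.nonneg]

section

variable {G U : ℝ → ℝ} {uL uR L k : ℝ}

lemma Profile.measurable (hP : Profile G U uL uR) : Measurable U :=
  hP.mono.elim (fun h => h.measurable) (fun h => h.measurable)

lemma Profile.ae_continuousAt (hP : Profile G U uL uR) : ∀ᵐ ξ, ContinuousAt U ξ := by
  have : {ξ | ¬ContinuousAt U ξ}.Countable :=
    hP.mono.elim (fun h => h.countable_not_continuousAt) (fun h => h.countable_not_continuousAt)
  filter_upwards [this.ae_notMem volume] with ξ hξ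
  simpa using hξ

lemma Profile.measurable_entropy (hP : Profile G U uL uR) (k : ℝ) :
    Measurable fun ξ => |U ξ - k| := by
  have := hP.measurable
  fun_prop

lemma Profile.measurable_kq (hP : Profile G U uL uR) (hGm : Measurable G) (k : ℝ) :
    Measurable fun ξ => kq G (U ξ) k :=
  (RiemannPhase.measurable_kq hGm).comp (hP.measurable.prodMk measurable_const)

lemma Profile.locallyIntegrable_entropy (hP : Profile G U uL uR) (hk : k ∈ Icc (-1 : ℝ) 1) :
    LocallyIntegrable fun ξ => |U ξ - k| :=
  (locallyIntegrable_const (2 : ℝ)).mono (hP.measurable_entropy k).aestronglyMeasurable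
    (Eventually.of_forall fun ξ => by simpa using abs_sub_le_two (hP.mem ξ) hk)

lemma Profile.locallyIntegrable_flux (hP : Profile G U uL uR) (hG : LipOn G L)
    (hGm : Measurable G) (hk : k ∈ Icc (-1 : ℝ) 1) :
    LocallyIntegrable fun ξ => kq G (U ξ) k - ξ * |U ξ - k| := by
  have hcont : Continuous fun ξ : ℝ => 2 * L + 2 * |ξ| := by fun_prop
  refine hcont.locallyIntegrable.mono ((hP.measurable_kq hGm k).sub
    (measurable_id.mul (hP.measurable_entropy k))).aestronglyMeasurable
    (Eventually.of_forall fun ξ => ?_)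
  have h1 := abs_kq_le_two hG (hP.mem ξ) hk
  have h2 : |ξ * (|U ξ - k|)| ≤ 2 * |ξ| := by
    rw [abs_mul, abs_abs]; nlinarith [abs_nonneg ξ, abs_sub_le_two (hP.mem ξ) hk]
  exact ((abs_sub _ _).trans (add_le_add h1 h2)).trans (le_abs_self _)

/-- The entropy inequality for self-similar profiles, in one variable. -/
lemma Profile.integral_le (hP : Profile G U uL uR) (hG : LipOn G L) (hGm : Measurable G)
    (hk : k ∈ Icc (-1 : ℝ) 1) {ψ : ℝ → ℝ} (hψ : ContDiff ℝ 1 ψ) (hc : HasCompactSupport ψ)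
    (h0 : ∀ ξ, 0 ≤ ψ ξ) :
    ∫ ξ, |U ξ - k| * ψ ξ ≤ ∫ ξ, (kq G (U ξ) k - ξ * |U ξ - k|) * deriv ψ ξ := by
  have hUm := hP.measurable
  set E : ℝ → ℝ := fun ξ => |U ξ - k| with hE
  set Z : ℝ → ℝ := fun ξ => kq G (U ξ) k - ξ * |U ξ - k| with hZ
  have hEi : LocallyIntegrable E := hP.locallyIntegrable_entropy hk
  have hZi : LocallyIntegrable Z := hP.locallyIntegrable_flux hG hGm hk
  -- The translation is put on the test function, so `J` is differentiable although `Z` may jump.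
  -- Moving it back to `Z` turns the incremental inequality into a difference quotient of `J` at
  -- `0`.
  set J : ℝ → ℝ := fun h => ∫ ξ, Z ξ * ψ (ξ - h) with hJ
  have hJd : HasDerivAt J (-∫ ξ, Z ξ * deriv ψ ξ) 0 := by
    have hg : ContDiff ℝ 1 fun s => ψ (-s) := hψ.comp contDiff_neg
    have hgc : HasCompactSupport fun s => ψ (-s) := hc.comp_homeomorph (Homeomorph.neg ℝ)
    have h1 := hgc.hasDerivAt_convolution_right (ContinuousLinearMap.mul ℝ ℝ) hZi hg 0
    have e1 : (convolution Z (fun s => ψ (-s)) (ContinuousLinearMap.mul ℝ ℝ) volume) = J := by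
      ext h
      simp only [convolution, hJ, ContinuousLinearMap.mul_apply', neg_sub]
    rw [e1] at h1
    refine h1.congr_deriv ?_
    simp only [convolution, ContinuousLinearMap.mul_apply', zero_sub]
    rw [← integral_neg]
    refine integral_congr_ae (Eventually.of_forall fun ξ => ?_)
    simp only [deriv_comp_neg, neg_neg, mul_neg]
  have hslope : Tendsto (fun h => h⁻¹ * (J (-h) - J 0)) (𝓝[>] 0) (𝓝 (∫ ξ, Z ξ * deriv ψ ξ)) := by
    have h1 : HasDerivAt (fun h => J (-h)) (∫ ξ, Z ξ * deriv ψ ξ) 0 := by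
      have h2 := HasDerivAt.comp (0 : ℝ) (h₂ := J) (h := fun h => -h) (by simpa using hJd)
        (hasDerivAt_neg' 0)
      refine h2.congr_deriv (by ring)
    have h2 := (hasDerivAt_iff_tendsto_slope.1 h1).mono_left
      (nhdsWithin_mono 0 (fun x (hx : 0 < x) => hx.ne'))
    refine h2.congr fun h => ?_
    simp [slope]
  -- The error term vanishes by dominated convergence: a monotone profile has only countably many
  -- discontinuities.
  have hr : Tendsto (fun h => ∫ ξ, ψ ξ * |U ξ - U (ξ - h)|) (𝓝[>] 0) (𝓝 0) := by
    have hint : Integrable fun ξ => ψ ξ * 2 :=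
      (hψ.continuous.integrable_of_hasCompactSupport hc).mul_const 2
    have h1 := tendsto_integral_filter_of_dominated_convergence (μ := volume) (l := 𝓝[>] (0 : ℝ))
      (F := fun h ξ => ψ ξ * |U ξ - U (ξ - h)|) (f := fun _ => 0) (fun ξ => ψ ξ * 2)
      (Eventually.of_forall fun h => ?_) (Eventually.of_forall fun h => ?_) hint ?_
    · simpa using h1
    · have hψm := hψ.continuous.measurable
      have hU2 : Measurable fun ξ => U (ξ - h) := hUm.comp (measurable_id.sub_const h)
      exact (hψm.mul (measurable_norm.comp (hUm.sub hU2))).aestronglyMeasurable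
    · refine Eventually.of_forall fun ξ => ?_
      rw [Real.norm_eq_abs, abs_mul, abs_of_nonneg (h0 ξ), abs_abs]
      exact mul_le_mul_of_nonneg_left (abs_sub_le_two (hP.mem _) (hP.mem _)) (h0 ξ)
    · filter_upwards [hP.ae_continuousAt] with ξ hξ
      have h2 : Tendsto (fun h : ℝ => ξ - h) (𝓝[>] 0) (𝓝 ξ) := by
        have : Continuous fun h : ℝ => ξ - h := by fun_prop
        simpa using (this.tendsto 0).mono_left nhdsWithin_le_nhds
      have h3 := (hξ.tendsto.comp h2).const_sub (U ξ)
      simpa using (h3.abs.const_mul (ψ ξ))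
  have hEψ : Integrable fun ξ => E ξ * ψ ξ :=
    hEi.integrable_smul_right_of_hasCompactSupport hψ.continuous hc
  have hmain : ∀ h : ℝ, 0 < h → ∫ ξ, E ξ * ψ ξ ≤
      h⁻¹ * (J (-h) - J 0) + ∫ ξ, ψ ξ * |U ξ - U (ξ - h)| := by
    intro h hh
    have hZψ : Integrable fun ξ => Z ξ * ψ ξ :=
      hZi.integrable_smul_right_of_hasCompactSupport hψ.continuous hc
    have hZψ' : Integrable fun ξ => Z ξ * ψ (ξ + h) :=
      hZi.integrable_smul_right_of_hasCompactSupport (hψ.continuous.comp (by fun_prop))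
        (hc.comp_homeomorph (Homeomorph.addRight h))
    have hshift : Integrable fun ξ => Z (ξ - h) * ψ ξ := by
      have := hZψ'.comp_sub_right h
      simpa using this
    have e1 : J (-h) = ∫ ξ, Z (ξ - h) * ψ ξ := by
      have := integral_sub_right_eq_self (μ := volume) (fun ξ => Z ξ * ψ (ξ + h)) h
      simp only [sub_add_cancel] at this
      rw [this, hJ]
      simp only [sub_neg_eq_add]
    have e0 : J 0 = ∫ ξ, Z ξ * ψ ξ := by simp [hJ]
    have hr' : Integrable fun ξ => ψ ξ * |U ξ - U (ξ - h)| := by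
      refine ((hψ.continuous.integrable_of_hasCompactSupport hc).mul_const 2).mono' ?_ ?_
      · have hψm := hψ.continuous.measurable
        have hU2 : Measurable fun ξ => U (ξ - h) := hUm.comp (measurable_id.sub_const h)
        exact (hψm.mul (measurable_norm.comp (hUm.sub hU2))).aestronglyMeasurable
      · refine Eventually.of_forall fun ξ => ?_
        rw [Real.norm_eq_abs, abs_mul, abs_of_nonneg (h0 ξ), abs_abs]
        exact mul_le_mul_of_nonneg_left (abs_sub_le_two (hP.mem _) (hP.mem _)) (h0 ξ)
    have hd : Integrable fun ξ => h⁻¹ * (Z (ξ - h) * ψ ξ - Z ξ * ψ ξ) :=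
      (hshift.sub hZψ).const_mul _
    rw [e1, e0, ← integral_sub hshift hZψ, ← integral_const_mul, ← integral_add hd hr']
    refine integral_mono hEψ (hd.add hr') fun ξ => ?_
    -- With increment `h`, the two occurrences of `ξ |U ξ - k|` in `Z` and in the inequality combine
    -- to `h * E ξ`.
    have hinc := hP.incr k hk (ξ - h) ξ (by linarith)
    have h4 : h * E ξ ≤ Z (ξ - h) - Z ξ + h * |U ξ - U (ξ - h)| := by
      simp only [hE, hZ]
      linarith
    have h5 := mul_le_mul_of_nonneg_left h4 (mul_nonneg (inv_nonneg.2 hh.le) (h0 ξ))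
    have h6 : h⁻¹ * h = 1 := inv_mul_cancel₀ hh.ne'
    calc E ξ * ψ ξ = h⁻¹ * ψ ξ * (h * E ξ) := by linear_combination (-(E ξ * ψ ξ)) * h6
      _ ≤ _ := h5
      _ = h⁻¹ * (Z (ξ - h) * ψ ξ - Z ξ * ψ ξ) + ψ ξ * |U ξ - U (ξ - h)| := by
        linear_combination (ψ ξ * |U ξ - U (ξ - h)|) * h6
  have hlim := hslope.add hr
  rw [add_zero] at hlim
  exact ge_of_tendsto hlim (eventually_nhdsWithin_of_forall fun h hh => hmain h hh)

end

end RiemannPhase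

namespace RiemannPhase

/-! ### Test functions -/

/-- Nonnegative test functions on the open upper half plane. -/
structure IsTest (φ : ℝ × ℝ → ℝ) : Prop where
  smooth : ContDiff ℝ ∞ φ
  compact : HasCompactSupport φ
  sub : tsupport φ ⊆ upperHalf
  nonneg : ∀ p, 0 ≤ φ p

lemma restrict_upperHalf :
    (volume.restrict upperHalf : Measure (ℝ × ℝ)) = volume.prod (volume.restrict (Ioi 0)) := by
  have h : upperHalf = (univ : Set ℝ) ×ˢ Ioi (0 : ℝ) := by
    ext p; simp [upperHalf]
  rw [h, Measure.volume_eq_prod, ← Measure.prod_restrict, Measure.restrict_univ]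

/-- The box `[-B, B] × [δ, B]`. -/
def box (δ B : ℝ) : Set (ℝ × ℝ) := Icc (-B) B ×ˢ Icc δ B

lemma mem_box {δ B : ℝ} {p : ℝ × ℝ} : p ∈ box δ B ↔ |p.1| ≤ B ∧ δ ≤ p.2 ∧ p.2 ≤ B := by
  simp only [box, mem_prod, mem_Icc, abs_le]

lemma isCompact_box (δ B : ℝ) : IsCompact (box δ B) := isCompact_Icc.prod isCompact_Icc

lemma integrable_of_compact {X : Type*} [TopologicalSpace X] [MeasurableSpace X] {μ : Measure X}
    [IsFiniteMeasureOnCompacts μ] {F : X → ℝ} (hF : AEStronglyMeasurable F μ) {K : Set X} {C : ℝ}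
    (hK : IsCompact K) (hKm : MeasurableSet K) (hC : ∀ p ∈ K, |F p| ≤ C)
    (h0 : ∀ p, p ∉ K → F p = 0) : Integrable F μ := by
  have hi : Integrable (K.indicator fun _ => C) μ :=
    (integrable_indicator_iff hKm).2 (integrableOn_const hK.measure_lt_top.ne)
  refine hi.mono' hF (Eventually.of_forall fun p => ?_)
  by_cases h : p ∈ K
  · simpa [h] using hC p h
  · simp [h, h0 p h]

namespace IsTest

variable {φ : ℝ × ℝ → ℝ}

/-- Compactness inside the open half plane keeps the support away from `t = 0`. The lower bound `δ`
makes all divisions by `t` harmless. -/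
lemma exists_bounds (hφ : IsTest φ) : ∃ δ B C, 0 < δ ∧ 0 < B ∧ 0 ≤ C ∧
    (∀ p, p ∉ box δ B → φ p = 0 ∧ fderiv ℝ φ p = 0) ∧
    ∀ p, |φ p| ≤ C ∧ ‖fderiv ℝ φ p‖ ≤ C := by
  obtain ⟨C₁, h1⟩ := hφ.compact.exists_bound_of_continuous hφ.smooth.continuous
  obtain ⟨C₂, h2⟩ := (hφ.compact.fderiv ℝ).exists_bound_of_continuous
    (hφ.smooth.continuous_fderiv (by simp))
  obtain ⟨B₁, h3⟩ := (hφ.compact.isCompact.bddAbove_image (f := fun p : ℝ × ℝ => |p.1|)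
    (by fun_prop))
  obtain ⟨B₂, h4⟩ := (hφ.compact.isCompact.bddAbove_image (f := fun p : ℝ × ℝ => p.2)
    (by fun_prop))
  have h5 : ∃ δ : ℝ, 0 < δ ∧ ∀ p ∈ tsupport φ, δ ≤ p.2 := by
    rcases (tsupport φ).eq_empty_or_nonempty with h | h
    · exact ⟨1, one_pos, by simp [h]⟩
    · obtain ⟨q, hq, h⟩ := hφ.compact.isCompact.exists_isMinOn h
        (f := fun p : ℝ × ℝ => p.2) (by fun_prop)
      exact ⟨q.2, hφ.sub hq, fun p hp => h hp⟩
  obtain ⟨δ, hδ, h5⟩ := h5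
  refine ⟨δ, max 1 (max B₁ B₂), max 0 (max C₁ C₂), hδ, by positivity, by positivity,
    fun p hp => ?_, fun p => ⟨(h1 p).trans (by simp), (h2 p).trans (by simp)⟩⟩
  have hp' : p ∉ tsupport φ := fun h => hp (mem_box.2
    ⟨(h3 (mem_image_of_mem _ h)).trans (by simp), h5 p h,
      (h4 (mem_image_of_mem _ h)).trans (by simp)⟩)
  exact ⟨image_eq_zero_of_notMem_tsupport hp', fderiv_of_notMem_tsupport ℝ hp'⟩

end IsTest

/-! ### Self-similar profiles are entropy solutions -/

section

variable {G U : ℝ → ℝ} {uL uR L k : ℝ} {φ : ℝ × ℝ → ℝ}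

lemma fderiv_slope_one (f : ℝ × ℝ →L[ℝ] ℝ) (ξ : ℝ) : f (ξ, 1) = ξ * f (1, 0) + f (0, 1) := by
  have : ((ξ, 1) : ℝ × ℝ) = ξ • (1, 0) + (0, 1) := by simp
  rw [this, map_add, map_smul, smul_eq_mul]

lemma abs_apply_le (f : ℝ × ℝ →L[ℝ] ℝ) : |f (1, 0)| ≤ ‖f‖ ∧ |f (0, 1)| ≤ ‖f‖ := by
  constructor
  · simpa [Prod.norm_def] using f.le_opNorm ((1, 0) : ℝ × ℝ)
  · simpa [Prod.norm_def] using f.le_opNorm ((0, 1) : ℝ × ℝ)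

/-- The derivative of `t φ(ξ t, t)` in `t`. -/
lemma hasDerivAt_ray (hφ : IsTest φ) (ξ t : ℝ) :
    HasDerivAt (fun t => t * φ (ξ * t, t)) (φ (ξ * t, t) + t * fderiv ℝ φ (ξ * t, t) (ξ, 1)) t := by
  have h1 : HasDerivAt (fun t : ℝ => (ξ * t, t)) (ξ, 1) t := by
    simpa using ((hasDerivAt_id t).const_mul ξ).prodMk (hasDerivAt_id t)
  have h2 := HasFDerivAt.comp_hasDerivAt (l := φ) (f := fun t : ℝ => (ξ * t, t)) t
    ((hφ.smooth.differentiable (by simp)) (ξ * t, t)).hasFDerivAt h1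
  exact ((hasDerivAt_id t).mul h2).congr_deriv (by simp)

/-- After the substitution `x = ξ t` the integrand is `|U ξ - k| d/dt (t φ(ξ t, t))` plus, for each
fixed `t`, the integrand of the one-variable entropy inequality with test function `ξ ↦ φ(ξ t, t)`.
The first part integrates to zero along every ray. -/
lemma Profile.entropy (hP : Profile G U uL uR) (hG : LipOn G L) (hGm : Measurable G)
    (hk : k ∈ Icc (-1 : ℝ) 1) (hφ : IsTest φ) :
    0 ≤ ∫ p in upperHalf, (|U (p.1 / p.2) - k| * fderiv ℝ φ p (0, 1)
      + kq G (U (p.1 / p.2)) k * fderiv ℝ φ p (1, 0)) := by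
  obtain ⟨δ, B, C, hδ, hB, hC, hbox, hbd⟩ := hφ.exists_bounds
  have hEm := hP.measurable_entropy k
  have hQm := hP.measurable_kq hGm k
  have hdc : Continuous (fderiv ℝ φ) := hφ.smooth.continuous_fderiv (by simp)
  have hdt : Continuous fun p => fderiv ℝ φ p (0, 1) := hdc.clm_apply continuous_const
  have hdx : Continuous fun p => fderiv ℝ φ p (1, 0) := hdc.clm_apply continuous_const
  set F : ℝ × ℝ → ℝ := fun p => |U (p.1 / p.2) - k| * fderiv ℝ φ p (0, 1)
      + kq G (U (p.1 / p.2)) k * fderiv ℝ φ p (1, 0) with hF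
  have hFm : Measurable F := by
    have hd : Measurable fun p : ℝ × ℝ => p.1 / p.2 := measurable_fst.div measurable_snd
    exact ((hEm.comp hd).mul hdt.measurable).add ((hQm.comp hd).mul hdx.measurable)
  have hFi : ∀ (μ : Measure (ℝ × ℝ)) [IsFiniteMeasureOnCompacts μ], Integrable F μ := by
    intro μ _
    refine integrable_of_compact (C := 2 * C + 2 * L * C) hFm.aestronglyMeasurable
      (isCompact_box δ B) (isCompact_box δ B).measurableSet (fun p _ => ?_) fun p hp => ?_
    · have h1 := abs_sub_le_two (hP.mem (p.1 / p.2)) hk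
      have h2 := abs_kq_le_two hG (hP.mem (p.1 / p.2)) hk
      have h3 := abs_apply_le (fderiv ℝ φ p)
      refine (abs_add_le _ _).trans (add_le_add ?_ ?_)
      · rw [abs_mul, abs_abs]
        exact mul_le_mul h1 (h3.2.trans (hbd p).2) (abs_nonneg _) (by norm_num)
      · rw [abs_mul]
        exact mul_le_mul h2 (h3.1.trans (hbd p).2) (abs_nonneg _) (by linarith [hG.nonneg])
    · simp [hF, (hbox p hp).2]
  -- the part of the integrand which is a derivative along rays
  set g : ℝ → ℝ → ℝ := fun ξ t => φ (ξ * t, t) + t * fderiv ℝ φ (ξ * t, t) (ξ, 1) with hg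
  have hray : Continuous fun p : ℝ × ℝ => (p.1 * p.2, p.2) := by fun_prop
  have hgc : Continuous fun p : ℝ × ℝ => g p.1 p.2 := by
    refine (hφ.smooth.continuous.comp hray).add (continuous_snd.mul ?_)
    exact (hdc.comp hray).clm_apply (continuous_fst.prodMk continuous_const)
  have hξ : ∀ ξ t : ℝ, ¬ (|ξ| ≤ B / δ ∧ δ ≤ t ∧ t ≤ B) → (ξ * t, t) ∉ box δ B := by
    intro ξ t h h'
    obtain ⟨h1, h2, h3⟩ := mem_box.1 h'
    refine h ⟨?_, h2, h3⟩
    rw [le_div_iff₀ hδ]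
    simp only [abs_mul] at h1
    have : |ξ| * δ ≤ |ξ| * |t| :=
      mul_le_mul_of_nonneg_left (h2.trans (le_abs_self t)) (abs_nonneg ξ)
    linarith
  set K : Set (ℝ × ℝ) := Icc (-(B / δ)) (B / δ) ×ˢ Icc δ B with hK
  have hKc : IsCompact K := isCompact_Icc.prod isCompact_Icc
  have hg0 : ∀ p : ℝ × ℝ, p ∉ K → g p.1 p.2 = 0 := by
    intro p hp
    have h := hbox _ (hξ p.1 p.2 fun h => hp ⟨abs_le.1 h.1, h.2⟩)
    simp [hg, h.1, h.2]
  have hgs : HasCompactSupport fun p : ℝ × ℝ => g p.1 p.2 := HasCompactSupport.intro hKc hg0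
  have hEg : Integrable (fun p : ℝ × ℝ => |U p.1 - k| * g p.1 p.2) volume := by
    refine ((hgc.integrable_of_hasCompactSupport hgs).abs.const_mul 2).mono'
      ((hEm.comp measurable_fst).mul hgc.measurable).aestronglyMeasurable
      (Eventually.of_forall fun p => ?_)
    rw [Real.norm_eq_abs, abs_mul, abs_abs]
    exact mul_le_mul_of_nonneg_right (abs_sub_le_two (hP.mem _) hk) (abs_nonneg _)
  have hEg' : Integrable (fun p : ℝ × ℝ => |U p.1 - k| * g p.1 p.2)
      (volume.prod (volume.restrict (Ioi 0))) := by
    rw [← restrict_upperHalf]; exact hEg.restrict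
  have hzero : ∫ t in Ioi (0 : ℝ), ∫ ξ, |U ξ - k| * g ξ t = 0 := by
    rw [← integral_integral_swap hEg']
    have : ∀ ξ, ∫ t in Ioi (0 : ℝ), |U ξ - k| * g ξ t = 0 := by
      intro ξ
      rw [integral_const_mul]
      have hc0 : ∀ t : ℝ, t ∉ Icc δ B → (ξ * t, t) ∉ box δ B := fun t ht =>
        hξ ξ t fun h => ht h.2
      have h1 : ∀ t : ℝ, t ∉ Icc δ B → g ξ t = 0 := fun t ht => by
        have h := hbox _ (hc0 t ht)
        simp [hg, h.1, h.2]
      have h2 : ∀ t : ℝ, t ∉ Icc δ B → t * φ (ξ * t, t) = 0 := fun t ht => by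
        simp [(hbox _ (hc0 t ht)).1]
      have h3 : ∫ t, g ξ t = 0 := by
        refine integral_eq_zero_of_hasDerivAt_of_integrable (fun t => hasDerivAt_ray hφ ξ t) ?_ ?_
        · exact (hgc.comp (by fun_prop : Continuous fun t : ℝ => (ξ, t))).integrable_of_hasCompactSupport
            (HasCompactSupport.intro isCompact_Icc h1)
        · refine (continuous_id.mul (hφ.smooth.continuous.comp
            (by fun_prop : Continuous fun t : ℝ => (ξ * t, t)))).integrable_of_hasCompactSupport
            (HasCompactSupport.intro isCompact_Icc h2)
      rw [setIntegral_eq_integral_of_forall_compl_eq_zero, h3, mul_zero]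
      intro t ht
      exact h1 t fun h => ht (hδ.trans_le h.1)
    simp [this]
  rw [restrict_upperHalf, integral_prod_symm _ (by rw [← restrict_upperHalf]; exact hFi _)]
  refine hzero.symm.le.trans ?_
  refine setIntegral_mono_on hEg'.integral_prod_right ?_ measurableSet_Ioi fun t ht => ?_
  · have h := hFi (volume.restrict upperHalf)
    rw [restrict_upperHalf] at h
    exact h.integral_prod_right
  have ht0 : 0 < t := ht
  set ψ : ℝ → ℝ := fun ξ => φ (ξ * t, t) with hψ
  have hlin : ContDiff ℝ 1 fun ξ : ℝ => (ξ * t, t) := by fun_prop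
  have hψs : ContDiff ℝ 1 ψ := (hφ.smooth.of_le (by simp)).comp hlin
  have hout : ∀ ξ : ℝ, ξ ∉ Icc (-(B / δ)) (B / δ) → (ξ * t, t) ∉ box δ B := fun ξ h =>
    hξ ξ t fun h' => h (abs_le.1 h'.1)
  have hψc : HasCompactSupport ψ :=
    HasCompactSupport.intro isCompact_Icc fun ξ h => (hbox _ (hout ξ h)).1
  have hψd : ∀ ξ, deriv ψ ξ = t * fderiv ℝ φ (ξ * t, t) (1, 0) := fun ξ => by
    have h1 : HasDerivAt (fun ξ : ℝ => (ξ * t, t)) (t • (1, 0)) ξ := by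
      simpa using ((hasDerivAt_id ξ).mul_const t).prodMk (hasDerivAt_const ξ t)
    have h2 := HasFDerivAt.comp_hasDerivAt (l := φ) (f := fun ξ : ℝ => (ξ * t, t)) ξ
      ((hφ.smooth.differentiable (by simp)) (ξ * t, t)).hasFDerivAt h1
    rw [map_smul, smul_eq_mul] at h2
    exact h2.deriv
  have hle := hP.integral_le hG hGm hk hψs hψc fun ξ => hφ.nonneg _
  have i1 : Integrable fun ξ => |U ξ - k| * ψ ξ :=
    (hP.locallyIntegrable_entropy hk).integrable_smul_right_of_hasCompactSupport hψs.continuous hψc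
  have i2 : Integrable fun ξ => (kq G (U ξ) k - ξ * |U ξ - k|) * deriv ψ ξ :=
    (hP.locallyIntegrable_flux hG hGm hk).integrable_smul_right_of_hasCompactSupport
      (hψs.continuous_deriv le_rfl) hψc.deriv
  have i3 : Integrable fun ξ => |U ξ - k| * g ξ t := by
    refine (hP.locallyIntegrable_entropy hk).integrable_smul_right_of_hasCompactSupport
      (hgc.comp (by fun_prop : Continuous fun ξ : ℝ => (ξ, t)))
      (HasCompactSupport.intro (isCompact_Icc (a := -(B / δ)) (b := B / δ)) fun ξ h => ?_)
    have h := hbox _ (hout ξ h)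
    simp [hg, h.1, h.2]
  have hcv : ∫ x, F (x, t) = t * ∫ ξ, F (ξ * t, t) := by
    rw [Measure.integral_comp_mul_right (fun x => F (x, t)) t, smul_eq_mul, ← mul_assoc,
      abs_of_pos (inv_pos.2 ht0), mul_inv_cancel₀ ht0.ne', one_mul]
  have hsplit : (fun ξ => t * F (ξ * t, t)) = fun ξ => |U ξ - k| * g ξ t +
      ((kq G (U ξ) k - ξ * |U ξ - k|) * deriv ψ ξ - |U ξ - k| * ψ ξ) := by
    ext ξ
    rw [hψd]
    simp only [hF, hg, hψ, fderiv_slope_one _ ξ, mul_div_cancel_right₀ ξ ht0.ne']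
    ring
  have i4 : Integrable fun ξ => (kq G (U ξ) k - ξ * |U ξ - k|) * deriv ψ ξ - |U ξ - k| * ψ ξ :=
    i2.sub i1
  rw [hcv, ← integral_const_mul, hsplit, integral_add i3 i4, integral_sub i2 i1]
  linarith

lemma step_eq_profile (hP : Profile G U uL uR) : ∃ M, 0 < M ∧ ∀ t, 0 < t → ∀ x,
    x ∉ Icc (-(M * t)) (M * t) → U (x / t) = step uL uR x := by
  obtain ⟨M, hM, h1, h2⟩ := hP.bound
  refine ⟨M, hM, fun t ht x hx => ?_⟩
  rw [mem_Icc, not_and_or, not_le, not_le] at hx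
  have hMt := mul_pos hM ht
  rcases hx with hx | hx
  · rw [h1 _ ((div_le_iff₀ ht).2 (by linarith)), step, if_pos (by linarith)]
  · rw [h2 _ ((le_div_iff₀ ht).2 (by linarith)), step, if_neg (by linarith)]

lemma step_mem (hP : Profile G U uL uR) (x : ℝ) : step uL uR x ∈ Icc (-1 : ℝ) 1 := by
  obtain ⟨M, hM, hl, hr⟩ := hP.bound
  unfold step
  split_ifs
  · rw [← hl (-M) le_rfl]; exact hP.mem _
  · rw [← hr M le_rfl]; exact hP.mem _

theorem Profile.isEntropySolution (hP : Profile G U uL uR) (hG : LipOn G L) (hGm : Measurable G) :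
    IsEntropySolution G (step uL uR) fun x t => U (x / t) where
  aemeasurable := (hP.measurable.comp (measurable_fst.div measurable_snd)).aemeasurable
  mem_Icc := Eventually.of_forall fun p => hP.mem _
  entropy k hk φ h1 h2 h3 h4 := hP.entropy hG hGm hk ⟨h1, h2, h3, h4⟩
  initial R hR := by
    obtain ⟨M, hM, h⟩ := step_eq_profile hP
    -- The convergence holds along all times, so no null set needs to be removed: `U (x / t)`
    -- differs from the datum only for `|x| ≤ M t`, and by at most `2`.
    refine Tendsto.mono_left ?_ inf_le_left
    have hz : Tendsto (fun t : ℝ => 2 * (2 * (M * t))) (𝓝[>] 0) (𝓝 0) := by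
      have : Continuous fun t : ℝ => 2 * (2 * (M * t)) := by fun_prop
      simpa using (this.tendsto 0).mono_left nhdsWithin_le_nhds
    refine tendsto_of_tendsto_of_tendsto_of_le_of_le' tendsto_const_nhds hz
      (Eventually.of_forall fun t => integral_nonneg fun x => abs_nonneg _)
      (eventually_nhdsWithin_of_forall fun t (ht : 0 < t) => ?_)
    have hMt := mul_pos hM ht
    calc ∫ x in Icc (-R) R, |U (x / t) - step uL uR x|
        ≤ ∫ x in Icc (-R) R, (Icc (-(M * t)) (M * t)).indicator (fun _ => (2 : ℝ)) x := by
          refine integral_mono_of_nonneg (Eventually.of_forall fun x => abs_nonneg _) ?_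
            (Eventually.of_forall fun x => ?_)
          · exact ((integrable_indicator_iff measurableSet_Icc).2
              (integrableOn_const measure_Icc_lt_top.ne)).integrableOn
          · by_cases hx : x ∈ Icc (-(M * t)) (M * t)
            · simpa only [indicator_of_mem hx] using abs_sub_le_two (hP.mem _) (step_mem hP x)
            · simp [hx, h t ht x hx]
      _ ≤ ∫ x, (Icc (-(M * t)) (M * t)).indicator (fun _ => (2 : ℝ)) x :=
          setIntegral_le_integral ((integrable_indicator_iff measurableSet_Icc).2
              (integrableOn_const measure_Icc_lt_top.ne))
            (Eventually.of_forall fun x => indicator_nonneg (fun _ _ => by norm_num) x)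
      _ = 2 * (2 * (M * t)) := by
          rw [integral_indicator measurableSet_Icc, setIntegral_const, smul_eq_mul,
            Measure.real, Real.volume_Icc, ENNReal.toReal_ofReal (by linarith)]
          ring

end

end RiemannPhase

namespace RiemannPhase

/-! ### Comparison with a self-similar profile -/

lemma exists_mollifier : ∃ ρ : ℝ → ℝ, ContDiff ℝ ∞ ρ ∧ (∀ s, 0 ≤ ρ s) ∧ 0 < ∫ s, ρ s ∧
    ∃ A C : ℝ, 0 < A ∧ 0 ≤ C ∧ (∀ s, s ∉ Icc (-A) A → ρ s = 0 ∧ deriv ρ s = 0) ∧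
      ∀ s, |ρ s| ≤ C ∧ |deriv ρ s| ≤ C := by
  let f : ContDiffBump (0 : ℝ) := ⟨1, 2, one_pos, one_lt_two⟩
  have hs : ContDiff ℝ ∞ f := f.contDiff
  obtain ⟨C₁, h1⟩ := f.hasCompactSupport.exists_bound_of_continuous hs.continuous
  obtain ⟨C₂, h2⟩ := f.hasCompactSupport.deriv.exists_bound_of_continuous
    (hs.continuous_deriv (by simp))
  refine ⟨f, hs, fun s => f.nonneg, f.integral_pos, 2, max 0 (max C₁ C₂), two_pos, by simp,
    fun s h => ?_, fun s => ⟨(h1 s).trans (by simp), (h2 s).trans (by simp)⟩⟩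
  have h' : s ∉ tsupport f := by
    rw [f.tsupport_eq, Real.closedBall_eq_Icc]
    simpa using h
  refine ⟨image_eq_zero_of_notMem_tsupport h', ?_⟩
  by_contra hne
  exact h' (support_deriv_subset (Function.mem_support.2 hne))

lemma hasDerivAt_fst {f : ℝ × ℝ → ℝ} {x t : ℝ} (hf : DifferentiableAt ℝ f (x, t)) :
    HasDerivAt (fun x => f (x, t)) (fderiv ℝ f (x, t) (1, 0)) x := by
  have h1 : HasDerivAt (fun x : ℝ => (x, t)) (1, 0) x :=
    (hasDerivAt_id x).prodMk (hasDerivAt_const x t)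
  exact HasFDerivAt.comp_hasDerivAt (l := f) (f := fun x : ℝ => (x, t)) x hf.hasFDerivAt h1

lemma hasDerivAt_snd {f : ℝ × ℝ → ℝ} {x t : ℝ} (hf : DifferentiableAt ℝ f (x, t)) :
    HasDerivAt (fun t => f (x, t)) (fderiv ℝ f (x, t) (0, 1)) t := by
  have h1 : HasDerivAt (fun t : ℝ => (x, t)) (0, 1) t :=
    (hasDerivAt_const t x).prodMk (hasDerivAt_id t)
  exact HasFDerivAt.comp_hasDerivAt (l := f) (f := fun t : ℝ => (x, t)) t hf.hasFDerivAt h1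

section

variable {G U : ℝ → ℝ} {uL uR L : ℝ} {φ : ℝ × ℝ → ℝ} {ρ : ℝ → ℝ}

/-- Localization of a test function along the ray `x / t = η`. -/
lemma IsTest.localize (hφ : IsTest φ) (hρ : ContDiff ℝ ∞ ρ) (hρ0 : ∀ s, 0 ≤ ρ s) (η ε : ℝ) :
    IsTest fun p => φ p * ρ ((p.1 / p.2 - η) / ε) where
  smooth := by
    refine contDiff_iff_contDiffAt.2 fun p => ?_
    by_cases hp : p ∈ tsupport φ
    · have h0 : p.2 ≠ 0 := (hφ.sub hp).ne'
      have h1 : ContDiffAt ℝ ∞ (fun p : ℝ × ℝ => (p.1 / p.2 - η) / ε) p :=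
        ((contDiffAt_fst.div contDiffAt_snd h0).sub contDiffAt_const).div_const ε
      exact hφ.smooth.contDiffAt.mul (hρ.contDiffAt.comp p h1)
    · have h1 : (fun p => φ p * ρ ((p.1 / p.2 - η) / ε)) =ᶠ[𝓝 p] fun _ => 0 := by
        filter_upwards [notMem_tsupport_iff_eventuallyEq.1 hp] with q hq
        simp [hq]
      exact contDiffAt_const.congr_of_eventuallyEq h1
  compact := hφ.compact.mul_right
  sub := (tsupport_mul_subset_left).trans hφ.sub
  nonneg p := mul_nonneg (hφ.nonneg p) (hρ0 _)

lemma IsTest.fderiv_localize (hφ : IsTest φ) (hρ : ContDiff ℝ ∞ ρ) (hρ0 : ∀ s, 0 ≤ ρ s)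
    (η : ℝ) {ε x t : ℝ} (ht : 0 < t) :
    fderiv ℝ (fun p : ℝ × ℝ => φ p * ρ ((p.1 / p.2 - η) / ε)) (x, t) (1, 0) =
        fderiv ℝ φ (x, t) (1, 0) * ρ ((x / t - η) / ε) +
          φ (x, t) * (deriv ρ ((x / t - η) / ε) * (1 / t / ε)) ∧
      fderiv ℝ (fun p : ℝ × ℝ => φ p * ρ ((p.1 / p.2 - η) / ε)) (x, t) (0, 1) =
        fderiv ℝ φ (x, t) (0, 1) * ρ ((x / t - η) / ε) +
          φ (x, t) * (deriv ρ ((x / t - η) / ε) * (-(x / t) / t / ε)) := by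
  have hd := ((hφ.localize hρ hρ0 η ε).smooth.differentiable (by simp)) (x, t)
  have hφd := (hφ.smooth.differentiable (by simp)) (x, t)
  have hρd := fun s => ((hρ.differentiable (by simp)) s).hasDerivAt
  constructor
  · refine (hasDerivAt_fst hd).unique ((hasDerivAt_fst hφd).mul ?_)
    exact (hρd _).comp x ((((hasDerivAt_id x).div_const t).sub_const η).div_const ε)
  · refine (hasDerivAt_snd hd).unique ((hasDerivAt_snd hφd).mul ?_)
    have h1 : HasDerivAt (fun t => x / t) (-(x / t) / t) t := by
      have := (hasDerivAt_inv ht.ne').const_mul x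
      refine (this.congr_deriv ?_)
      field_simp
    exact (hρd _).comp t ((h1.sub_const η).div_const ε)

/-- One fiber of the comparison: `k` is the value of the other solution, `ξ = x / t`. -/
lemma Profile.fiber_le (hP : Profile G U uL uR) (hG : LipOn G L) (hGm : Measurable G)
    (hρ : ContDiff ℝ ∞ ρ) (hρ0 : ∀ s, 0 ≤ ρ s) (hρc : HasCompactSupport ρ) {k : ℝ}
    (hk : k ∈ Icc (-1 : ℝ) 1) {ε t : ℝ} (hε : 0 < ε) (ht : 0 < t) (ξ : ℝ) {f ft fx : ℝ}
    (hf : 0 ≤ f) :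
    ∫ η, (|k - U η| * (ft * ρ ((ξ - η) / ε) + f * (deriv ρ ((ξ - η) / ε) * (-ξ / t / ε))) +
        kq G k (U η) * (fx * ρ ((ξ - η) / ε) + f * (deriv ρ ((ξ - η) / ε) * (1 / t / ε)))) ≤
      ε * ∫ s, ((|k - U (ξ - ε * s)| * ft + kq G k (U (ξ - ε * s)) * fx) * ρ s -
        f / t * |k - U (ξ - ε * s)| * (ρ s + s * deriv ρ s)) := by
  set ψ : ℝ → ℝ := fun η => ρ ((ξ - η) / ε) with hψ
  have hlin : ContDiff ℝ ∞ fun η : ℝ => (ξ - η) / ε :=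
    (contDiff_const.sub contDiff_id).div_const ε
  have hψs : ContDiff ℝ 1 ψ := (hρ.comp hlin).of_le (by simp)
  have hcomp : ∀ {r : ℝ → ℝ}, HasCompactSupport r → HasCompactSupport fun η => r ((ξ - η) / ε) := by
    intro r hr
    have := hr.comp_homeomorph ((Homeomorph.subLeft ξ).trans
      (Homeomorph.mulRight₀ ε⁻¹ (inv_ne_zero hε.ne')))
    simpa [Function.comp_def, div_eq_mul_inv] using this
  have hψc : HasCompactSupport ψ := hcomp hρc
  have hψd : ∀ η, deriv ψ η = -(deriv ρ ((ξ - η) / ε) / ε) := fun η => by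
    have h1 : HasDerivAt (fun η : ℝ => (ξ - η) / ε) (-1 / ε) η :=
      ((hasDerivAt_id η).const_sub ξ).div_const ε
    have h2 := ((hρ.differentiable (by simp)) ((ξ - η) / ε)).hasDerivAt.comp η h1
    exact (h2.congr_deriv (by ring)).deriv
  have hle := hP.integral_le hG hGm hk hψs hψc fun η => hρ0 _
  have hEi := hP.locallyIntegrable_entropy hk
  have hZi := hP.locallyIntegrable_flux hG hGm hk
  have i1 : Integrable fun η => |U η - k| * ψ η :=
    hEi.integrable_smul_right_of_hasCompactSupport hψs.continuous hψc
  have i2 : Integrable fun η => (kq G (U η) k - η * |U η - k|) * deriv ψ η :=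
    hZi.integrable_smul_right_of_hasCompactSupport (hψs.continuous_deriv le_rfl) hψc.deriv
  have i3 : Integrable fun η => |U η - k| * (η * ψ η) :=
    hEi.integrable_smul_right_of_hasCompactSupport (continuous_id.mul hψs.continuous) hψc.mul_left
  have i4 : Integrable fun η => (kq G (U η) k - η * |U η - k|) * ψ η :=
    hZi.integrable_smul_right_of_hasCompactSupport hψs.continuous hψc
  have i5 : Integrable fun η => |U η - k| * ((ξ - η) * deriv ψ η) :=
    hEi.integrable_smul_right_of_hasCompactSupport
      ((continuous_const.sub continuous_id).mul (hψs.continuous_deriv le_rfl)) hψc.deriv.mul_left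
  set h : ℝ → ℝ := fun η => (|k - U η| * ft + kq G k (U η) * fx) * ψ η -
    f / t * |k - U η| * (ψ η - (ξ - η) * deriv ψ η) with hh
  have ih : Integrable h := by
    have e : h = fun η => ft * (|U η - k| * ψ η) + (fx * ((kq G (U η) k - η * |U η - k|) * ψ η) +
        fx * (|U η - k| * (η * ψ η))) - (f / t * (|U η - k| * ψ η) -
          f / t * (|U η - k| * ((ξ - η) * deriv ψ η))) := by
      ext η
      simp only [hh, abs_sub_comm k, kq_comm G k]
      ring
    rw [e]
    exact ((i1.const_mul _).add ((i4.const_mul _).add (i3.const_mul _))).sub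
      ((i1.const_mul _).sub (i5.const_mul _))
  have i6 : Integrable fun η => |U η - k| * ψ η - (kq G (U η) k - η * |U η - k|) * deriv ψ η :=
    i1.sub i2
  have hcv : ε * ∫ s, h (ξ - ε * s) = ∫ η, h η := by
    rw [Measure.integral_comp_mul_left (fun y => h (ξ - y)) ε, smul_eq_mul, ← mul_assoc,
      abs_of_pos (inv_pos.2 hε), mul_inv_cancel₀ hε.ne', one_mul, integral_sub_left_eq_self]
  have e1 : ∀ s, h (ξ - ε * s) = (|k - U (ξ - ε * s)| * ft + kq G k (U (ξ - ε * s)) * fx) * ρ s -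
        f / t * |k - U (ξ - ε * s)| * (ρ s + s * deriv ρ s) := fun s => by
    have e2 : (ξ - (ξ - ε * s)) / ε = s := by field_simp; ring
    simp only [hh]
    rw [hψd]
    simp only [hψ, e2]
    field_simp
    ring
  simp only [← e1]
  rw [hcv]
  -- The terms in `deriv ρ` carry `kq - ξ |k - U η|`, which is the flux `kq - η |k - U η|` of the
  -- one-variable inequality minus `(ξ - η) |k - U η|`. The last piece is harmless because `ξ - η`
  -- is of order `ε` on the support; adding and subtracting `|U η - k| ψ` completes the inequality.
  have e3 : ∀ η, |k - U η| * (ft * ρ ((ξ - η) / ε) + f * (deriv ρ ((ξ - η) / ε) * (-ξ / t / ε))) +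
      kq G k (U η) * (fx * ρ ((ξ - η) / ε) + f * (deriv ρ ((ξ - η) / ε) * (1 / t / ε))) =
      h η + f / t * (|U η - k| * ψ η - (kq G (U η) k - η * |U η - k|) * deriv ψ η) := fun η => by
    have e4 : deriv ρ ((ξ - η) / ε) = -(ε * deriv ψ η) := by
      rw [hψd]; field_simp
    simp only [e4, hh, abs_sub_comm k, kq_comm G k, hψ]
    field_simp
    ring
  simp only [e3]
  rw [integral_add ih (i6.const_mul _), integral_const_mul, integral_sub i1 i2]
  have : f / t * ((∫ η, |U η - k| * ψ η) - ∫ η, (kq G (U η) k - η * |U η - k|) * deriv ψ η) ≤ 0 :=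
    mul_nonpos_of_nonneg_of_nonpos (div_nonneg hf ht.le) (by linarith)
  linarith

/-- Bad speeds are countable, and for `x ≠ 0` the map `t ↦ x / t` is injective, so almost every
vertical slice of their preimage is countable. -/
lemma Profile.ae_continuousAt_div (hP : Profile G U uL uR) :
    ∀ᵐ p : ℝ × ℝ ∂(volume.restrict upperHalf), ContinuousAt U (p.1 / p.2) := by
  have hN : {ξ | ¬ContinuousAt U ξ}.Countable :=
    hP.mono.elim (fun h => h.countable_not_continuousAt) (fun h => h.countable_not_continuousAt)
  have hm : MeasurableSet {p : ℝ × ℝ | p.1 / p.2 ∈ {ξ | ¬ContinuousAt U ξ}} :=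
    (measurable_fst.div measurable_snd) hN.measurableSet
  have h0 : volume {p : ℝ × ℝ | p.1 / p.2 ∈ {ξ | ¬ContinuousAt U ξ}} = 0 := by
    rw [Measure.volume_eq_prod, Measure.measure_prod_null hm]
    have h1 : ∀ᵐ x : ℝ, x ≠ 0 := by simp [ae_iff]
    filter_upwards [h1] with x hx
    refine (hN.preimage_of_injOn (f := fun t => x / t) fun s _ t _ h => ?_).measure_zero volume
    simpa [div_eq_mul_inv, hx] using h
  refine ae_restrict_of_ae ?_
  rw [ae_iff]
  exact h0

lemma abs_mul_le_of_le {a b A B : ℝ} (ha : |a| ≤ A) (hb : |b| ≤ B) : |a * b| ≤ A * B := by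
  rw [abs_mul]
  exact mul_le_mul ha hb (abs_nonneg b) ((abs_nonneg a).trans ha)

lemma measurableSet_upperHalf : MeasurableSet upperHalf :=
  measurableSet_lt measurable_const measurable_snd

/-- Doubling of variables against a self-similar profile. -/
theorem Profile.kato (hP : Profile G U uL uR) (hG : LipOn G L) (hGm : Measurable G)
    {w : ℝ × ℝ → ℝ} (hw : Measurable w) (hwm : ∀ p, w p ∈ Icc (-1 : ℝ) 1)
    (hent : ∀ k ∈ Icc (-1 : ℝ) 1, ∀ φ, IsTest φ → 0 ≤ ∫ p in upperHalf,
      (|w p - k| * fderiv ℝ φ p (0, 1) + kq G (w p) k * fderiv ℝ φ p (1, 0))) (hφ : IsTest φ) :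
    0 ≤ ∫ p in upperHalf, (|w p - U (p.1 / p.2)| * fderiv ℝ φ p (0, 1)
      + kq G (w p) (U (p.1 / p.2)) * fderiv ℝ φ p (1, 0)) := by
  obtain ⟨δ, B, C, hδ, hB, hC, hbox, hbd⟩ := hφ.exists_bounds
  obtain ⟨ρ, hρ, hρ0, hρi, A, D, hA, hD, hρA, hρD⟩ := exists_mollifier
  have hL := hG.nonneg
  have hUm := hP.measurable
  have hφm : Measurable φ := hφ.smooth.continuous.measurable
  have hdc : Continuous (fderiv ℝ φ) := hφ.smooth.continuous_fderiv (by simp)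
  set ft : ℝ × ℝ → ℝ := fun p => fderiv ℝ φ p (0, 1) with hft
  set fx : ℝ × ℝ → ℝ := fun p => fderiv ℝ φ p (1, 0) with hfx
  have hftm : Measurable ft := (hdc.clm_apply continuous_const).measurable
  have hfxm : Measurable fx := (hdc.clm_apply continuous_const).measurable
  have hρm : Measurable ρ := hρ.continuous.measurable
  have hρc : HasCompactSupport ρ := HasCompactSupport.intro isCompact_Icc fun s h => (hρA s h).1
  have hρdc : Continuous (deriv ρ) := hρ.continuous_deriv (by simp)
  have hρdm : Measurable (deriv ρ) := hρdc.measurable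
  have hft0 : ∀ p, p ∉ box δ B → φ p = 0 ∧ ft p = 0 ∧ fx p = 0 := fun p hp => by
    simp [hft, hfx, hbox p hp]
  have hftC : ∀ p, |ft p| ≤ C ∧ |fx p| ≤ C := fun p =>
    ⟨(abs_apply_le _).2.trans (hbd p).2, (abs_apply_le _).1.trans (hbd p).2⟩
  set μ : Measure (ℝ × ℝ) := volume.restrict upperHalf with hμ
  have hq2 : ∀ p η, |w p - U η| ≤ 2 ∧ |kq G (w p) (U η)| ≤ 2 * L := fun p η =>
    ⟨abs_sub_le_two (hwm p) (hP.mem η), abs_kq_le_two hG (hwm p) (hP.mem η)⟩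
  -- the integrand in `(p, η)`
  set T : ℝ → (ℝ × ℝ) × ℝ → ℝ := fun ε q =>
    |w q.1 - U q.2| * (ft q.1 * ρ ((q.1.1 / q.1.2 - q.2) / ε) + φ q.1 *
      (deriv ρ ((q.1.1 / q.1.2 - q.2) / ε) * (-(q.1.1 / q.1.2) / q.1.2 / ε))) +
    kq G (w q.1) (U q.2) * (fx q.1 * ρ ((q.1.1 / q.1.2 - q.2) / ε) + φ q.1 *
      (deriv ρ ((q.1.1 / q.1.2 - q.2) / ε) * (1 / q.1.2 / ε))) with hT
  have hTi : ∀ ε, 0 < ε → Integrable (T ε) (μ.prod volume) := by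
    intro ε hε
    have hQm : Measurable fun q : (ℝ × ℝ) × ℝ => kq G (w q.1) (U q.2) :=
      (RiemannPhase.measurable_kq hGm).comp
        ((hw.comp measurable_fst).prodMk (hUm.comp measurable_snd))
    have hTm : Measurable (T ε) := by
      simp only [hT]
      fun_prop
    refine integrable_of_compact (K := box δ B ×ˢ Icc (-(B / δ + ε * A)) (B / δ + ε * A))
      (C := 2 * (C * D + C * (D * (B / δ / δ / ε))) + 2 * L * (C * D + C * (D * (1 / δ / ε))))
      hTm.aestronglyMeasurable ((isCompact_box δ B).prod isCompact_Icc)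
      ((isCompact_box δ B).measurableSet.prod measurableSet_Icc) ?_ ?_
    · rintro ⟨⟨x, t⟩, η⟩ ⟨hp, -⟩
      obtain ⟨h1, h2, h3⟩ := mem_box.1 hp
      simp only at h1 h2 h3
      have ht : 0 < t := hδ.trans_le h2
      have hb1 : |-(x / t) / t / ε| ≤ B / δ / δ / ε := by
        rw [abs_div, abs_div, abs_neg, abs_div, abs_of_pos ht, abs_of_pos hε]
        gcongr
      have hb2 : |1 / t / ε| ≤ 1 / δ / ε := by
        rw [abs_of_pos (by positivity)]
        gcongr
      refine (abs_add_le _ _).trans (add_le_add (abs_mul_le_of_le ?_ ?_) (abs_mul_le_of_le ?_ ?_))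
      · rw [abs_abs]; exact (hq2 _ _).1
      · exact (abs_add_le _ _).trans (add_le_add (abs_mul_le_of_le (hftC _).1 (hρD _).1)
          (abs_mul_le_of_le (hbd _).1 (abs_mul_le_of_le (hρD _).2 hb1)))
      · exact (hq2 _ _).2
      · exact (abs_add_le _ _).trans (add_le_add (abs_mul_le_of_le (hftC _).2 (hρD _).1)
          (abs_mul_le_of_le (hbd _).1 (abs_mul_le_of_le (hρD _).2 hb2)))
    · rintro ⟨⟨x, t⟩, η⟩ hq
      by_cases hp : (x, t) ∈ box δ B
      · obtain ⟨h1, h2, h3⟩ := mem_box.1 hp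
        simp only at h1 h2 h3
        have ht : 0 < t := hδ.trans_le h2
        have hs : (x / t - η) / ε ∉ Icc (-A) A := by
          intro hs
          refine hq ⟨hp, abs_le.1 ?_⟩
          have hs := abs_le.2 hs
          rw [abs_div, abs_of_pos hε, div_le_iff₀ hε] at hs
          simp only
          have h4 : |x / t| ≤ B / δ := by
            rw [abs_div, abs_of_pos ht]
            gcongr
          have h5 : |η| ≤ |x / t| + |x / t - η| := by
            have := abs_sub (x / t) (x / t - η)
            simpa using this
          linarith
        have h := hρA _ hs
        simp only [hT, h.1, h.2]
        ring
      · have h := hft0 _ hp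
        simp only [hT, h.1, h.2.1, h.2.2]
        ring
  -- the rescaled integrand in `(p, s)`
  set H : ℝ → (ℝ × ℝ) × ℝ → ℝ := fun ε q =>
    (|w q.1 - U (q.1.1 / q.1.2 - ε * q.2)| * ft q.1 +
      kq G (w q.1) (U (q.1.1 / q.1.2 - ε * q.2)) * fx q.1) * ρ q.2 -
    φ q.1 / q.1.2 * |w q.1 - U (q.1.1 / q.1.2 - ε * q.2)| * (ρ q.2 + q.2 * deriv ρ q.2) with hH
  have hHm : ∀ ε, Measurable (H ε) := by
    intro ε
    have hU2 : Measurable fun q : (ℝ × ℝ) × ℝ => U (q.1.1 / q.1.2 - ε * q.2) :=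
      hUm.comp (by fun_prop)
    have hQm : Measurable fun q : (ℝ × ℝ) × ℝ => kq G (w q.1) (U (q.1.1 / q.1.2 - ε * q.2)) :=
      (RiemannPhase.measurable_kq hGm).comp ((hw.comp measurable_fst).prodMk hU2)
    simp only [hH]
    fun_prop
  set K : Set ((ℝ × ℝ) × ℝ) := box δ B ×ˢ Icc (-A) A with hK
  have hKc : IsCompact K := (isCompact_box δ B).prod isCompact_Icc
  have hKm : MeasurableSet K := (isCompact_box δ B).measurableSet.prod measurableSet_Icc
  set M : ℝ := (2 * C + 2 * L * C) * D + C / δ * 2 * (D + A * D) with hM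
  have hHM : ∀ ε, ∀ q ∈ K, |H ε q| ≤ M := by
    rintro ε ⟨⟨x, t⟩, s⟩ ⟨hp, hs⟩
    obtain ⟨h1, h2, h3⟩ := mem_box.1 hp
    simp only at h1 h2 h3
    have ht : 0 < t := hδ.trans_le h2
    have hb : |φ (x, t) / t| ≤ C / δ := by
      rw [abs_div, abs_of_pos ht]
      gcongr
      exact (hbd _).1
    refine (abs_sub _ _).trans (add_le_add (abs_mul_le_of_le ?_ (hρD _).1)
      (abs_mul_le_of_le (abs_mul_le_of_le hb ?_) ?_))
    · refine (abs_add_le _ _).trans (add_le_add (abs_mul_le_of_le ?_ (hftC _).1)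
        (abs_mul_le_of_le (hq2 _ _).2 (hftC _).2))
      rw [abs_abs]; exact (hq2 _ _).1
    · rw [abs_abs]; exact (hq2 _ _).1
    · exact (abs_add_le _ _).trans (add_le_add (hρD _).1
        (abs_mul_le_of_le (abs_le.2 hs) (hρD _).2))
  have hH0 : ∀ ε, ∀ q, q ∉ K → H ε q = 0 := by
    rintro ε ⟨p, s⟩ hq
    by_cases hp : p ∈ box δ B
    · have h := hρA s fun hs => hq ⟨hp, hs⟩
      simp only [hH, h.1, h.2]
      ring
    · have h := hft0 p hp
      simp only [hH, h.1, h.2.1, h.2.2]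
      ring
  have hHi : ∀ ε, Integrable (H ε) (μ.prod volume) := fun ε =>
    integrable_of_compact (hHm ε).aestronglyMeasurable hKc hKm (hHM ε) (hH0 ε)
  -- Integrating over the point first uses the entropy inequality of `w` with `k = U η`; integrating
  -- over `η` first uses that of the profile and rescales. The factor `ε` of the rescaling is
  -- positive and can be divided out.
  have hpos : ∀ ε, 0 < ε → 0 ≤ ∫ q, H ε q ∂(μ.prod volume) := by
    intro ε hε
    have h1 : 0 ≤ ∫ q, T ε q ∂(μ.prod volume) := by
      rw [integral_prod_symm _ (hTi ε hε)]
      refine integral_nonneg fun η => ?_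
      refine (hent (U η) (hP.mem η) _ (hφ.localize hρ hρ0 η ε)).trans_eq ?_
      refine setIntegral_congr_fun measurableSet_upperHalf fun p hp => ?_
      obtain ⟨x, t⟩ := p
      have h := hφ.fderiv_localize (ε := ε) (x := x) hρ hρ0 η hp
      simp only [h.1, h.2, hT, hft, hfx]
    have h2 : ∫ q, T ε q ∂(μ.prod volume) ≤ ε * ∫ q, H ε q ∂(μ.prod volume) := by
      rw [integral_prod _ (hTi ε hε), integral_prod _ (hHi ε), ← integral_const_mul]
      refine setIntegral_mono_on (hTi ε hε).integral_prod_left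
        ((hHi ε).integral_prod_left.const_mul ε) measurableSet_upperHalf fun p hp => ?_
      exact hP.fiber_le hG hGm hρ hρ0 hρc (hwm p) hε hp (p.1 / p.2)
        (ft := ft p) (fx := fx p) (hφ.nonneg p)
    exact nonneg_of_mul_nonneg_right (h1.trans h2) hε
  have hlim : Tendsto (fun ε => ∫ q, H ε q ∂(μ.prod volume)) (𝓝[>] 0)
      (𝓝 (∫ q, H 0 q ∂(μ.prod volume))) := by
    refine tendsto_integral_filter_of_dominated_convergence (K.indicator fun _ => M)
      (Eventually.of_forall fun ε => (hHm ε).aestronglyMeasurable)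
      (Eventually.of_forall fun ε => Eventually.of_forall fun q => ?_)
      ((integrable_indicator_iff hKm).2 (integrableOn_const hKc.measure_lt_top.ne)) ?_
    · by_cases hq : q ∈ K
      · simpa [hq] using hHM ε q hq
      · simp [hq, hH0 ε q hq]
    · have hae := Measure.quasiMeasurePreserving_fst (μ := μ) (ν := (volume : Measure ℝ)) |>.ae
        hP.ae_continuousAt_div
      filter_upwards [hae] with q hq
      have h1 : Tendsto (fun ε : ℝ => q.1.1 / q.1.2 - ε * q.2) (𝓝[>] 0) (𝓝 (q.1.1 / q.1.2)) := by
        have : Continuous fun ε : ℝ => q.1.1 / q.1.2 - ε * q.2 := by fun_prop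
        simpa using (this.tendsto 0).mono_left nhdsWithin_le_nhds
      have h2 : Tendsto (fun ε : ℝ => U (q.1.1 / q.1.2 - ε * q.2)) (𝓝[>] 0)
          (𝓝 (U (q.1.1 / q.1.2))) := hq.tendsto.comp h1
      have h3 : Tendsto (fun ε : ℝ => |w q.1 - U (q.1.1 / q.1.2 - ε * q.2)|) (𝓝[>] 0)
          (𝓝 |w q.1 - U (q.1.1 / q.1.2)|) := (h2.const_sub _).abs
      have h4 : Tendsto (fun ε : ℝ => kq G (w q.1) (U (q.1.1 / q.1.2 - ε * q.2))) (𝓝[>] 0)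
          (𝓝 (kq G (w q.1) (U (q.1.1 / q.1.2)))) := by
        rw [tendsto_iff_norm_sub_tendsto_zero]
        have h5 : Tendsto (fun ε : ℝ => L * |U (q.1.1 / q.1.2 - ε * q.2) - U (q.1.1 / q.1.2)|)
            (𝓝[>] 0) (𝓝 0) := by
          simpa using ((h2.sub_const (U (q.1.1 / q.1.2))).abs.const_mul L)
        exact squeeze_zero (fun ε => norm_nonneg _)
          (fun ε => abs_kq_sub_le hG (hwm _) (hP.mem _) (hP.mem _)) h5
      simp only [hH, zero_mul, sub_zero]
      exact (((h3.mul_const _).add (h4.mul_const _)).mul_const _).sub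
        ((h3.const_mul _).mul_const _)
  have hfin : 0 ≤ ∫ q, H 0 q ∂(μ.prod volume) :=
    ge_of_tendsto hlim (eventually_nhdsWithin_of_forall fun ε hε => hpos ε hε)
  -- The integrand is `(s ρ)'`. In the limit `ε = 0` its coefficient no longer depends on `s`, so
  -- the term containing `φ / t` disappears.
  have hΘ : ∫ s, (ρ s + s * deriv ρ s) = 0 := by
    refine integral_eq_zero_of_hasDerivAt_of_integrable (f := fun s => s * ρ s)
      (fun s => ?_) ?_ ?_
    · exact ((hasDerivAt_id s).mul ((hρ.differentiable (by simp)) s).hasDerivAt).congr_deriv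
        (by simp)
    · exact (hρ.continuous.add (continuous_id.mul hρdc)).integrable_of_hasCompactSupport
        (hρc.add hρc.deriv.mul_left)
    · exact (continuous_id.mul hρ.continuous).integrable_of_hasCompactSupport hρc.mul_left
  have iρ : Integrable ρ := hρ.continuous.integrable_of_hasCompactSupport hρc
  have iΘ : Integrable fun s => ρ s + s * deriv ρ s :=
    (hρ.continuous.add (continuous_id.mul hρdc)).integrable_of_hasCompactSupport
        (hρc.add hρc.deriv.mul_left)
  rw [integral_prod _ (hHi 0)] at hfin
  have hin : ∀ p, ∫ s, H 0 (p, s) = (∫ s, ρ s) * (|w p - U (p.1 / p.2)| * ft p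
      + kq G (w p) (U (p.1 / p.2)) * fx p) := by
    intro p
    simp only [hH, zero_mul, sub_zero]
    rw [integral_sub (iρ.const_mul _) (iΘ.const_mul _), integral_const_mul, integral_const_mul, hΘ]
    ring
  simp only [hin] at hfin
  rw [integral_const_mul] at hfin
  exact nonneg_of_mul_nonneg_right hfin hρi

end

end RiemannPhase

namespace RiemannPhase

/-! ### Uniqueness -/

lemma exists_cutoff : ∃ χ : ℝ → ℝ, ContDiff ℝ ∞ χ ∧ (∀ s, χ s ∈ Icc (0 : ℝ) 1) ∧
    (∀ s ≤ 1, χ s = 0) ∧ (∀ s, 2 ≤ s → χ s = 1) ∧ (∀ s, s ∉ Icc (1 : ℝ) 2 → deriv χ s = 0) ∧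
    ∃ C, 0 < C ∧ ∀ s, |deriv χ s| ≤ C := by
  have hs : ContDiff ℝ ∞ fun s : ℝ => Real.smoothTransition (s - 1) :=
    Real.smoothTransition.contDiff.comp (contDiff_id.sub contDiff_const)
  have h1 : ∀ s : ℝ, s ≤ 1 → Real.smoothTransition (s - 1) = 0 := fun s h =>
    Real.smoothTransition.zero_of_nonpos (by linarith)
  have h2 : ∀ s : ℝ, 2 ≤ s → Real.smoothTransition (s - 1) = 1 := fun s h =>
    Real.smoothTransition.one_of_one_le (by linarith)
  have h3 : ∀ s, s ∉ Icc (1 : ℝ) 2 → deriv (fun s : ℝ => Real.smoothTransition (s - 1)) s = 0 := by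
    intro s h
    rw [mem_Icc, not_and_or, not_le, not_le] at h
    rcases h with h | h
    · have : (fun s : ℝ => Real.smoothTransition (s - 1)) =ᶠ[𝓝 s] fun _ => 0 := by
        filter_upwards [Iio_mem_nhds h] with r hr using h1 r (mem_Iio.1 hr).le
      rw [this.deriv_eq, deriv_const]
    · have : (fun s : ℝ => Real.smoothTransition (s - 1)) =ᶠ[𝓝 s] fun _ => 1 := by
        filter_upwards [Ioi_mem_nhds h] with r hr using h2 r (mem_Ioi.1 hr).le
      rw [this.deriv_eq, deriv_const]
  obtain ⟨C, hC⟩ := (HasCompactSupport.intro isCompact_Icc h3).exists_bound_of_continuous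
    (hs.continuous_deriv (by simp))
  exact ⟨_, hs, fun s => ⟨Real.smoothTransition.nonneg _, Real.smoothTransition.le_one _⟩,
    h1, h2, h3, max 1 C, by positivity, fun s => (hC s).trans (le_max_right _ _)⟩

/-- The derivative of `expNegInvGlue`. -/
noncomputable def glueDeriv (x : ℝ) : ℝ := x⁻¹ ^ 2 * expNegInvGlue x

lemma hasDerivAt_glue (x : ℝ) : HasDerivAt expNegInvGlue (glueDeriv x) x := by
  simpa [glueDeriv] using expNegInvGlue.hasDerivAt_polynomial_eval_inv_mul 1 x

lemma glueDeriv_nonneg (x : ℝ) : 0 ≤ glueDeriv x :=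
  mul_nonneg (sq_nonneg _) (expNegInvGlue.nonneg x)

lemma continuous_glueDeriv : Continuous glueDeriv := by
  have : glueDeriv = deriv expNegInvGlue := funext fun x => (hasDerivAt_glue x).deriv.symm
  rw [this]
  exact (expNegInvGlue.contDiff (n := 1)).continuous_deriv le_rfl

lemma expNegInvGlue_le_one (x : ℝ) : expNegInvGlue x ≤ 1 := by
  unfold expNegInvGlue
  split_ifs with h
  · exact zero_le_one
  · exact Real.exp_le_one_iff.2 (neg_nonpos.2 (inv_nonneg.2 (not_le.1 h).le))

/-- The function whose positivity set is a backward cone of propagation. -/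
noncomputable def cone (N l : ℝ) (p : ℝ × ℝ) : ℝ := N - √(1 + p.1 ^ 2) - l * p.2

lemma contDiff_cone (N l : ℝ) : ContDiff ℝ ∞ (cone N l) := by
  unfold cone
  refine (contDiff_const.sub (ContDiff.sqrt (by fun_prop) fun p => ?_)).sub (by fun_prop)
  positivity

lemma mem_box_of_cone_pos {N l δ : ℝ} (hl : 1 ≤ l) (hδ : 0 < δ) {p : ℝ × ℝ} (h : 0 < cone N l p)
    (hp : δ ≤ p.2) : p ∈ box δ N := by
  have h1 : |p.1| ≤ √(1 + p.1 ^ 2) := by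
    rw [← Real.sqrt_sq_eq_abs]
    exact Real.sqrt_le_sqrt (by linarith)
  have h2 : p.2 ≤ l * p.2 := le_mul_of_one_le_left (hδ.le.trans hp) hl
  have h3 := Real.sqrt_nonneg (1 + p.1 ^ 2)
  unfold cone at h
  exact mem_box.2 ⟨by linarith, hp, by linarith⟩

lemma hasDerivAt_cone_fst (N l x t : ℝ) :
    HasDerivAt (fun x => cone N l (x, t)) (-(x / √(1 + x ^ 2))) x := by
  have h0 : (1 + x ^ 2) ≠ 0 := by positivity
  have h1 : HasDerivAt (fun x : ℝ => 1 + x ^ 2) (2 * x) x := by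
    simpa using (hasDerivAt_pow 2 x).const_add 1
  have h2 := ((h1.sqrt h0).const_sub N).sub_const (l * t)
  refine h2.congr_deriv ?_
  field_simp

lemma hasDerivAt_cone_snd (N l x t : ℝ) : HasDerivAt (fun t => cone N l (x, t)) (-l) t := by
  have h1 := ((hasDerivAt_id t).const_mul l).const_sub (N - √(1 + x ^ 2))
  simpa [cone] using h1

lemma integrable_bdd_mul {μ : Measure (ℝ × ℝ)} [IsFiniteMeasureOnCompacts μ] {d f : ℝ × ℝ → ℝ}
    {D : ℝ} (hd : Measurable d) (hD : ∀ p, |d p| ≤ D) (hf : Continuous f)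
    (hc : HasCompactSupport f) : Integrable (fun p => d p * f p) μ := by
  refine ((hf.integrable_of_hasCompactSupport hc).abs.const_mul D).mono'
    (hd.mul hf.measurable).aestronglyMeasurable (Eventually.of_forall fun p => ?_)
  rw [Real.norm_eq_abs, abs_mul]
  exact mul_le_mul_of_nonneg_right (hD p) (abs_nonneg _)

/-! ### Energy estimate and uniqueness in backward cones -/

section

variable {G U : ℝ → ℝ} {uL uR L : ℝ} {w d q : ℝ × ℝ → ℝ} {χ : ℝ → ℝ}

lemma compactSupport_cone {l δ N : ℝ} (hl : 1 ≤ l) (hδ : 0 < δ) {r e : ℝ → ℝ}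
    (hr : ∀ s < 1, r s = 0) (he : ∀ z ≤ 0, e z = 0) :
    HasCompactSupport fun p : ℝ × ℝ => r (p.2 / δ) * e (cone N l p) := by
  refine HasCompactSupport.intro (isCompact_box δ N) fun p hp => ?_
  by_cases h1 : p.2 / δ < 1
  · simp [hr _ h1]
  · by_cases h2 : cone N l p ≤ 0
    · simp [he _ h2]
    · exact absurd (mem_box_of_cone_pos hl hδ (not_le.1 h2)
        (by rwa [not_lt, one_le_div hδ] at h1)) hp

lemma isTest_cone {l δ N : ℝ} (hl : 1 ≤ l) (hδ : 0 < δ) (hχ : ContDiff ℝ ∞ χ)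
    (hχ0 : ∀ s ≤ 1, χ s = 0) (hχm : ∀ s, 0 ≤ χ s) :
    IsTest fun p : ℝ × ℝ => χ (p.2 / δ) * expNegInvGlue (cone N l p) where
  smooth := (hχ.comp (contDiff_snd.div_const δ)).mul
    (expNegInvGlue.contDiff.comp (contDiff_cone N l))
  compact := compactSupport_cone hl hδ (fun s hs => hχ0 s hs.le)
    fun z hz => expNegInvGlue.zero_of_nonpos hz
  sub := by
    have h1 : tsupport (fun p : ℝ × ℝ => χ (p.2 / δ) * expNegInvGlue (cone N l p)) ⊆
        {p | δ ≤ p.2} := by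
      refine closure_minimal (fun p hp => ?_) (isClosed_le continuous_const continuous_snd)
      by_contra h
      refine hp ?_
      have : χ (p.2 / δ) = 0 := hχ0 _ ((div_le_one hδ).2 (not_le.1 h).le)
      simp [this]
    exact fun p hp => hδ.trans_le (h1 hp)
  nonneg p := mul_nonneg (hχm _) (expNegInvGlue.nonneg _)

/-- The energy estimate in a backward cone. -/
lemma cone_estimate (hd : Measurable d) (hd0 : ∀ p, 0 ≤ d p) (hd2 : ∀ p, d p ≤ 2)
    (hq : Measurable q) (hL : 0 ≤ L) (hqd : ∀ p, |q p| ≤ L * d p)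
    (hkato : ∀ φ, IsTest φ →
      0 ≤ ∫ p in upperHalf, (d p * fderiv ℝ φ p (0, 1) + q p * fderiv ℝ φ p (1, 0)))
    (hχ : ContDiff ℝ ∞ χ) (hχm : ∀ s, χ s ∈ Icc (0 : ℝ) 1) (hχ0 : ∀ s ≤ 1, χ s = 0)
    (hχd : ∀ s, s ∉ Icc (1 : ℝ) 2 → deriv χ s = 0) {δ : ℝ} (hδ : 0 < δ) (N : ℝ) :
    ∫ p in upperHalf, d p * (χ (p.2 / δ) * glueDeriv (cone N (L + 1) p)) ≤
      ∫ p in upperHalf, d p * (deriv χ (p.2 / δ) / δ * expNegInvGlue (cone N (L + 1) p)) := by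
  have hl : 1 ≤ L + 1 := by linarith
  have ht := isTest_cone (N := N) hl hδ hχ hχ0 fun s => (hχm s).1
  have hφd := ht.smooth.differentiable (by simp)
  have hfd : ∀ p, fderiv ℝ (fun p : ℝ × ℝ => χ (p.2 / δ) * expNegInvGlue (cone N (L + 1) p)) p
        (1, 0) = -(χ (p.2 / δ) * glueDeriv (cone N (L + 1) p) * (p.1 / √(1 + p.1 ^ 2))) ∧
      fderiv ℝ (fun p : ℝ × ℝ => χ (p.2 / δ) * expNegInvGlue (cone N (L + 1) p)) p (0, 1) =
        deriv χ (p.2 / δ) / δ * expNegInvGlue (cone N (L + 1) p) -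
          (L + 1) * (χ (p.2 / δ) * glueDeriv (cone N (L + 1) p)) := by
    rintro ⟨x, t⟩
    constructor
    · refine (hasDerivAt_fst (hφd (x, t))).unique ?_
      refine (((hasDerivAt_glue _).comp x (hasDerivAt_cone_fst N (L + 1) x t)).const_mul
        (χ (t / δ))).congr_deriv (by ring)
    · refine (hasDerivAt_snd (hφd (x, t))).unique ?_
      have h1 : HasDerivAt (fun t => χ (t / δ)) (deriv χ (t / δ) * (1 / δ)) t :=
        ((hχ.differentiable (by simp)) (t / δ)).hasDerivAt.comp t
          ((hasDerivAt_id t).div_const δ)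
      refine (h1.mul ((hasDerivAt_glue _).comp t (hasDerivAt_cone_snd N (L + 1) x t))).congr_deriv ?_
      simp only [Function.comp_apply]
      ring
  have hcc : Continuous (cone N (L + 1)) := (contDiff_cone N (L + 1)).continuous
  have hgz : ∀ z : ℝ, z ≤ 0 → glueDeriv z = 0 := fun z hz => by
    simp [glueDeriv, expNegInvGlue.zero_of_nonpos hz]
  have hdabs : ∀ p, |d p| ≤ 2 := fun p => by rw [abs_of_nonneg (hd0 p)]; exact hd2 p
  have hdiv : Continuous fun p : ℝ × ℝ => p.2 / δ := continuous_snd.div_const δ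
  have i1 : Integrable (fun p => d p * (χ (p.2 / δ) * glueDeriv (cone N (L + 1) p)))
      (volume.restrict upperHalf) :=
    integrable_bdd_mul hd hdabs
      ((hχ.continuous.comp hdiv).mul (continuous_glueDeriv.comp hcc))
      (compactSupport_cone hl hδ (fun s hs => hχ0 s hs.le) hgz)
  have i2 : Integrable (fun p => d p *
      (deriv χ (p.2 / δ) / δ * expNegInvGlue (cone N (L + 1) p))) (volume.restrict upperHalf) :=
    integrable_bdd_mul hd hdabs
      ((((hχ.continuous_deriv (by simp)).comp hdiv).div_const δ).mul
        ((expNegInvGlue.contDiff (n := 0)).continuous.comp hcc))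
      (compactSupport_cone (r := fun s => deriv χ s / δ) hl hδ
        (fun s hs => by simp [hχd s fun h => absurd h.1 (not_le.2 hs)])
        fun z hz => expNegInvGlue.zero_of_nonpos hz)
  have hdc := ht.smooth.continuous_fderiv (by simp)
  have hsc := ht.compact.fderiv ℝ
  have i3 : Integrable (fun p => d p * fderiv ℝ
      (fun p : ℝ × ℝ => χ (p.2 / δ) * expNegInvGlue (cone N (L + 1) p)) p (0, 1) + q p * fderiv ℝ
      (fun p : ℝ × ℝ => χ (p.2 / δ) * expNegInvGlue (cone N (L + 1) p)) p (1, 0))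
      (volume.restrict upperHalf) := by
    refine (integrable_bdd_mul hd hdabs (hdc.clm_apply continuous_const)
      (hsc.comp_left (g := fun f : ℝ × ℝ →L[ℝ] ℝ => f (0, 1)) (by simp))).add
      (integrable_bdd_mul (D := L * 2) hq (fun p => (hqd p).trans ?_)
        (hdc.clm_apply continuous_const)
        (hsc.comp_left (g := fun f : ℝ × ℝ →L[ℝ] ℝ => f (1, 0)) (by simp)))
    exact mul_le_mul_of_nonneg_left (hd2 p) hL
  have h0 := (hkato _ ht).trans (integral_mono i3 (i2.sub i1) fun p => ?_)
  · simp only [Pi.sub_apply] at h0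
    rw [integral_sub i2 i1] at h0
    linarith
  · simp only [Pi.sub_apply, (hfd p).1, (hfd p).2]
    have h1 : |p.1 / √(1 + p.1 ^ 2)| ≤ 1 := by
      rw [abs_div, abs_of_nonneg (Real.sqrt_nonneg _), div_le_one (by positivity),
        ← Real.sqrt_sq_eq_abs]
      exact Real.sqrt_le_sqrt (by linarith)
    -- The smoothed modulus `√(1 + x²)` has slope at most `1`, so the lateral flux costs at most `L
    -- d`. The cone speed `L + 1` absorbs it and leaves one full copy of `d`.
    have h2 : -(q p * (p.1 / √(1 + p.1 ^ 2))) ≤ L * d p := by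
      refine (neg_le_abs _).trans ?_
      simpa using abs_mul_le_of_le (hqd p) h1
    have h3 : 0 ≤ χ (p.2 / δ) * glueDeriv (cone N (L + 1) p) :=
      mul_nonneg (hχm _).1 (glueDeriv_nonneg _)
    nlinarith [mul_le_mul_of_nonneg_left h2 h3]

/-- A nonnegative function with vanishing initial trace which satisfies the energy estimates
vanishes. -/
lemma ae_eq_zero_of_cone_estimate (hd : Measurable d) (hd0 : ∀ p, 0 ≤ d p) (hd2 : ∀ p, d p ≤ 2)
    (hq : Measurable q) (hL : 0 ≤ L) (hqd : ∀ p, |q p| ≤ L * d p)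
    (hkato : ∀ φ, IsTest φ →
      0 ≤ ∫ p in upperHalf, (d p * fderiv ℝ φ p (0, 1) + q p * fderiv ℝ φ p (1, 0)))
    (hinit : ∀ N κ : ℝ, 0 < N → 0 < κ → ∃ τ, 0 < τ ∧ ∀ᵐ t : ℝ, 0 < t → t < τ →
      ∫ x in Icc (-N) N, d (x, t) ≤ κ) :
    ∀ᵐ p ∂(volume.restrict upperHalf), d p = 0 := by
  obtain ⟨χ, hχ, hχm, hχ0, hχ1, hχd, C, hC, hχC⟩ := exists_cutoff
  have hl : 1 ≤ L + 1 := by linarith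
  have hgz : ∀ z : ℝ, z ≤ 0 → glueDeriv z = 0 := fun z hz => by
    simp [glueDeriv, expNegInvGlue.zero_of_nonpos hz]
  have hdabs : ∀ p, |d p| ≤ 2 := fun p => by rw [abs_of_nonneg (hd0 p)]; exact hd2 p
  set f : ℝ → ℝ → ℝ × ℝ → ℝ := fun N δ p =>
    d p * (χ (p.2 / δ) * glueDeriv (cone N (L + 1) p)) with hf
  have hfi : ∀ N δ, 0 < δ → Integrable (f N δ) (volume.restrict upperHalf) := fun N δ hδ =>
    integrable_bdd_mul hd hdabs
      ((hχ.continuous.comp (continuous_snd.div_const δ)).mul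
        (continuous_glueDeriv.comp (contDiff_cone N (L + 1)).continuous))
      (compactSupport_cone hl hδ (fun s hs => hχ0 s hs.le) hgz)
  have hf0 : ∀ N δ p, 0 ≤ f N δ p := fun N δ p =>
    mul_nonneg (hd0 p) (mul_nonneg (hχm _).1 (glueDeriv_nonneg _))
  have hbound : ∀ N κ : ℝ, 0 < N → 0 < κ → ∃ τ, 0 < τ ∧ ∀ δ, 0 < δ → δ < τ →
      ∫ p in upperHalf, f N δ p ≤ C * κ := by
    intro N κ hN hκ
    obtain ⟨τ, hτ, h⟩ := hinit N κ hN hκ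
    -- The derivative of the time cutoff lives on `[δ, 2δ]`, which has to lie below `τ`. It is of
    -- size `C / δ` on an interval of length `δ`, whence the bound `C κ`.
    refine ⟨τ / 3, by linarith, fun δ hδ hδτ => ?_⟩
    refine (cone_estimate hd hd0 hd2 hq hL hqd hkato hχ hχm hχ0 hχd hδ N).trans ?_
    set g : ℝ × ℝ → ℝ := fun p =>
      d p * (deriv χ (p.2 / δ) / δ * expNegInvGlue (cone N (L + 1) p)) with hg
    have hgi : Integrable g (volume.restrict upperHalf) :=
      integrable_bdd_mul hd hdabs
        ((((hχ.continuous_deriv (by simp)).comp (continuous_snd.div_const δ)).div_const δ).mul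
          ((expNegInvGlue.contDiff (n := 0)).continuous.comp (contDiff_cone N (L + 1)).continuous))
        (compactSupport_cone (r := fun s => deriv χ s / δ) hl hδ
          (fun s hs => by simp [hχd s fun h => absurd h.1 (not_le.2 hs)])
          fun z hz => expNegInvGlue.zero_of_nonpos hz)
    rw [restrict_upperHalf] at hgi ⊢
    rw [integral_prod_symm _ hgi]
    have hind : Integrable ((Icc δ (2 * δ)).indicator fun _ : ℝ => C / δ * κ)
        (volume.restrict (Ioi 0)) :=
      ((integrable_indicator_iff measurableSet_Icc).2
        (integrableOn_const measure_Icc_lt_top.ne)).restrict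
    have hle : ∀ᵐ t ∂(volume.restrict (Ioi (0 : ℝ))),
        ∫ x, g (x, t) ≤ (Icc δ (2 * δ)).indicator (fun _ => C / δ * κ) t := by
      filter_upwards [ae_restrict_of_ae h, ae_restrict_mem measurableSet_Ioi] with t ht ht0
      by_cases hm : t ∈ Icc δ (2 * δ)
      · rw [indicator_of_mem hm]
        have h1 := ht ht0 (by linarith [hm.2])
        have hdt : Measurable fun x => d (x, t) := hd.comp (by fun_prop)
        have hdi : Integrable ((Icc (-N) N).indicator fun x => d (x, t)) := by
          refine (integrable_indicator_iff measurableSet_Icc).2 ?_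
          refine Measure.integrableOn_of_bounded (M := 2) measure_Icc_lt_top.ne
            hdt.aestronglyMeasurable (Eventually.of_forall fun x => hdabs _)
        calc ∫ x, g (x, t) ≤ ∫ x, C / δ * (Icc (-N) N).indicator (fun x => d (x, t)) x := by
              refine (le_abs_self _).trans ?_
              rw [← Real.norm_eq_abs]
              refine norm_integral_le_of_norm_le (hdi.const_mul _)
                (Eventually.of_forall fun x => ?_)
              by_cases hx : x ∈ Icc (-N) N
              · rw [indicator_of_mem hx, Real.norm_eq_abs, abs_mul, abs_of_nonneg (hd0 _), abs_mul,
                  abs_div, abs_of_pos hδ, abs_of_nonneg (expNegInvGlue.nonneg _), mul_comm]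
                refine mul_le_mul_of_nonneg_right ?_ (hd0 _)
                refine (mul_le_of_le_one_right (by positivity) (expNegInvGlue_le_one _)).trans ?_
                exact div_le_div_of_nonneg_right (hχC _) hδ.le
              · have hcz : cone N (L + 1) (x, t) ≤ 0 := by
                  by_contra hc
                  exact hx (abs_le.1 (mem_box.1 (mem_box_of_cone_pos hl hδ (not_le.1 hc) hm.1)).1)
                simp [hg, hx, expNegInvGlue.zero_of_nonpos hcz]
          _ = C / δ * ∫ x in Icc (-N) N, d (x, t) := by
              rw [integral_const_mul, integral_indicator measurableSet_Icc]
          _ ≤ C / δ * κ := mul_le_mul_of_nonneg_left h1 (by positivity)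
      · rw [indicator_of_notMem hm]
        have h1 : deriv χ (t / δ) = 0 := hχd _ fun h' => hm
          ⟨by simpa using (le_div_iff₀ hδ).1 h'.1, (div_le_iff₀ hδ).1 h'.2⟩
        simp [hg, h1]
    refine (integral_mono_ae hgi.integral_prod_right hind hle).trans ?_
    refine (setIntegral_le_integral ((integrable_indicator_iff measurableSet_Icc).2
      (integrableOn_const measure_Icc_lt_top.ne)) (Eventually.of_forall fun t =>
        indicator_nonneg (fun _ _ => by positivity) t)).trans_eq ?_
    rw [integral_indicator measurableSet_Icc, setIntegral_const, smul_eq_mul, Measure.real,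
      Real.volume_Icc, ENNReal.toReal_ofReal (by linarith)]
    field_simp
    ring
  have hzero : ∀ N δ : ℝ, 0 < N → 0 < δ → f N δ =ᵐ[volume.restrict upperHalf] 0 := by
    intro N δ hN hδ
    refine (integral_eq_zero_iff_of_nonneg (hf0 N δ) (hfi N δ hδ)).1 (le_antisymm ?_
      (integral_nonneg (hf0 N δ)))
    refine le_of_forall_pos_le_add fun κ hκ => ?_
    obtain ⟨τ, hτ, h⟩ := hbound N (κ / C) hN (by positivity)
    -- The integrand grows as the cutoff time shrinks: where `χ (t / δ)` is nonzero, the cutoff with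
    -- parameter at most `δ / 2` equals `1`. Hence the integral for fixed `δ` is bounded by
    -- arbitrarily small ones.
    have hm : 0 < min (δ / 2) (τ / 2) := by positivity
    have h1 := h _ hm ((min_le_right _ _).trans_lt (by linarith))
    rw [mul_div_cancel₀ _ hC.ne'] at h1
    rw [zero_add]
    refine (integral_mono (hfi N δ hδ) (hfi N _ hm) fun p => ?_).trans h1
    refine mul_le_mul_of_nonneg_left (mul_le_mul_of_nonneg_right ?_ (glueDeriv_nonneg _)) (hd0 p)
    by_cases hp : p.2 / δ ≤ 1
    · rw [hχ0 _ hp]; exact (hχm _).1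
    · rw [hχ1 (p.2 / min (δ / 2) (τ / 2))]
      · exact (hχm _).2
      · rw [not_le, one_lt_div hδ] at hp
        rw [le_div_iff₀ hm]
        have := min_le_left (δ / 2) (τ / 2)
        linarith
  have hall : ∀ᵐ p ∂(volume.restrict upperHalf), ∀ n : ℕ,
      f (n + 1) (1 / (n + 1 : ℝ)) p = 0 := by
    rw [ae_all_iff]
    exact fun n => hzero _ _ (by positivity) (by positivity)
  filter_upwards [hall, ae_restrict_mem measurableSet_upperHalf] with p hp hp0
  have ht : 0 < p.2 := hp0
  -- For such `n` the point lies inside the cone of height `n + 1` and after time `2 / (n + 1)`, so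
  -- the weight multiplying `d p` is strictly positive.
  obtain ⟨n, hn⟩ := exists_nat_gt (max (2 / p.2) (√(1 + p.1 ^ 2) + (L + 1) * p.2))
  have h1 : 2 / p.2 < n := (le_max_left _ _).trans_lt hn
  have h2 : √(1 + p.1 ^ 2) + (L + 1) * p.2 < n := (le_max_right _ _).trans_lt hn
  have h3 : 0 < cone (n + 1) (L + 1) p := by unfold cone; linarith
  have h4 : χ (p.2 / (1 / (n + 1 : ℝ))) = 1 := by
    refine hχ1 _ ?_
    rw [div_lt_iff₀ ht] at h1
    rw [div_div_eq_mul_div, div_one]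
    nlinarith
  have h5 := hp n
  simp only [hf, h4, one_mul] at h5
  have h6 : 0 < glueDeriv (cone (n + 1) (L + 1) p) :=
    mul_pos (by positivity) (expNegInvGlue.pos_of_pos h3)
  exact (mul_eq_zero.1 h5).resolve_right h6.ne'

/-- Uniqueness of entropy solutions of the Riemann problem. -/
theorem Profile.unique (hP : Profile G U uL uR) (hG : LipOn G L) (hGm : Measurable G)
    {u : ℝ → ℝ → ℝ} (hu : IsEntropySolution G (step uL uR) u) :
    ∀ᵐ p : ℝ × ℝ ∂(volume.restrict upperHalf), u p.1 p.2 = U (p.1 / p.2) := by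
  have hUs := hP.isEntropySolution hG hGm
  have hUm := hP.measurable
  have hstep : Measurable (step uL uR) :=
    Measurable.ite measurableSet_Iic measurable_const measurable_const
  have hstepm : ∀ x, step uL uR x ∈ Icc (-1 : ℝ) 1 := step_mem hP
  -- A measurable representative, clamped to `[-1, 1]` so that the bounds hold at every point and
  -- not only almost everywhere.
  set w : ℝ × ℝ → ℝ := fun p => max (-1) (min 1 (hu.aemeasurable.mk _ p)) with hw
  have hwm : Measurable w := measurable_const.max (measurable_const.min hu.aemeasurable.measurable_mk)
  have hwI : ∀ p, w p ∈ Icc (-1 : ℝ) 1 := fun p =>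
    ⟨le_max_left _ _, max_le (by norm_num) (min_le_left _ _)⟩
  have hwu : ∀ᵐ p ∂(volume.restrict upperHalf), u p.1 p.2 = w p := by
    filter_upwards [hu.aemeasurable.ae_eq_mk, hu.mem_Icc] with p h1 h2
    simp only [hw, ← h1]
    rw [min_eq_right h2.2, max_eq_right h2.1]
  have hent : ∀ k ∈ Icc (-1 : ℝ) 1, ∀ φ, IsTest φ → 0 ≤ ∫ p in upperHalf,
      (|w p - k| * fderiv ℝ φ p (0, 1) + kq G (w p) k * fderiv ℝ φ p (1, 0)) := by
    intro k hk φ hφ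
    refine (hu.entropy k hk φ hφ.smooth hφ.compact hφ.sub hφ.nonneg).trans_eq
      (integral_congr_ae ?_)
    filter_upwards [hwu] with p hp
    simp only [hp, kq]
  have hvm : Measurable fun p : ℝ × ℝ => U (p.1 / p.2) :=
    hP.measurable.comp (measurable_fst.div measurable_snd)
  have hdm : Measurable fun p : ℝ × ℝ => |w p - U (p.1 / p.2)| := by fun_prop
  have hqm : Measurable fun p : ℝ × ℝ => kq G (w p) (U (p.1 / p.2)) :=
    (RiemannPhase.measurable_kq hGm).comp (hwm.prodMk hvm)
  have hae : ∀ᵐ t : ℝ, 0 < t → ∀ᵐ x : ℝ, u x t = w (x, t) := by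
    have h1 : ∀ᵐ p ∂((volume.restrict (Ioi (0 : ℝ))).prod (volume : Measure ℝ)),
        u p.2 p.1 = w (p.2, p.1) := by
      rw [restrict_upperHalf] at hwu
      exact (Measure.measurePreserving_swap.quasiMeasurePreserving.ae hwu)
    exact (ae_restrict_iff' measurableSet_Ioi).1 (Measure.ae_ae_of_ae_prod h1)
  have hinit : ∀ N κ : ℝ, 0 < N → 0 < κ → ∃ τ, 0 < τ ∧ ∀ᵐ t : ℝ, 0 < t → t < τ →
      ∫ x in Icc (-N) N, |w (x, t) - U (x / t)| ≤ κ := by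
    intro N κ hN hκ
    -- Both solutions have the same initial trace, so the triangle inequality makes their distance
    -- small for almost all small times; the exceptional null set comes from the filter in the
    -- definition.
    have h1 := ((hu.initial N hN).add (hUs.initial N hN)).eventually
      (gt_mem_nhds (by simpa using hκ : (0 : ℝ) + 0 < κ))
    obtain ⟨s₁, hs₁, s₂, hs₂, hss⟩ := mem_inf_iff_superset.1 h1
    obtain ⟨τ, hτ, hs₃⟩ := mem_nhdsGT_iff_exists_Ioo_subset.1 hs₁
    refine ⟨τ, hτ, ?_⟩
    filter_upwards [hs₂, hae] with t ht hta ht0 htτ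
    have h2 := hss ⟨hs₃ ⟨ht0, htτ⟩, ht⟩
    simp only [mem_ofPred_eq] at h2
    have hb : ∀ f : ℝ → ℝ, Measurable f → (∀ x, |f x| ≤ 2) → IntegrableOn f (Icc (-N) N) :=
      fun f hf h => Measure.integrableOn_of_bounded (M := 2) measure_Icc_lt_top.ne
        hf.aestronglyMeasurable (Eventually.of_forall fun x => h x)
    have hwt : Measurable fun x => w (x, t) := hwm.comp (by fun_prop)
    have hUt : Measurable fun x => U (x / t) := hP.measurable.comp (by fun_prop)
    have e1 : ∫ x in Icc (-N) N, |u x t - step uL uR x| =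
        ∫ x in Icc (-N) N, |w (x, t) - step uL uR x| := by
      refine integral_congr_ae ?_
      filter_upwards [ae_restrict_of_ae (hta ht0)] with x hx
      rw [hx]
    have i1 := hb (fun x => |w (x, t) - step uL uR x|) (by fun_prop) fun x => by
      rw [abs_abs]; exact abs_sub_le_two (hwI _) (hstepm x)
    have i2 := hb (fun x => |U (x / t) - step uL uR x|) (by fun_prop) fun x => by
      rw [abs_abs]; exact abs_sub_le_two (hP.mem _) (hstepm x)
    have i3 := hb (fun x => |w (x, t) - U (x / t)|) (by fun_prop) fun x => by
      rw [abs_abs]; exact abs_sub_le_two (hwI _) (hP.mem _)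
    rw [e1, ← integral_add i1 i2] at h2
    refine (integral_mono i3 (i1.add i2) fun x => ?_).trans h2.le
    simp only [Pi.add_apply]
    rw [abs_sub_comm (U (x / t))]
    exact abs_sub_le _ _ _
  have h0 := ae_eq_zero_of_cone_estimate hdm (fun p => abs_nonneg _)
    (fun p => abs_sub_le_two (hwI p) (hP.mem _)) hqm hG.nonneg
    (fun p => abs_kq_le hG (hwI p) (hP.mem _))
    (fun φ hφ => hP.kato hG hGm hwm hwI hent hφ) hinit
  filter_upwards [hwu, h0] with p h1 h2
  rw [h1]
  exact sub_eq_zero.1 (abs_eq_zero.1 h2)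

end

end RiemannPhase

namespace RiemannPhase

/-! ### The Riemann problem -/

section

variable {b : ℝ}

lemma flux_le_tangent (hb : Admissible b) (h6 : 1 / 6 ≤ b) {v e : ℝ} (hv : v ∈ Icc (-1 : ℝ) 1)
    (he : e ∈ Icc (-1 : ℝ) 1) : flux b v ≤ flux b e + deriv (flux b) e * (v - e) := by
  rcases eq_or_ne v e with rfl | hne
  · simp
  · exact (flux_lt_tangent hb h6 hv he hne).le

/-- The stationary shock between the two maximum points of the flux. -/
lemma stationary_shock {U : ℝ → ℝ} {uL uR m : ℝ}
    (h : IsRSR (flux b) U uL m (-m) uR) :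
    shockSpeed (flux b) m (-m) = 0 ∧ ∀ t : ℝ, 0 < t → ∃ l r : ℝ,
      Tendsto (fun x => U (x / t)) (𝓝[<] 0) (𝓝 l) ∧
      Tendsto (fun x => U (x / t)) (𝓝[>] 0) (𝓝 r) ∧ r - l = -2 * m := by
  have h0 : shockSpeed (flux b) m (-m) = 0 := by simp [shockSpeed, flux_neg]
  obtain ⟨-, ⟨-, hl, hr⟩, -⟩ := h
  rw [h0] at hl hr
  refine ⟨h0, fun t ht => ⟨m, -m, hl.comp ?_, hr.comp ?_, by ring⟩⟩
  all_goals
    have hc : Tendsto (fun x : ℝ => x / t) (𝓝 0) (𝓝 0) := by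
      simpa using (continuous_id.div_const t).tendsto (0 : ℝ)
  · exact tendsto_nhdsWithin_iff.2 ⟨hc.mono_left nhdsWithin_le_nhds,
      eventually_nhdsWithin_of_forall fun x hx => div_neg_of_neg_of_pos hx ht⟩
  · exact tendsto_nhdsWithin_iff.2 ⟨hc.mono_left nhdsWithin_le_nhds,
      eventually_nhdsWithin_of_forall fun x hx => div_pos hx ht⟩

end

end RiemannPhase

open RiemannPhase in
theorem mainTheorem2 (b : ℝ) (hb : 0 < b) (hb' : b ≤ 1 / (2 + Real.sqrt 2))
    (uL uR : ℝ) (huL : uL ∈ Set.Icc (-1 : ℝ) 1) (huR : uR ∈ Set.Icc (-1 : ℝ) 1) (hne : uL ≠ uR) :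
    ∃ U : ℝ → ℝ,
      -- the self-similar function `U (x / t)` is the unique entropy solution
      IsEntropySolution (flux b) (step uL uR) (fun x t => U (x / t)) ∧
      (∀ u : ℝ → ℝ → ℝ, IsEntropySolution (flux b) (step uL uR) u →
        ∀ᵐ p : ℝ × ℝ ∂(volume.restrict upperHalf), u p.1 p.2 = U (p.1 / p.2)) ∧
      -- it is given by the envelope formula
      EnvelopeFormula (flux b) U uL uR ∧
      -- only pure shocks and pure fans for `b ≥ 1/6`
      (1 / 6 ≤ b →
        (uL < uR → HasPattern (flux b) U uL uR .S) ∧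
        (uR < uL → HasPattern (flux b) U uL uR .R)) ∧
      -- the phase diagram for `b < 1/6`
      (b < 1 / 6 →
        (∃! w : Pattern, InRegion b uL uR w) ∧
        (∀ w : Pattern, InRegion b uL uR w → HasPattern (flux b) U uL uR w) ∧
        (InRegion b uL uR .RSR →
          IsRSR (flux b) U uL (vMax b) (-vMax b) uR ∧
          shockSpeed (flux b) (vMax b) (-vMax b) = 0 ∧
          ∀ t : ℝ, 0 < t → ∃ l r : ℝ,
            Tendsto (fun x => U (x / t)) (𝓝[<] 0) (𝓝 l) ∧
            Tendsto (fun x => U (x / t)) (𝓝[>] 0) (𝓝 r) ∧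
            r - l = -2 * vMax b)) := by
  have ha := Admissible.of_le hb hb'
  have hG := lipOn_flux ha
  have hGm := measurable_flux b
  have coords : b < 1 / 6 → ∀ v, ∃ x, st b x = v := fun h v => ⟨_, Small.st_co ⟨hb, h⟩ v⟩
  rcases lt_or_gt_of_ne hne with hlt | hlt
  -- Increasing data: maximizers for the reflected flux on `[-uR, -uL]` become, after a change of
  -- sign, minimizers for the flux itself.
  · obtain ⟨V, hV⟩ := exists_maxSel hG.neg (a := -uR) (c := -uL) (by linarith [huR.2])
      (by linarith) (by linarith [huL.1])
    have hP := (hV.profile hG.neg (by linarith [huR.2]) (by linarith) (by linarith [huL.1])).neg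
    have hmin := hV.neg
    refine ⟨fun ξ => -V ξ, hP.isEntropySolution hG hGm, fun u hu => hP.unique hG hGm hu,
      ⟨fun h => absurd h hlt.not_gt, fun _ ξ => ⟨(hmin ξ).1, hmin.envelope ξ⟩⟩,
      fun h6 => ⟨fun _ => ?_, fun h => absurd h hlt.not_gt⟩, fun h6 => ?_⟩
    · refine hV.reflect_isS hlt fun w hw => ?_
      have hwm : w ∈ Set.Icc (-1 : ℝ) 1 := ⟨huL.1.trans hw.1, hw.2.trans huR.2⟩
      -- The tangent inequalities at `w`, tested at `uL` and `uR` with weights `uR - w` and `w -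
      -- uL`, cancel the derivative and leave the chord inequality.
      nlinarith [mul_le_mul_of_nonneg_left (flux_le_tangent ha h6 huL hwm) (sub_nonneg.2 hw.2),
        mul_le_mul_of_nonneg_left (flux_le_tangent ha h6 huR hwm) (sub_nonneg.2 hw.1)]
    · have hs : Small b := ⟨hb, h6⟩
      obtain ⟨w₀, h1, h2⟩ : ∃ w₀, (∀ w, InRegion b uL uR w ↔ w = w₀) ∧
          HasPattern (flux b) (fun ξ => -V ξ) uL uR w₀ := by
        obtain ⟨x, rfl⟩ := coords h6 uL
        obtain ⟨y, rfl⟩ := coords h6 uR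
        exact hs.ascending (hs.st_co _) (hs.st_co _) hs.hypParams
          (hs.strictMono_st.lt_iff_lt.1 hlt) huL huR hV
      refine ⟨⟨w₀, (h1 w₀).2 rfl, fun w hw => (h1 w).1 hw⟩, fun w hw => ?_, fun h => ?_⟩
      · rw [(h1 w).1 hw]; exact h2
      · have h3 : vMax b < uL ∧ uR < -vMax b := h
        linarith [hs.vMax_pos, h3.1, h3.2]
  · obtain ⟨U, hU⟩ := exists_maxSel hG huR.1 hlt.le huL.2
    have hP := hU.profile hG huR.1 hlt.le huL.2
    refine ⟨U, hP.isEntropySolution hG hGm, fun u hu => hP.unique hG hGm hu,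
      ⟨fun _ ξ => ⟨(hU ξ).1, hU.envelope ξ⟩, fun h => absurd h hlt.not_gt⟩,
      fun h6 => ⟨fun h => absurd h hlt.not_gt, fun _ => ?_⟩, fun h6 => ?_⟩
    · have hsub : Set.Icc uR uL ⊆ Set.Icc (-1) 1 := Set.Icc_subset_Icc huR.1 huL.2
      exact hU.isR hlt ((continuousOn_deriv_flux ha).mono hsub) fun e he v hv hne =>
        flux_lt_tangent ha h6 (hsub hv) (hsub (Set.Ioo_subset_Icc_self he)) hne
    · have hs : Small b := ⟨hb, h6⟩
      have hst : ∀ {x y}, st b x < st b y → x < y := fun h => hs.strictMono_st.lt_iff_lt.1 h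
      obtain ⟨w₀, h1, h2⟩ : ∃ w₀, (∀ w, InRegion b uL uR w ↔ w = w₀) ∧
          HasPattern (flux b) U uL uR w₀ := by
        obtain ⟨x, rfl⟩ := coords h6 uL
        obtain ⟨y, rfl⟩ := coords h6 uR
        exact hs.descending (hs.st_co _) (hs.st_co _) hs.hypParams (hst hlt) huR huL hU
      refine ⟨⟨w₀, (h1 w₀).2 rfl, fun w hw => (h1 w).1 hw⟩, fun w hw => ?_, fun h => ?_⟩
      · rw [(h1 w).1 hw]; exact h2
      · have h3 : vMax b < uL ∧ uR < -vMax b := h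
        -- The general pattern only asserts that some intermediate states exist; the construction is
        -- invoked again to identify them as `±vMax`.
        have h4 : IsRSR (flux b) U uL (vMax b) (-vMax b) uR := by
          have hm := hs.st_co (vMax b)
          obtain ⟨x, rfl⟩ := coords h6 uL
          obtain ⟨y, rfl⟩ := coords h6 uR
          rw [← hm, ← st_neg] at h3 ⊢
          exact hs.desc_isRSR hs.hypParams (hst h3.2) (hst h3.1) huR huL hU
        exact ⟨h4, stationary_shock h4⟩
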